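/- Let $k$ be a field and let $A$ be a finite-dimensional Frobenius $k$-algebra: there is a nondegenerate bilinear form $\langle\,,\rangle$ on $A$ with $\langle ab,c\rangle=\langle a,bc\rangle$. Let $\nu$ be its Nakayama automorphism, $\langle a,b\rangle=\langle b,\nu(a)\rangle$. Put $A^e=A\otimes_k A^{\mathrm{op}}$. Bimodules (with $k$ acting centrally) are left $A^e$-modules by $(a\otimes b)m=amb$, and right ones by $m(a\otimes b)=bma$. For automorphisms $\alpha,\beta$ of $A$ let ${}_\alpha M_\beta$ be $M$ with the action $a*m*b=\alpha(a)\,m\,\beta(b)$. For a bimodule $X$ let $X^\vee=\mathrm{Hom}_{A^e}(X,A^e)$ with $(afb)(x)=f(x)(b\otimes a)$. A complete resolution $T\xrightarrow{\varepsilon}A$ is an exact complex $T$ of finitely generated projective bimodules such that $T^\vee$ is exact, together with a map $\varepsilon:T_0\to A$ for which $T_{\ge0}\to A$ is a projective resolution; let $\eta:A\to T_{-1}$ be the map with $\eta\varepsilon=d_0$. Tate–Hochschild (co)homology is $\hat H^n(A,M)=H^n(\mathrm{Hom}_{A^e}(T,M))$ and $\hat H_n(A,M)=H_n(T\otimes_{A^e}M)$,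 $n\in\mathbb Z$. A diagonal approximation is a chain map $\Delta:T\to T\hat\otimes_A T$, where $(T\hat\otimes_A T)_n=\prod_{p+q=n}T_p\otimes_A T_q$, with $(\varepsilon\hat\otimes\varepsilon)\Delta=\varepsilon$ under $A\otimes_AA=A$. The cap product $\frown\colon\hat H^r(A,M)\times\hat H_s(A,N)\to\hat H_{s-r}(A,M\otimes_AN)$ is induced by $$u\frown(x\otimes n)=(-1)^{r(s-r)}\sum x'\otimes_{A^e}(u(x'')\otimes_A n),$$ where $\sum x'\otimes x''$ is the component of $\Delta(x)$ in $T_{s-r}\otimes_AT_r$. The fundamental class $\omega\in\hat H_{-1}(A,{}_1A_{\nu^{-1}})$ is the element that corresponds to $1=[\varepsilon]\in\hat H^0(A,A)$ under the duality isomorphism $\hat H^n(A,M)\cong\hat H_{-n-1}(A,{}_1M_{\nu^{-1}})$ (for $n=0$, $M=A$), which is the composite $$H^n(\mathrm{Hom}_{A^e}(T,M))\cong H_{-n}\bigl({}_{\nu^{-1}}(T^\vee)_1\otimes_{A^e}{}_1M_{\nu^{-1}}\bigr)=H_{-n-1}(T'\otimes_{A^e}{}_1M_{\nu^{-1}})\cong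 H_{-n-1}(T\otimes_{A^e}{}_1M_{\nu^{-1}}).$$ Here the first isomorphism is inverse to $f\otimes m\mapsto(x\mapsto f(x)m)$. The complex $T'$ has $T'_j={}_{\nu^{-1}}((T_i)^\vee)_1$ for $i+j=-1$, with differential $f\mapsto(-1)^if\circ d$ on $(T_i)^\vee$, so that $\Sigma T'={}_{\nu^{-1}}(T^\vee)_1$; it is a complete resolution of $A$ with the augmentation $\varepsilon'$ determined by $t(\nu^{-1}(\varepsilon'(f)))=-f\circ\eta$ for $f\in(T_{-1})^\vee$, where $t:{}_1A_{\nu^{-1}}\to A^\vee$ is the isomorphism $t(x)(y)=\sum_iy\,u_i\,\nu(x)\otimes v_i$ for dual bases, $\langle v_i,u_j\rangle=\delta_{ij}$. The last isomorphism is induced by a chain map $\theta:T'\to T$ with $\varepsilon\theta=\varepsilon'$. **Theorem.** Complete resolutions $T$ of $A$ exist, each has a diagonal approximation, and each has exactly one fundamental class $\omega\in\hat H_{-1}(A,{}_1A_{\nu^{-1}})$. For every complete resolution $T$, every diagonal approximation $\Delta$, every $n\in\mathbb Z$ and every $A$-bimodule $M$, the cap product with $\omega$ is a $k$-linear isomorphism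 $$-\frown\omega:\hat H^n(A,M)\longrightarrow\hat H_{-n-1}(A,{}_1M_{\nu^{-1}}),$$ where $M\otimes_A{}_1A_{\nu^{-1}}$ is identified with ${}_1M_{\nu^{-1}}$ by $m\otimes a\mapsto ma$. -/

import Mathlib

universe u v w w' w''

noncomputable section

namespace TateHochschild

open scoped TensorProduct ModuleCat
open MulOpposite

set_option linter.unusedSectionVars false

/-! ## Bimodules as modules over the enveloping algebra -/

section Bimodules

variable (k : Type u) (A : Type v) [Field k] [Ring A] [Algebra k A]

/-- The enveloping algebra `Aᵉ = A ⊗ Aᵒᵖ`. An `A`-bimodule (with `k` acting centrally) is the same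
as a left `Aᵉ`-module, through `(a ⊗ bᵒ) m = a m b`. -/
def Env : Type v := A ⊗[k] Aᵐᵒᵖ

instance : Ring (Env k A) := inferInstanceAs (Ring (A ⊗[k] Aᵐᵒᵖ))

instance : Algebra k (Env k A) := inferInstanceAs (Algebra k (A ⊗[k] Aᵐᵒᵖ))

variable {A}

/-- The element `a ⊗ bᵒ` of `Aᵉ`. -/
def env (a b : A) : Env k A := a ⊗ₜ[k] op b

theorem env_mul (a b a' b' : A) : env k a b * env k a' b' = env k (a * a') (b' * b) :=
  Algebra.TensorProduct.tmul_mul_tmul (R := k) a a' (op b) (op b')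

theorem env_one : env k (1 : A) 1 = 1 := rfl

theorem env_add_left (a a' b : A) : env k (a + a') b = env k a b + env k a' b :=
  TensorProduct.add_tmul a a' (op b)

theorem env_add_right (a b b' : A) : env k a (b + b') = env k a b + env k a b' :=
  TensorProduct.tmul_add a (op b) (op b')

theorem env_smul_left (r : k) (a b : A) : env k (r • a) b = r • env k a b :=
  TensorProduct.smul_tmul' r a (op b)

theorem env_smul_right (r : k) (a b : A) : env k a (r • b) = r • env k a b :=
  TensorProduct.tmul_smul r a (op b)

variable {k}

theorem env_induction {motive : Env k A → Prop} (c : Env k A) (zero : motive 0)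
    (env : ∀ a b, motive (env k a b)) (add : ∀ x y, motive x → motive y → motive (x + y)) :
    motive c :=
  TensorProduct.induction_on (motive := motive) c zero (fun a b => env a b.unop) add

/-- An additive map that commutes with all `a ⊗ bᵒ` commutes with `Aᵉ`. -/
theorem map_env_smul {M : Type w} {N : Type w'} [AddCommGroup M] [Module (Env k A) M]
    [AddCommGroup N] [Module (Env k A) N] (f : M →+ N)
    (hf : ∀ (a b : A) m, f (env k a b • m) = env k a b • f m) (c : Env k A) (m : M) :
    f (c • m) = c • f m := by
  induction c using env_induction with
  | zero => simp
  | env a b => exact hf a b m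
  | add x y hx hy => simp only [add_smul, map_add, hx, hy]

variable (k A)

/-- The action of `Aᵉ` on `A` by `(a ⊗ bᵒ) x = a x b`. -/
def regularAction : Env k A →ₐ[k] Module.End k A := AlgHom.mulLeftRight k A

/-- The algebra `A` as a bimodule over itself. -/
instance regularBimodule :
    @Module (Env k A) A _ (@AddCommGroup.toAddCommMonoid A Ring.toAddCommGroup) :=
  Module.compHom A (regularAction k A).toRingHom

variable {A}

theorem env_smul_self (a b x : A) : env k a b • x = a * x * b :=
  AlgHom.mulLeftRight_apply k A a (op b) x

variable (A)

instance : IsScalarTower k (Env k A) A where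
  smul_assoc r c x := by
    change regularAction k A (r • c) x = r • regularAction k A c x
    rw [map_smul, LinearMap.smul_apply]

variable {k A} in
/-- Two commuting algebra maps from `A` and `Aᵒᵖ` define one from `Aᵉ`. -/
def Env.lift {C : Type w} [Ring C] [Algebra k C] (f : A →ₐ[k] C) (g : Aᵐᵒᵖ →ₐ[k] C)
    (h : ∀ a b, Commute (f a) (g b)) : Env k A →ₐ[k] C :=
  Algebra.TensorProduct.lift f g h

variable {k A} in
theorem Env.lift_env {C : Type w} [Ring C] [Algebra k C] (f : A →ₐ[k] C) (g : Aᵐᵒᵖ →ₐ[k] C)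
    (h : ∀ a b, Commute (f a) (g b)) (a b : A) : Env.lift f g h (env k a b) = f a * g (op b) :=
  Algebra.TensorProduct.lift_tmul f g h a (op b)

/-- The anti-automorphism `a ⊗ bᵒ ↦ b ⊗ aᵒ` of `Aᵉ`. It turns left `Aᵉ`-modules into right ones, so
that a bimodule is a right `Aᵉ`-module by `m (a ⊗ bᵒ) = b m a`. -/
def flip : Env k A →ₐ[k] (Env k A)ᵐᵒᵖ :=
  Env.lift
    (AlgHom.opComm.symm (Algebra.TensorProduct.includeRight : Aᵐᵒᵖ →ₐ[k] A ⊗[k] Aᵐᵒᵖ))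
    (AlgHom.op (Algebra.TensorProduct.includeLeft : A →ₐ[k] A ⊗[k] Aᵐᵒᵖ))
    (fun a b => congrArg op (by
      have h₁ := env_mul k 1 a b.unop 1
      have h₂ := env_mul k b.unop 1 1 a
      simp only [one_mul, mul_one] at h₁ h₂
      exact h₂.trans h₁.symm))

variable {A}

theorem flip_env (a b : A) : flip k A (env k a b) = op (env k b a) := by
  refine (Env.lift_env _ _ _ a b).trans (congrArg op ?_)
  have h := env_mul k b 1 1 a
  simp only [mul_one] at h
  exact h

/-- The algebra endomorphism `α ⊗ βᵒ` of `Aᵉ`. -/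
def envMap (α β : A ≃ₐ[k] A) : Env k A →ₐ[k] Env k A :=
  Algebra.TensorProduct.map α.toAlgHom (AlgHom.op β.toAlgHom)

theorem envMap_env (α β : A ≃ₐ[k] A) (a b : A) :
    envMap k α β (env k a b) = env k (α a) (β b) := rfl

end Bimodules

/-! ## Twisted bimodules -/

section Twist

variable {k : Type u} {A : Type v} [Field k] [Ring A] [Algebra k A]

/-- The twisted bimodule `_α M_β`: the space `M` with the action `a * m * b = α(a) m β(b)`. -/
def Twist (_α _β : A ≃ₐ[k] A) (M : Type w) : Type w := M

variable (α β : A ≃ₐ[k] A) (M : Type w) [AddCommGroup M] [Module k M] [Module (Env k A) M]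
  [IsScalarTower k (Env k A) M]

instance : AddCommGroup (Twist α β M) := inferInstanceAs (AddCommGroup M)

instance : Module k (Twist α β M) := inferInstanceAs (Module k M)

instance : Module (Env k A) (Twist α β M) := Module.compHom M (envMap k α β).toRingHom

/-- The identity map from `M` to `_α M_β`. -/
def toTwist : M ≃ₗ[k] Twist α β M := LinearEquiv.refl k M

variable {M}

theorem smul_toTwist (c : Env k A) (m : M) :
    c • toTwist α β M m = toTwist α β M (envMap k α β c • m) := rfl

variable (M)

instance : IsScalarTower k (Env k A) (Twist α β M) where
  smul_assoc r c m := by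
    have h := smul_assoc r (envMap k α β c) ((toTwist α β M).symm m)
    rw [← (envMap k α β).map_smul_of_tower r c] at h
    exact h

end Twist

/-! ## The `Aᵉ`-dual of a bimodule -/

section Dual

variable (k : Type u) (A : Type v) [Field k] [Ring A] [Algebra k A]
variable (X : Type w) [AddCommGroup X] [Module (Env k A) X]

/-- The dual `X^∨ = Hom_{Aᵉ}(X, Aᵉ)` of a bimodule. -/
def EnvDual : Type _ := X →ₗ[Env k A] Env k A

instance : AddCommGroup (EnvDual k A X) := inferInstanceAs (AddCommGroup (X →ₗ[Env k A] Env k A))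

instance : Module k (EnvDual k A X) := inferInstanceAs (Module k (X →ₗ[Env k A] Env k A))

/-- The bimodule structure `(a f b)(x) = f(x) (b ⊗ aᵒ)` on `X^∨`. -/
instance : Module (Env k A) (EnvDual k A X) :=
  Module.compHom (X →ₗ[Env k A] Env k A) (flip k A).toRingHom

/-- An element of `X^∨`, regarded as a morphism of bimodules `X → Aᵉ`. -/
def EnvDual.hom : EnvDual k A X ≃ₗ[k] (X →ₗ[Env k A] Env k A) := LinearEquiv.refl k _

variable {k A X}

theorem EnvDual.smul_hom_apply (c : Env k A) (f : EnvDual k A X) (x : X) :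
    EnvDual.hom k A X (c • f) x = EnvDual.hom k A X f x * (flip k A c).unop := rfl

theorem EnvDual.env_smul_hom_apply (a b : A) (f : EnvDual k A X) (x : X) :
    EnvDual.hom k A X (env k a b • f) x = EnvDual.hom k A X f x * env k b a := by
  rw [EnvDual.smul_hom_apply, flip_env, unop_op]

instance : IsScalarTower k (Env k A) (EnvDual k A X) where
  smul_assoc r c f := by
    apply (EnvDual.hom k A X).injective
    ext x
    rw [LinearEquiv.map_smul, LinearMap.smul_apply, EnvDual.smul_hom_apply,
      EnvDual.smul_hom_apply, (flip k A).map_smul_of_tower r c, unop_smul, mul_smul_comm]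

/-- The transpose `f ↦ f ∘ d` of a morphism of bimodules. -/
def EnvDual.comp {Y : Type w'} [AddCommGroup Y] [Module (Env k A) Y]
    (f : EnvDual k A Y) (d : X →ₗ[Env k A] Y) : EnvDual k A X :=
  (EnvDual.hom k A X).symm ((EnvDual.hom k A Y f).comp d)

end Dual

/-! ## Tensor products over `A` -/

section ATensor

variable (k : Type u) (A : Type v) [Field k] [Ring A] [Algebra k A]
variable (M : Type w) [AddCommGroup M] [Module k M] [Module (Env k A) M]
variable (N : Type w') [AddCommGroup N] [Module k N] [Module (Env k A) N]

/-- The relations `m a ⊗ n = m ⊗ a n`. -/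
def aRel : Submodule k (M ⊗[k] N) :=
  Submodule.span k
    {t | ∃ (a : A) (m : M) (n : N), t = (env k 1 a • m) ⊗ₜ[k] n - m ⊗ₜ[k] (env k a 1 • n)}

/-- The tensor product `M ⊗_A N` of two bimodules. -/
def ATensor : Type _ := (M ⊗[k] N) ⧸ aRel k A M N

instance : AddCommGroup (ATensor k A M N) := inferInstanceAs (AddCommGroup (_ ⧸ aRel k A M N))

instance : Module k (ATensor k A M N) := inferInstanceAs (Module k (_ ⧸ aRel k A M N))

/-- The element `m ⊗_A n`, as a bilinear map. -/
def ATensor.mk : M →ₗ[k] N →ₗ[k] ATensor k A M N :=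
  (TensorProduct.mk k M N).compr₂ (aRel k A M N).mkQ

variable {k A M N}

theorem ATensor.mk_smul (a : A) (m : M) (n : N) :
    ATensor.mk k A M N (env k 1 a • m) n = ATensor.mk k A M N m (env k a 1 • n) :=
  (Submodule.Quotient.eq _).2 (Submodule.subset_span ⟨a, m, n, rfl⟩)

/-- The map out of `M ⊗_A N` given by an `A`-balanced bilinear map. -/
def ATensor.lift {P : Type w''} [AddCommGroup P] [Module k P] (f : M →ₗ[k] N →ₗ[k] P)
    (hf : ∀ (a : A) m n, f (env k 1 a • m) n = f m (env k a 1 • n)) :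
    ATensor k A M N →ₗ[k] P :=
  (aRel k A M N).liftQ (TensorProduct.lift f) (Submodule.span_le.2 (by
    rintro _ ⟨a, m, n, rfl⟩
    simp [hf]))

@[simp]
theorem ATensor.lift_mk {P : Type w''} [AddCommGroup P] [Module k P] (f : M →ₗ[k] N →ₗ[k] P)
    (hf : ∀ (a : A) m n, f (env k 1 a • m) n = f m (env k a 1 • n)) (m : M) (n : N) :
    ATensor.lift f hf (ATensor.mk k A M N m n) = f m n :=
  rfl

theorem ATensor.hom_ext {P : Type w''} [AddCommGroup P] [Module k P]
    {f g : ATensor k A M N →ₗ[k] P}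
    (h : ∀ m n, f (ATensor.mk k A M N m n) = g (ATensor.mk k A M N m n)) : f = g :=
  Submodule.linearMap_qext _ (TensorProduct.ext' h)

theorem ATensor.induction {motive : ATensor k A M N → Prop} (t : ATensor k A M N)
    (zero : motive 0) (mk : ∀ m n, motive (ATensor.mk k A M N m n))
    (add : ∀ x y, motive x → motive y → motive (x + y)) : motive t := by
  obtain ⟨t, rfl⟩ := (aRel k A M N).mkQ_surjective t
  exact TensorProduct.induction_on (motive := fun t => motive ((aRel k A M N).mkQ t)) t zero mk
    (fun x y hx hy => add _ _ hx hy)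

variable [IsScalarTower k (Env k A) M] [IsScalarTower k (Env k A) N]

variable (M N) in
/-- Left multiplication `m ⊗_A n ↦ a m ⊗_A n`. -/
def ATensor.leftMul : A →ₐ[k] Module.End k (ATensor k A M N) :=
  AlgHom.ofLinearMap
    { toFun := fun a =>
        ATensor.lift ((ATensor.mk k A M N).comp (Algebra.lsmul k k M (env k a 1))) (fun b m n => by
          simp [← ATensor.mk_smul, ← mul_smul, env_mul])
      map_add' := fun a b => ATensor.hom_ext fun m n => by simp [env_add_left]
      map_smul' := fun r a => ATensor.hom_ext fun m n => by simp [env_smul_left] }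
    (ATensor.hom_ext fun m n => by simp [env_one])
    (fun a b => ATensor.hom_ext fun m n => by simp [← mul_smul, env_mul])

variable (M N) in
/-- Right multiplication `m ⊗_A n ↦ m ⊗_A n b`. -/
def ATensor.rightMul : Aᵐᵒᵖ →ₐ[k] Module.End k (ATensor k A M N) :=
  AlgHom.ofLinearMap
    { toFun := fun b =>
        ATensor.lift ((ATensor.mk k A M N).compl₂ (Algebra.lsmul k k N (env k 1 b.unop)))
          (fun a m n => by simp [ATensor.mk_smul, ← mul_smul, env_mul])
      map_add' := fun a b => ATensor.hom_ext fun m n => by simp [env_add_right]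
      map_smul' := fun r a => ATensor.hom_ext fun m n => by simp [env_smul_right] }
    (ATensor.hom_ext fun m n => by simp [env_one])
    (fun a b => ATensor.hom_ext fun m n => by simp [← mul_smul, env_mul])

variable (k A M N) in
/-- The outer bimodule structure `a (m ⊗_A n) b = a m ⊗_A n b`, as an action of `Aᵉ`. -/
def ATensor.action : Env k A →ₐ[k] Module.End k (ATensor k A M N) :=
  Env.lift (ATensor.leftMul M N) (ATensor.rightMul M N)
    (fun _ _ => ATensor.hom_ext fun _ _ => rfl)

instance : Module (Env k A) (ATensor k A M N) :=
  Module.compHom (ATensor k A M N) (ATensor.action k A M N).toRingHom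

theorem ATensor.env_smul_mk (a b : A) (m : M) (n : N) :
    env k a b • ATensor.mk k A M N m n =
      ATensor.mk k A M N (env k a 1 • m) (env k 1 b • n) := by
  change ATensor.action k A M N (env k a b) (ATensor.mk k A M N m n) = _
  exact LinearMap.congr_fun (Env.lift_env _ _ _ a b) _

instance : IsScalarTower k (Env k A) (ATensor k A M N) where
  smul_assoc r c t := by
    change ATensor.action k A M N (r • c) t = r • ATensor.action k A M N c t
    rw [map_smul, LinearMap.smul_apply]

/-- A `k`-linear map out of `M ⊗_A N` that is compatible with the bimodule structures on elements
`m ⊗_A n` is a morphism of bimodules. -/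
def ATensor.toEnvLinear {P : Type w''} [AddCommGroup P] [Module k P] [Module (Env k A) P]
    (f : ATensor k A M N →ₗ[k] P)
    (hf : ∀ (a b : A) m n, f (ATensor.mk k A M N (env k a 1 • m) (env k 1 b • n)) =
      env k a b • f (ATensor.mk k A M N m n)) :
    ATensor k A M N →ₗ[Env k A] P where
  toFun := f
  map_add' := f.map_add
  map_smul' c t := by
    refine map_env_smul f.toAddMonoidHom (fun a b t => ?_) c t
    induction t using ATensor.induction with
    | zero => simp
    | mk m n => exact (congrArg f (ATensor.env_smul_mk a b m n)).trans (hf a b m n)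
    | add x y hx hy => simp only [map_add, smul_add, hx, hy]

end ATensor

section ATensorMap

variable {k : Type u} {A : Type v} [Field k] [Ring A] [Algebra k A]
variable {M : Type*} [AddCommGroup M] [Module k M] [Module (Env k A) M]
  [IsScalarTower k (Env k A) M]
variable {N : Type*} [AddCommGroup N] [Module k N] [Module (Env k A) N]
  [IsScalarTower k (Env k A) N]
variable {M' : Type*} [AddCommGroup M'] [Module k M'] [Module (Env k A) M']
  [IsScalarTower k (Env k A) M']
variable {N' : Type*} [AddCommGroup N'] [Module k N'] [Module (Env k A) N']
  [IsScalarTower k (Env k A) N']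

/-- The morphism `f ⊗_A g` of bimodules. -/
def ATensor.map (f : M →ₗ[Env k A] M') (g : N →ₗ[Env k A] N') :
    ATensor k A M N →ₗ[Env k A] ATensor k A M' N' :=
  ATensor.toEnvLinear
    (ATensor.lift ((ATensor.mk k A M' N').compl₁₂ (f.restrictScalars k) (g.restrictScalars k))
      (fun a m n => by simp [ATensor.mk_smul]))
    (fun a b m n => by simp [ATensor.env_smul_mk])

@[simp]
theorem ATensor.map_mk (f : M →ₗ[Env k A] M') (g : N →ₗ[Env k A] N') (m : M) (n : N) :
    ATensor.map f g (ATensor.mk k A M N m n) = ATensor.mk k A M' N' (f m) (g n) := rfl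

variable (M) in
/-- The canonical morphism `M ⊗_A (_1 A_β) → _1 M_β`, `m ⊗_A a ↦ m a` (it is an isomorphism). -/
def twistUnit (β : A ≃ₐ[k] A) :
    ATensor k A M (Twist AlgEquiv.refl β A) →ₗ[Env k A] Twist AlgEquiv.refl β M :=
  ATensor.toEnvLinear
    (ATensor.lift
      (LinearMap.mk₂ k (fun (m : M) (x : Twist AlgEquiv.refl β A) =>
          toTwist AlgEquiv.refl β M
            (env k 1 ((toTwist (k := k) AlgEquiv.refl β A).symm x) • m))
        (fun m m' x => by simp)
        (fun r m x => by rw [smul_comm, map_smul])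
        (fun m x y => by simp [env_add_right, add_smul])
        (fun r m x => by simp [env_smul_right]))
      (fun a m x => by
        obtain ⟨x, rfl⟩ := (toTwist (k := k) AlgEquiv.refl β A).surjective x
        simp only [LinearMap.mk₂_apply, smul_toTwist, envMap_env, env_smul_self, ← mul_smul,
          env_mul, LinearEquiv.symm_apply_apply, AlgEquiv.coe_refl, id_eq, map_one, mul_one]))
    (fun a b m x => by
      obtain ⟨x, rfl⟩ := (toTwist (k := k) AlgEquiv.refl β A).surjective x
      simp only [ATensor.lift_mk, LinearMap.mk₂_apply, smul_toTwist, envMap_env, env_smul_self,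
        ← mul_smul, env_mul, LinearEquiv.symm_apply_apply, AlgEquiv.coe_refl, id_eq, map_one,
        mul_one, one_mul])

end ATensorMap

/-! ## Tensor products over `Aᵉ` -/

section EnvTensor

variable (k : Type u) (A : Type v) [Field k] [Ring A] [Algebra k A]
variable (X : Type w) [AddCommGroup X] [Module k X] [Module (Env k A) X]
variable (N : Type w') [AddCommGroup N] [Module k N] [Module (Env k A) N]

/-- The relations `b x a ⊗ n = x ⊗ a n b`. -/
def envRel : Submodule k (X ⊗[k] N) :=
  Submodule.span k
    {t | ∃ (a b : A) (x : X) (n : N),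
      t = (env k b a • x) ⊗ₜ[k] n - x ⊗ₜ[k] (env k a b • n)}

/-- The tensor product `X ⊗_{Aᵉ} N` of two bimodules, where `X` is regarded as a right `Aᵉ`-module
by `x (a ⊗ bᵒ) = b x a`. -/
def EnvTensor : Type _ := (X ⊗[k] N) ⧸ envRel k A X N

instance : AddCommGroup (EnvTensor k A X N) :=
  inferInstanceAs (AddCommGroup (_ ⧸ envRel k A X N))

instance : Module k (EnvTensor k A X N) := inferInstanceAs (Module k (_ ⧸ envRel k A X N))

/-- The element `x ⊗_{Aᵉ} n`, as a bilinear map. -/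
def EnvTensor.mk : X →ₗ[k] N →ₗ[k] EnvTensor k A X N :=
  (TensorProduct.mk k X N).compr₂ (envRel k A X N).mkQ

variable {k A X N}

theorem EnvTensor.mk_smul (a b : A) (x : X) (n : N) :
    EnvTensor.mk k A X N (env k b a • x) n = EnvTensor.mk k A X N x (env k a b • n) :=
  (Submodule.Quotient.eq _).2 (Submodule.subset_span ⟨a, b, x, n, rfl⟩)

/-- The map out of `X ⊗_{Aᵉ} N` given by an `Aᵉ`-balanced bilinear map. -/
def EnvTensor.lift {P : Type w''} [AddCommGroup P] [Module k P] (f : X →ₗ[k] N →ₗ[k] P)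
    (hf : ∀ (a b : A) x n, f (env k b a • x) n = f x (env k a b • n)) :
    EnvTensor k A X N →ₗ[k] P :=
  (envRel k A X N).liftQ (TensorProduct.lift f) (Submodule.span_le.2 (by
    rintro _ ⟨a, b, x, n, rfl⟩
    simp [hf]))

@[simp]
theorem EnvTensor.lift_mk {P : Type w''} [AddCommGroup P] [Module k P] (f : X →ₗ[k] N →ₗ[k] P)
    (hf : ∀ (a b : A) x n, f (env k b a • x) n = f x (env k a b • n)) (x : X) (n : N) :
    EnvTensor.lift f hf (EnvTensor.mk k A X N x n) = f x n :=
  rfl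

theorem EnvTensor.hom_ext {P : Type w''} [AddCommGroup P] [Module k P]
    {f g : EnvTensor k A X N →ₗ[k] P}
    (h : ∀ x n, f (EnvTensor.mk k A X N x n) = g (EnvTensor.mk k A X N x n)) : f = g :=
  Submodule.linearMap_qext _ (TensorProduct.ext' h)

end EnvTensor

section EnvTensorMap

variable {k : Type u} {A : Type v} [Field k] [Ring A] [Algebra k A]
variable {X : Type*} [AddCommGroup X] [Module k X] [Module (Env k A) X]
  [IsScalarTower k (Env k A) X]
variable {N : Type*} [AddCommGroup N] [Module k N] [Module (Env k A) N]
  [IsScalarTower k (Env k A) N]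
variable {X' : Type*} [AddCommGroup X'] [Module k X'] [Module (Env k A) X']
  [IsScalarTower k (Env k A) X']
variable {N' : Type*} [AddCommGroup N'] [Module k N'] [Module (Env k A) N']
  [IsScalarTower k (Env k A) N']
variable {Y : Type*} [AddCommGroup Y] [Module k Y] [Module (Env k A) Y]
  [IsScalarTower k (Env k A) Y]
variable {M : Type*} [AddCommGroup M] [Module k M] [Module (Env k A) M]
  [IsScalarTower k (Env k A) M]

/-- The map `f ⊗_{Aᵉ} g`. -/
def EnvTensor.map (f : X →ₗ[Env k A] X') (g : N →ₗ[Env k A] N') :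
    EnvTensor k A X N →ₗ[k] EnvTensor k A X' N' :=
  EnvTensor.lift ((EnvTensor.mk k A X' N').compl₁₂ (f.restrictScalars k) (g.restrictScalars k))
    (fun a b x n => by simp [EnvTensor.mk_smul])

@[simp]
theorem EnvTensor.map_mk (f : X →ₗ[Env k A] X') (g : N →ₗ[Env k A] N') (x : X) (n : N) :
    EnvTensor.map f g (EnvTensor.mk k A X N x n) = EnvTensor.mk k A X' N' (f x) (g n) := rfl

/-- The canonical map `(_α (X^∨)_1) ⊗_{Aᵉ} (_1 M_α) → Hom_{Aᵉ}(X, M)`, `f ⊗ m ↦ (x ↦ f(x) m)`. It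
is an isomorphism if `X` is finitely generated and projective. -/
def evalDual (α : A ≃ₐ[k] A) (X : Type w) [AddCommGroup X] [Module k X] [Module (Env k A) X]
    [IsScalarTower k (Env k A) X]
    (M : Type w') [AddCommGroup M] [Module k M] [Module (Env k A) M] [IsScalarTower k (Env k A) M] :
    EnvTensor k A (Twist α AlgEquiv.refl (EnvDual k A X)) (Twist AlgEquiv.refl α M) →ₗ[k]
      (X →ₗ[Env k A] M) :=
  EnvTensor.lift
    (LinearMap.mk₂ k (fun (f : Twist α AlgEquiv.refl (EnvDual k A X))
          (m : Twist AlgEquiv.refl α M) =>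
        (LinearMap.toSpanSingleton (Env k A) M ((toTwist AlgEquiv.refl α M).symm m)).comp
          (EnvDual.hom k A X ((toTwist α AlgEquiv.refl (EnvDual k A X)).symm f)))
      (fun f f' m => LinearMap.ext fun x => by simp [add_smul])
      (fun r f m => LinearMap.ext fun x => by simp)
      (fun f m m' => LinearMap.ext fun x => by simp)
      (fun r f m => LinearMap.ext fun x => by
        rw [map_smul, LinearMap.smul_apply]
        simp only [LinearMap.comp_apply, LinearMap.toSpanSingleton_apply]
        rw [smul_comm]))
    (fun a b f m => LinearMap.ext fun x => by
      obtain ⟨f, rfl⟩ := (toTwist α AlgEquiv.refl (EnvDual k A X)).surjective f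
      obtain ⟨m, rfl⟩ := (toTwist AlgEquiv.refl α M).surjective m
      rw [smul_toTwist, smul_toTwist, envMap_env, envMap_env]
      simp only [LinearMap.mk₂_apply, LinearEquiv.symm_apply_apply, LinearMap.comp_apply,
        LinearMap.toSpanSingleton_apply, EnvDual.env_smul_hom_apply, mul_smul, AlgEquiv.coe_refl,
        id_eq])

/-- The unsigned evaluation map
`(X ⊗_A Y) ⊗_{Aᵉ} N → X ⊗_{Aᵉ} (M ⊗_A N)`, `(x ⊗ y) ⊗ n ↦ x ⊗ (u(y) ⊗ n)`,
for a morphism of bimodules `u : Y → M`. -/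
def contract (u : Y →ₗ[Env k A] M) :
    EnvTensor k A (ATensor k A X Y) N →ₗ[k] EnvTensor k A X (ATensor k A M N) :=
  EnvTensor.lift
    (ATensor.lift
      (LinearMap.mk₂ k (fun (x : X) (y : Y) =>
          (EnvTensor.mk k A X (ATensor k A M N) x).comp
            (ATensor.mk k A M N (u.restrictScalars k y)))
        (fun x x' y => by simp [LinearMap.add_comp])
        (fun r x y => by simp [LinearMap.smul_comp])
        (fun x y y' => by simp [LinearMap.comp_add])
        (fun r x y => by rw [map_smul, map_smul, LinearMap.comp_smul]))
      (fun a x y => LinearMap.ext fun n => by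
        have := EnvTensor.mk_smul (k := k) a 1 x (ATensor.mk k A M N (u y) n)
        rw [ATensor.env_smul_mk, env_one, one_smul, ← map_smul u] at this
        exact this))
    (fun a b t n => by
      induction t using ATensor.induction with
      | zero => simp
      | mk x y =>
        rw [ATensor.env_smul_mk, ATensor.lift_mk, ATensor.lift_mk]
        have h₁ := EnvTensor.mk_smul (k := k) 1 b x (ATensor.mk k A M N (env k 1 a • u y) n)
        have h₂ := ATensor.mk_smul (k := k) a (u y) (env k 1 b • n)
        rw [ATensor.env_smul_mk, env_one, one_smul, h₂, ← mul_smul, env_mul, mul_one, mul_one,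
          ← map_smul u] at h₁
        exact h₁
      | add x y hx hy => simp only [map_add, smul_add, hx, hy, LinearMap.add_apply])

end EnvTensorMap

/-! ## Frobenius algebras -/

section Frobenius

variable (k : Type u) (A : Type v) [Field k] [Ring A] [Algebra k A]

/-- A Frobenius form on `A`: a nondegenerate bilinear form with `⟨ab, c⟩ = ⟨a, bc⟩`. A finite
dimensional algebra is a Frobenius algebra if it has such a form. -/
structure FrobeniusForm where
  form : LinearMap.BilinForm k A
  assoc : ∀ a b c, form (a * b) c = form a (b * c)
  nondegenerate : form.Nondegenerate

variable {k A} (F : FrobeniusForm k A)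

/-- `ν` is the Nakayama automorphism of the form: `⟨a, b⟩ = ⟨b, ν(a)⟩`. -/
def FrobeniusForm.IsNakayama (ν : A ≃ₐ[k] A) : Prop :=
  ∀ a b, F.form a b = F.form b (ν a)

variable [FiniteDimensional k A]

/-- The element `t(x)(y) = ∑ y uᵢ ν(x) ⊗ vᵢ` of `Aᵉ`, where `(uᵢ)` is a basis of `A` and `(vᵢ)` is
the dual basis, `⟨vᵢ, uⱼ⟩ = δᵢⱼ` (the sum does not depend on the basis). The map `x ↦ t(x)` is the
standard isomorphism of bimodules `_1 A_{ν⁻¹} → A^∨`. -/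
def FrobeniusForm.toDual (ν : A ≃ₐ[k] A) (x y : A) : Env k A :=
  ∑ i, env k (y * Module.finBasis k A i * ν x)
    (F.form.dualBasis F.nondegenerate (Module.finBasis k A) i)

end Frobenius

/-! ## Complete resolutions -/

section CompleteResolution

variable (k : Type u) (A : Type v) [Field k] [Ring A] [Algebra k A]

/-- A complete resolution `T → A` of `A` over `Aᵉ`: an exact complex `T` of finitely generated
projective bimodules whose `Aᵉ`-dual is exact, with an augmentation `ε : T₀ → A` that makes the
truncation `T_{≥ 0}` a projective resolution of `A`. -/
structure CompleteResolution where
  complex : ChainComplex (ModuleCat.{v} (Env k A)) ℤ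
  finite : ∀ i, Module.Finite (Env k A) (complex.X i)
  projective : ∀ i, Module.Projective (Env k A) (complex.X i)
  exact : ∀ i j l, j + 1 = i → l + 1 = j →
    Function.Exact (complex.d i j).hom (complex.d j l).hom
  dual_exact : ∀ i j l, j + 1 = i → l + 1 = j →
    Function.Exact (fun f : EnvDual k A (complex.X l) => f.comp (complex.d j l).hom)
      (fun f : EnvDual k A (complex.X j) => f.comp (complex.d i j).hom)
  ε : complex.X 0 →ₗ[Env k A] A
  ε_surjective : Function.Surjective ε
  ε_exact : Function.Exact (complex.d 1 0).hom ε

namespace CompleteResolution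

variable {k A} (T : CompleteResolution k A)

/-- The bimodule in degree `i`. -/
abbrev X (i : ℤ) : ModuleCat.{v} (Env k A) := T.complex.X i

/-- The differential. -/
abbrev d (i j : ℤ) : T.X i →ₗ[Env k A] T.X j := (T.complex.d i j).hom

theorem d_d (i j l : ℤ) (x : T.X i) : T.d j l (T.d i j x) = 0 := by
  have h := T.complex.d_comp_d i j l
  exact congrArg (fun f => f.hom x) h

/-- The monomorphism `η : A → T_{-1}` with `η ∘ ε = d₀`. -/
def η : A →ₗ[Env k A] T.X (-1) :=
  ((LinearMap.ker T.ε).liftQ (T.d 0 (-1)) (fun x hx => by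
    obtain ⟨y, rfl⟩ := (T.ε_exact x).1 hx
    exact T.d_d 1 0 (-1) y)).comp
    (T.ε.quotKerEquivOfSurjective T.ε_surjective).symm.toLinearMap

theorem η_ε (x : T.X 0) : T.η (T.ε x) = T.d 0 (-1) x := by
  have h : (T.ε.quotKerEquivOfSurjective T.ε_surjective).symm (T.ε x) =
      (LinearMap.ker T.ε).mkQ x := by
    rw [LinearEquiv.symm_apply_eq]
    rfl
  simp only [η, LinearMap.comp_apply, LinearEquiv.coe_coe, h]
  rfl

end CompleteResolution

end CompleteResolution

/-! ## Tate-Hochschild cohomology and homology -/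

section Tate

variable {k : Type u} {A : Type v} [Field k] [Ring A] [Algebra k A] (T : CompleteResolution k A)

section Cohomology

variable (M : Type w) [AddCommGroup M] [Module k M] [Module (Env k A) M]
  [IsScalarTower k (Env k A) M]

/-- The map `f ↦ f ∘ d` from `Hom_{Aᵉ}(T_j, M)` to `Hom_{Aᵉ}(T_i, M)`; up to sign, this is the
differential of the complex `Hom_{Aᵉ}(T, M)`. -/
def homD (i j : ℤ) : (T.X j →ₗ[Env k A] M) →ₗ[k] (T.X i →ₗ[Env k A] M) where
  toFun f := f.comp (T.d i j)
  map_add' f g := LinearMap.add_comp (T.d i j) g f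
  map_smul' r f := LinearMap.smul_comp r f _

/-- The `n`-cocycles of `Hom_{Aᵉ}(T, M)`. -/
def tateCocycles (n : ℤ) : Submodule k (T.X n →ₗ[Env k A] M) := LinearMap.ker (homD T M (n + 1) n)

/-- The `n`-coboundaries, as a subspace of the cocycles. -/
def tateCoboundaries (n : ℤ) : Submodule k (tateCocycles T M n) :=
  (LinearMap.range (homD T M n (n - 1))).comap (tateCocycles T M n).subtype

/-- Tate-Hochschild cohomology `Ĥⁿ(A, M) = Hⁿ(Hom_{Aᵉ}(T, M))`, computed with `T`. -/
abbrev TateCohomology (n : ℤ) : Type _ := tateCocycles T M n ⧸ tateCoboundaries T M n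

/-- The class of a cocycle. -/
def TateCohomology.mk (n : ℤ) : tateCocycles T M n →ₗ[k] TateCohomology T M n :=
  (tateCoboundaries T M n).mkQ

end Cohomology

section Homology

variable (N : Type w) [AddCommGroup N] [Module k N] [Module (Env k A) N]
  [IsScalarTower k (Env k A) N]

/-- The differential `d ⊗ id` of the complex `T ⊗_{Aᵉ} N`. -/
def tensorD (i j : ℤ) : EnvTensor k A (T.X i) N →ₗ[k] EnvTensor k A (T.X j) N :=
  EnvTensor.map (T.d i j) LinearMap.id

/-- The `n`-cycles of `T ⊗_{Aᵉ} N`. -/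
def tateCycles (n : ℤ) : Submodule k (EnvTensor k A (T.X n) N) :=
  LinearMap.ker (tensorD T N n (n - 1))

/-- The `n`-boundaries, as a subspace of the cycles. -/
def tateBoundaries (n : ℤ) : Submodule k (tateCycles T N n) :=
  (LinearMap.range (tensorD T N (n + 1) n)).comap (tateCycles T N n).subtype

/-- Tate-Hochschild homology `Ĥₙ(A, N) = Hₙ(T ⊗_{Aᵉ} N)`, computed with `T`. -/
abbrev TateHomology (n : ℤ) : Type _ := tateCycles T N n ⧸ tateBoundaries T N n

/-- The class of a cycle. -/
def TateHomology.mk (n : ℤ) : tateCycles T N n →ₗ[k] TateHomology T N n :=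
  (tateBoundaries T N n).mkQ

variable {T N}

theorem mem_tateCocycles {M : Type w} [AddCommGroup M] [Module k M] [Module (Env k A) M]
    [IsScalarTower k (Env k A) M] {i j : ℤ} (h : j + 1 = i) {f : T.X j →ₗ[Env k A] M} :
    f ∈ tateCocycles T M j ↔ f.comp (T.d i j) = 0 := by
  subst h
  rfl

theorem mem_tateCycles {i j : ℤ} (h : j + 1 = i) {z : EnvTensor k A (T.X i) N} :
    z ∈ tateCycles T N i ↔ tensorD T N i j z = 0 := by
  obtain rfl : j = i - 1 := by omega
  rfl

variable {N' : Type w'} [AddCommGroup N'] [Module k N'] [Module (Env k A) N']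
  [IsScalarTower k (Env k A) N']

theorem tensorD_map (f : N →ₗ[Env k A] N') (i j : ℤ) (z : EnvTensor k A (T.X i) N) :
    tensorD T N' i j (EnvTensor.map LinearMap.id f z) =
      EnvTensor.map LinearMap.id f (tensorD T N i j z) :=
  LinearMap.congr_fun (f := (tensorD T N' i j).comp (EnvTensor.map LinearMap.id f))
    (g := (EnvTensor.map LinearMap.id f).comp (tensorD T N i j))
    (EnvTensor.hom_ext fun _ _ => rfl) z

variable (T) in
/-- The map `Ĥₙ(A, N) → Ĥₙ(A, N')` induced by a morphism of bimodules `N → N'`. -/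
def TateHomology.map (f : N →ₗ[Env k A] N') (n : ℤ) :
    TateHomology T N n →ₗ[k] TateHomology T N' n :=
  Submodule.mapQ _ _
    ((EnvTensor.map LinearMap.id f).restrict (p := tateCycles T N n) (q := tateCycles T N' n)
      (fun z hz => by
        change tensorD T N' n (n - 1) _ = 0
        rw [tensorD_map, show tensorD T N n (n - 1) z = 0 from hz, map_zero]))
    (by
      rintro z ⟨y, hy⟩
      exact ⟨EnvTensor.map LinearMap.id f y, (tensorD_map f _ _ y).trans
        (congrArg (EnvTensor.map LinearMap.id f) hy)⟩)

end Homology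

end Tate

/-! ## The complete tensor product and diagonal approximations -/

section Diagonal

variable {k : Type u} {A : Type v} [Field k] [Ring A] [Algebra k A]

/-- The degree `n` part `∏_{p + q = n} C_p ⊗_A D_q` of the complete tensor product of two complexes
of bimodules. -/
abbrev CompleteTensor (C D : ChainComplex (ModuleCat.{v} (Env k A)) ℤ) (n : ℤ) : Type _ :=
  ∀ pq : {pq : ℤ × ℤ // pq.1 + pq.2 = n}, ATensor k A (C.X pq.1.1) (D.X pq.1.2)

/-- The component in `C_p ⊗_A D_q`. -/
def CompleteTensor.proj (C D : ChainComplex (ModuleCat.{v} (Env k A)) ℤ) {n : ℤ} (p q : ℤ)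
    (h : p + q = n) : CompleteTensor C D n →ₗ[Env k A] ATensor k A (C.X p) (D.X q) :=
  LinearMap.proj (φ := fun pq : {pq : ℤ × ℤ // pq.1 + pq.2 = n} =>
    ATensor k A (C.X pq.1.1) (D.X pq.1.2)) ⟨(p, q), h⟩

/-- The differential `d ⊗ id + id ⊗ d` (with the sign `(-1)^p` in the second term) of the complete
tensor product. -/
def CompleteTensor.d (C D : ChainComplex (ModuleCat.{v} (Env k A)) ℤ) (n m : ℤ) (h : m + 1 = n) :
    CompleteTensor C D n →ₗ[Env k A] CompleteTensor C D m :=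
  LinearMap.pi fun pq =>
    (ATensor.map (C.d (pq.1.1 + 1) pq.1.1).hom LinearMap.id).comp
        (CompleteTensor.proj C D (pq.1.1 + 1) pq.1.2 (by have := pq.2; omega)) +
      pq.1.1.negOnePow •
        (ATensor.map LinearMap.id (D.d (pq.1.2 + 1) pq.1.2).hom).comp
          (CompleteTensor.proj C D pq.1.1 (pq.1.2 + 1) (by have := pq.2; omega))

/-- A diagonal approximation: a chain map `Δ : T → T ⊗̂_A T` with `(ε ⊗̂ ε) Δ = ε`. Here `A ⊗_A A` is
identified with `A` by `a ⊗ 1 ↔ a`, and `ε` vanishes outside degree `0`. -/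
structure DiagonalApproximation (T : CompleteResolution k A) where
  Δ : ∀ n : ℤ, T.X n →ₗ[Env k A] CompleteTensor T.complex T.complex n
  comm : ∀ (n m : ℤ) (h : m + 1 = n) (x : T.X n),
    CompleteTensor.d T.complex T.complex n m h (Δ n x) = Δ m (T.d n m x)
  augmentation : ∀ x : T.X 0,
    ATensor.map T.ε T.ε (CompleteTensor.proj T.complex T.complex 0 0 rfl (Δ 0 x)) =
      ATensor.mk k A A A (T.ε x) 1

end Diagonal

/-! ## The cap product -/

section Cap

variable {k : Type u} {A : Type v} [Field k] [Ring A] [Algebra k A] {T : CompleteResolution k A}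
  (Δ : DiagonalApproximation T)
variable {M : Type w} [AddCommGroup M] [Module k M] [Module (Env k A) M]
  [IsScalarTower k (Env k A) M]
variable {N : Type w'} [AddCommGroup N] [Module k N] [Module (Env k A) N]
  [IsScalarTower k (Env k A) N]

/-- The component `T_n → T_p ⊗_A T_q` of `Δ`. -/
def DiagonalApproximation.component {n : ℤ} (p q : ℤ) (h : p + q = n) :
    T.X n →ₗ[Env k A] ATensor k A (T.X p) (T.X q) :=
  (CompleteTensor.proj T.complex T.complex p q h).comp (Δ.Δ n)

/-- The cap product of a cochain and a chain, without its sign: apply `Δ ⊗ id` to the chain and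
evaluate the cochain `u` on the second factor, `(x ⊗ y) ⊗ n ↦ x ⊗ (u(y) ⊗ n)`. -/
def capUnsigned (t r s : ℤ) (h : t + r = s) (u : T.X r →ₗ[Env k A] M) :
    EnvTensor k A (T.X s) N →ₗ[k] EnvTensor k A (T.X t) (ATensor k A M N) :=
  (contract u).comp (EnvTensor.map (Δ.component t r h) LinearMap.id)

theorem contract_ext {X : Type*} [AddCommGroup X] [Module k X] [Module (Env k A) X]
    [IsScalarTower k (Env k A) X] {Y : Type*} [AddCommGroup Y] [Module k Y] [Module (Env k A) Y]
    [IsScalarTower k (Env k A) Y] {P : Type*} [AddCommGroup P] [Module k P]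
    {f g : EnvTensor k A (ATensor k A X Y) N →ₗ[k] P}
    (h : ∀ x y n, f (EnvTensor.mk k A _ N (ATensor.mk k A X Y x y) n) =
      g (EnvTensor.mk k A _ N (ATensor.mk k A X Y x y) n)) : f = g := by
  refine EnvTensor.hom_ext fun t n => ?_
  induction t using ATensor.induction with
  | zero => simp
  | mk x y => exact h x y n
  | add x y hx hy => simp only [map_add, LinearMap.add_apply, hx, hy]

@[simp]
theorem contract_mk {X : Type*} [AddCommGroup X] [Module k X] [Module (Env k A) X]
    [IsScalarTower k (Env k A) X] {Y : Type*} [AddCommGroup Y] [Module k Y] [Module (Env k A) Y]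
    [IsScalarTower k (Env k A) Y] (u : Y →ₗ[Env k A] M) (x : X) (y : Y) (n : N) :
    contract u (EnvTensor.mk k A _ N (ATensor.mk k A X Y x y) n) =
      EnvTensor.mk k A X _ x (ATensor.mk k A M N (u y) n) := rfl

theorem capUnsigned_add (t r s : ℤ) (h : t + r = s) (u u' : T.X r →ₗ[Env k A] M)
    (z : EnvTensor k A (T.X s) N) :
    capUnsigned Δ t r s h (u + u') z = capUnsigned Δ t r s h u z + capUnsigned Δ t r s h u' z := by
  have : contract (X := T.X t) (N := N) (u + u') = contract u + contract u' :=
    contract_ext fun x y n => by simp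
  simp only [capUnsigned, this, LinearMap.comp_apply, LinearMap.add_apply]

theorem capUnsigned_smul (t r s : ℤ) (h : t + r = s) (c : k) (u : T.X r →ₗ[Env k A] M)
    (z : EnvTensor k A (T.X s) N) :
    capUnsigned Δ t r s h (c • u) z = c • capUnsigned Δ t r s h u z := by
  have : contract (X := T.X t) (N := N) (c • u) = c • contract u :=
    contract_ext fun x y n => by simp
  simp only [capUnsigned, this, LinearMap.comp_apply, LinearMap.smul_apply]

/-- The Leibniz rule for the unsigned cap product. -/
theorem capUnsigned_leibniz (p q m : ℤ) (h : p + q = m) (u : T.X q →ₗ[Env k A] M)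
    (z : EnvTensor k A (T.X (m + 1)) N) :
    capUnsigned Δ p q m h u (tensorD T N (m + 1) m z) =
      tensorD T (ATensor k A M N) (p + 1) p (capUnsigned Δ (p + 1) q (m + 1) (by omega) u z) +
        p.negOnePow • capUnsigned Δ p (q + 1) (m + 1) (by omega) (homD T M (q + 1) q u) z := by
  have hΔ : (Δ.component p q h).comp (T.d (m + 1) m) =
      (ATensor.map (T.d (p + 1) p) LinearMap.id).comp
          (Δ.component (n := m + 1) (p + 1) q (by omega)) +
        p.negOnePow • (ATensor.map LinearMap.id (T.d (q + 1) q)).comp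
          (Δ.component (n := m + 1) p (q + 1) (by omega)) :=
    LinearMap.ext fun x => (congrFun (Δ.comm (m + 1) m rfl x) ⟨(p, q), h⟩).symm
  have h₁ : ∀ x : EnvTensor k A (ATensor k A (T.X (p + 1)) (T.X q)) N,
      contract u (EnvTensor.map (ATensor.map (T.d (p + 1) p) LinearMap.id) LinearMap.id x) =
        tensorD T (ATensor k A M N) (p + 1) p (contract u x) :=
    LinearMap.congr_fun (f := (contract u).comp (EnvTensor.map _ _))
      (g := (tensorD T _ _ _).comp (contract u)) (contract_ext fun _ _ _ => rfl)
  have h₂ : ∀ x : EnvTensor k A (ATensor k A (T.X p) (T.X (q + 1))) N,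
      contract u (EnvTensor.map (ATensor.map LinearMap.id (T.d (q + 1) q)) LinearMap.id x) =
        contract (homD T M (q + 1) q u) x :=
    LinearMap.congr_fun (f := (contract u).comp (EnvTensor.map _ _))
      (g := contract (homD T M (q + 1) q u)) (contract_ext fun _ _ _ => rfl)
  simp only [capUnsigned, LinearMap.comp_apply, ← h₁, ← h₂]
  refine LinearMap.congr_fun (f := ((contract u).comp (EnvTensor.map (Δ.component p q h)
    LinearMap.id)).comp (tensorD T N (m + 1) m)) (g := (contract u).comp
    ((EnvTensor.map (ATensor.map (T.d (p + 1) p) LinearMap.id) LinearMap.id).comp (EnvTensor.map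
      (Δ.component (n := m + 1) (p + 1) q (by omega)) LinearMap.id)) + p.negOnePow •
    (contract u).comp
    ((EnvTensor.map (ATensor.map LinearMap.id (T.d (q + 1) q)) LinearMap.id).comp (EnvTensor.map
      (Δ.component (n := m + 1) p (q + 1) (by omega)) LinearMap.id))) ?_ z
  refine EnvTensor.hom_ext fun x n => ?_
  have hx := LinearMap.congr_fun hΔ x
  simp only [LinearMap.comp_apply, LinearMap.add_apply, LinearMap.smul_apply] at hx
  simp only [LinearMap.comp_apply, LinearMap.add_apply, LinearMap.smul_apply, tensorD,
    EnvTensor.map_mk, hx, map_add, LinearMap.id_apply]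
  congr 1
  rcases Int.even_or_odd p with hp | hp
  · simp [Int.negOnePow_even p hp]
  · simp [Int.negOnePow_odd p hp]

/-- The cap product `u ⌢ z = (-1)^{|u| t} x ⊗ (u(y) ⊗ n)` of a cochain `u` of degree `r` and a chain
`z` of degree `s`, where `x ⊗ y ⊗ n` is the component of `(Δ ⊗ id)(z)` with `x` in degree
`t = s - r` and `y` in degree `r`. -/
def capChain (t r s : ℤ) (h : t + r = s) :
    (T.X r →ₗ[Env k A] M) →ₗ[k] EnvTensor k A (T.X s) N →ₗ[k]
      EnvTensor k A (T.X t) (ATensor k A M N) where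
  toFun u := (r * t).negOnePow • capUnsigned Δ t r s h u
  map_add' u u' := by
    rw [← smul_add]
    exact congrArg _ (LinearMap.ext fun z => capUnsigned_add Δ t r s h u u' z)
  map_smul' c u := by
    rw [RingHom.id_apply, smul_comm]
    exact congrArg _ (LinearMap.ext fun z => capUnsigned_smul Δ t r s h c u z)

theorem capChain_apply (t r s : ℤ) (h : t + r = s) (u : T.X r →ₗ[Env k A] M)
    (z : EnvTensor k A (T.X s) N) :
    capChain Δ t r s h u z = (r * t).negOnePow • capUnsigned Δ t r s h u z := rfl

theorem units_smul_mem {P : Type*} [AddCommGroup P] [Module k P] (S : Submodule k P) (e : ℤˣ)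
    {x : P} (hx : x ∈ S) : e • x ∈ S := by
  rcases Int.units_eq_one_or e with rfl | rfl
  · simpa using hx
  · simpa using hx

theorem homD_eq_zero {q : ℤ} {u : T.X q →ₗ[Env k A] M} (hu : u ∈ tateCocycles T M q) :
    homD T M (q + 1) q u = 0 := hu

theorem capUnsigned_zero (t r s : ℤ) (h : t + r = s) (z : EnvTensor k A (T.X s) N) :
    capUnsigned Δ t r s h (0 : T.X r →ₗ[Env k A] M) z = 0 := by
  simpa using capUnsigned_smul Δ t r s h (0 : k) (0 : T.X r →ₗ[Env k A] M) z

/-- The cap product of a cocycle and a cycle is a cycle. -/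
theorem capChain_mem (t r s : ℤ) (h : t + r = s) {u : T.X r →ₗ[Env k A] M}
    (hu : u ∈ tateCocycles T M r) {z : EnvTensor k A (T.X s) N} (hz : z ∈ tateCycles T N s) :
    capChain Δ t r s h u z ∈ tateCycles T (ATensor k A M N) t := by
  obtain ⟨p, rfl⟩ : ∃ p, t = p + 1 := ⟨t - 1, by omega⟩
  obtain ⟨m, rfl⟩ : ∃ m, s = m + 1 := ⟨s - 1, by omega⟩
  refine units_smul_mem _ _ ((mem_tateCycles rfl).2 ?_)
  have hL := capUnsigned_leibniz Δ p r m (by omega) u z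
  rw [(mem_tateCycles rfl).1 hz, homD_eq_zero hu, capUnsigned_zero, map_zero, smul_zero,
    add_zero] at hL
  exact hL.symm

/-- The cap product of a cocycle and a boundary is a boundary. -/
theorem capChain_boundary (t r s : ℤ) (h : t + r = s) {u : T.X r →ₗ[Env k A] M}
    (hu : u ∈ tateCocycles T M r) (y : EnvTensor k A (T.X (s + 1)) N) :
    capChain Δ t r s h u (tensorD T N (s + 1) s y) ∈
      LinearMap.range (tensorD T (ATensor k A M N) (t + 1) t) := by
  refine units_smul_mem _ _ ?_
  rw [capUnsigned_leibniz, homD_eq_zero hu, capUnsigned_zero, smul_zero, add_zero]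
  exact ⟨_, rfl⟩

/-- The cap product of a coboundary and a cycle is a boundary. -/
theorem capChain_coboundary (t r s q : ℤ) (h : t + r = s) (hq : q = r - 1)
    (g : T.X q →ₗ[Env k A] M)
    {z : EnvTensor k A (T.X s) N} (hz : z ∈ tateCycles T N s) :
    capChain Δ t r s h (homD T M r q g) z ∈
      LinearMap.range (tensorD T (ATensor k A M N) (t + 1) t) := by
  obtain rfl : r = q + 1 := by omega
  obtain ⟨m, rfl⟩ : ∃ m, s = m + 1 := ⟨s - 1, by omega⟩
  refine units_smul_mem _ _ ?_
  have hL := capUnsigned_leibniz Δ t q m (by omega) g z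
  rw [(mem_tateCycles rfl).1 hz, map_zero] at hL
  have := units_smul_mem (LinearMap.range (tensorD T (ATensor k A M N) (t + 1) t)) t.negOnePow
    (neg_mem (LinearMap.mem_range_self _ (capUnsigned Δ (t + 1) q (m + 1) (by omega) g z)))
  rw [neg_eq_of_add_eq_zero_right hL.symm, smul_smul, Int.units_mul_self, one_smul] at this
  exact this

/-- The cap product `Ĥʳ(A, M) × Ĥₛ(A, N) → Ĥₜ(A, M ⊗_A N)`, `t = s - r`. -/
def cap (t r s : ℤ) (h : t + r = s) :
    TateCohomology T M r →ₗ[k] TateHomology T N s →ₗ[k] TateHomology T (ATensor k A M N) t :=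
  (tateCoboundaries T M r).liftQ
    { toFun := fun u => (tateBoundaries T N s).mapQ (tateBoundaries T (ATensor k A M N) t)
        ((capChain Δ t r s h u.1).restrict (fun z hz => capChain_mem Δ t r s h u.2 hz))
        (by
          rintro z ⟨y, hy⟩
          change capChain Δ t r s h u.1 z.1 ∈
            LinearMap.range (tensorD T (ATensor k A M N) (t + 1) t)
          rw [show z.1 = tensorD T N (s + 1) s y from hy.symm]
          exact capChain_boundary Δ t r s h u.2 y)
      map_add' := fun u u' => Submodule.linearMap_qext _ (LinearMap.ext fun z =>
        congrArg (tateBoundaries T (ATensor k A M N) t).mkQ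
          (Subtype.ext (LinearMap.congr_fun ((capChain Δ t r s h).map_add u.1 u'.1) z.1)))
      map_smul' := fun c u => Submodule.linearMap_qext _ (LinearMap.ext fun z =>
        congrArg (tateBoundaries T (ATensor k A M N) t).mkQ
          (Subtype.ext (LinearMap.congr_fun ((capChain Δ t r s h).map_smul c u.1) z.1))) }
    (by
      rintro u ⟨g, hg⟩
      refine Submodule.linearMap_qext _ (LinearMap.ext fun z => ?_)
      refine (Submodule.Quotient.mk_eq_zero _).2 ?_
      change capChain Δ t r s h u.1 z.1 ∈
        LinearMap.range (tensorD T (ATensor k A M N) (t + 1) t)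
      rw [show u.1 = homD T M r (r - 1) g from hg.symm]
      exact capChain_coboundary Δ t r s _ h rfl g z.2)

theorem cap_mk (t r s : ℤ) (h : t + r = s) (u : tateCocycles T M r) (z : tateCycles T N s) :
    cap Δ t r s h (TateCohomology.mk T M r u) (TateHomology.mk T N s z) =
      TateHomology.mk T (ATensor k A M N) t
        ⟨capChain Δ t r s h u.1 z.1, capChain_mem Δ t r s h u.2 z.2⟩ := rfl

/-- The cap product with a class `ω ∈ Ĥ_{-1}(A, _1 A_β)`, as a map
`Ĥⁿ(A, M) → Ĥ_{-n-1}(A, _1 M_β)`, where `M ⊗_A (_1 A_β)` is identified with `_1 M_β`. -/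
def capWith (β : A ≃ₐ[k] A) (ω : TateHomology T (Twist AlgEquiv.refl β A) (-1)) (n : ℤ)
    (M : Type w) [AddCommGroup M] [Module k M] [Module (Env k A) M]
    [IsScalarTower k (Env k A) M] :
    TateCohomology T M n →ₗ[k] TateHomology T (Twist AlgEquiv.refl β M) (-n - 1) :=
  (TateHomology.map T (twistUnit M β) (-n - 1)).comp
    ((cap Δ (-n - 1) n (-1) (by omega)).flip ω)

end Cap

section Unit

variable {k : Type u} {A : Type v} [Field k] [Ring A] [Algebra k A] (T : CompleteResolution k A)

/-- The augmentation as a cocycle in `Hom_{Aᵉ}(T, A)`. -/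
def augmentationCocycle : tateCocycles T A 0 :=
  ⟨T.ε, (mem_tateCocycles (T := T) (M := A) (i := 1) (zero_add 1)).2
    (LinearMap.ext fun x => (T.ε_exact (T.d 1 0 x)).2 ⟨x, rfl⟩)⟩

/-- The unit `1 ∈ Ĥ⁰(A, A)`: the class of the augmentation. -/
def tateOne : TateCohomology T A 0 :=
  TateCohomology.mk T A 0 (augmentationCocycle T)

end Unit

/-! ## Duality and the fundamental class -/

section Duality

variable {k : Type u} {A : Type v} [Field k] [Ring A] [Algebra k A] [FiniteDimensional k A]
  (F : FrobeniusForm k A) (ν : A ≃ₐ[k] A) (T : CompleteResolution k A)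

/-- Let `T'` be the complex with `T'_j = _{ν⁻¹}((T_i)^∨)_1` for `i + j = -1` and differential
`f ↦ (-1)ⁱ f ∘ d` on `(T_i)^∨`. Thus `Σ T' = _{ν⁻¹}(T^∨)_1`. It is a complete resolution of `A`,
with the augmentation `ε' : T'_0 → A` that is determined by `t(ν⁻¹(ε'(f))) = - f ∘ η`
for `f ∈ (T_{-1})^∨`, where `t : _1 A_{ν⁻¹} → A^∨` is the standard isomorphism.
A dual comparison is an augmentation-preserving chain map `θ : T' → T`. -/
structure DualComparison where
  θ : ∀ i j : ℤ, i + j = -1 → Twist ν.symm AlgEquiv.refl (EnvDual k A (T.X i)) →ₗ[Env k A] T.X j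
  comm : ∀ (i j i' j' : ℤ) (h : i + j = -1) (h' : i' + j' = -1), j' + 1 = j →
    ∀ f : EnvDual k A (T.X i),
      T.d j j' (θ i j h (toTwist ν.symm AlgEquiv.refl _ f)) =
        i.negOnePow • θ i' j' h' (toTwist ν.symm AlgEquiv.refl _ (f.comp (T.d i' i)))
  augmentation : ∀ (f : EnvDual k A (T.X (-1))) (y : A),
    F.toDual ν (ν.symm (T.ε (θ (-1) 0 rfl (toTwist ν.symm AlgEquiv.refl _ f)))) y =
      - EnvDual.hom k A _ f (T.η y)

/-- The graph of the duality isomorphism `Ĥⁿ(A, M) ≅ Ĥ_m(A, _1 M_{ν⁻¹})`, `m = -n - 1`, which is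
the composite
`Hⁿ(Hom_{Aᵉ}(T, M)) ≅ H_{-n}(_{ν⁻¹}(T^∨)_1 ⊗_{Aᵉ} _1 M_{ν⁻¹}) = H_m(T' ⊗_{Aᵉ} _1 M_{ν⁻¹})
≅ H_m(T ⊗_{Aᵉ} _1 M_{ν⁻¹})`;
the first map is inverse to the evaluation map and the last one is induced by `θ : T' → T`. -/
def TateDual {M : Type w} [AddCommGroup M] [Module k M] [Module (Env k A) M]
    [IsScalarTower k (Env k A) M] {n m : ℤ} (h : n + m = -1) (c : TateCohomology T M n)
    (w : TateHomology T (Twist AlgEquiv.refl ν.symm M) m) : Prop :=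
  ∃ (θ : DualComparison F ν T) (u : tateCocycles T M n)
    (y : EnvTensor k A (Twist ν.symm AlgEquiv.refl (EnvDual k A (T.X n)))
      (Twist AlgEquiv.refl ν.symm M))
    (z : tateCycles T (Twist AlgEquiv.refl ν.symm M) m),
    TateCohomology.mk T M n u = c ∧ evalDual ν.symm (T.X n) M y = u.1 ∧
      z.1 = EnvTensor.map (θ.θ n m h) LinearMap.id y ∧ TateHomology.mk T _ m z = w

/-- The fundamental class of `A`: the element of `Ĥ_{-1}(A, _1 A_{ν⁻¹})` that corresponds to
`1 ∈ Ĥ⁰(A, A)` under the duality isomorphism. -/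
def IsFundamentalClass (ω : TateHomology T (Twist AlgEquiv.refl ν.symm A) (-1)) : Prop :=
  TateDual F ν T (by norm_num) (tateOne T) ω

end Duality

end TateHochschild

end

noncomputable section

namespace TateHochschild

open scoped TensorProduct ModuleCat
open MulOpposite

set_option linter.unusedSectionVars false

/-! A Frobenius form identifies `R`-linear maps into `R` with `k`-linear functionals, for `R = A`
and for `R = Aᵉ`. Hence finitely generated projective bimodules are also injective. Syzygies of `A`
therefore exist in both directions and splice to a complete resolution, and the comparison theorem
works upwards and downwards: augmentation-preserving chain maps between complete resolutions exist,
and a chain map `f` is null-homotopic as soon as `ε f₀` factors through `d₀` (`exists_chainMap`,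
`exists_nullHomotopy`).

A diagonal approximation is built row by row in the second degree `q`, starting from sections of `id
⊗ ε` in row `0`. Going up uses exactness of `Q ⊗_A T`, going down uses a contraction of `T ⊗_A Q` by
bimodule morphisms for `Q` finitely generated projective. Both come from one contraction of `T` over
left `A`-modules, which exists because `A` is projective and injective over itself.

For the duality, evaluation identifies `Hom(T, M)` with `T' ⊗ M_{ν⁻¹}` up to signs (`dualChain`),
and the duality isomorphism is induced by any comparison `θ : T' → T`. The cap product with a cycle
`z` that represents `ω` is natural in `M`, so its case `M = Aᵉ` determines it: up to sign it is
induced by a chain map `ψ : T' → T` (`exists_capChainMap`). What remains is that `ψ` is homotopic to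
`θ` (`capChainMap_sub_mem`).

The cocycle `ε ψ₀` factors through the augmentation `ε'` of `T'`, so it equals `c ε'` with `c`
central, and `ψ ≃ cθ`. Let `a` be the chain dual to the unit. Since `(id ⊗ ε)Δ ≃ id`, the unit caps
`ω` to `ω`; thus `ψ(a)` is homologous to `θ(a)`, and `ca` to `a` because `θ` is a homotopy
equivalence. As `ν` fixes the centre, duality turns this into `(c - 1)ε = w d₀` for some `w`. Then
`ε(cθ₀ - θ₀) = w d₀ θ₀` factors through the differential of `T'`, so `cθ ≃ θ`. The element `c`
itself need not be shown to be `1`. -/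

/-! ## Sequences indexed by the integers -/

/-- A sequence indexed by `ℤ` can be built from one term, if it can be prolonged in both
directions while an invariant `Q` is preserved. -/
theorem exists_int_seq {α : ℤ → Type w} (Q : ∀ n, α n → Prop) (R : ∀ n, α n → α (n + 1) → Prop)
    (n₀ : ℤ) (x₀ : α n₀) (h₀ : Q n₀ x₀)
    (up : ∀ n x, Q n x → ∃ y, Q (n + 1) y ∧ R n x y)
    (down : ∀ n y, Q (n + 1) y → ∃ x, Q n x ∧ R n x y) :
    ∃ x : ∀ n, α n, x n₀ = x₀ ∧ (∀ n, Q n (x n)) ∧ ∀ n, R n (x n) (x (n + 1)) := by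
  -- The relation is transported along `i + 1 = j`, because `n - 1 + 1 = n` does not hold by
  -- definition.
  let R' : ∀ i j, α i → α j → Prop := fun i j x y => ∃ h : i + 1 = j, R i x (h ▸ y)
  have down' : ∀ n (y : {y : α n // Q n y}), ∃ x : {x : α (n - 1) // Q (n - 1) x},
      R' (n - 1) n x.1 y.1 := by
    rintro n ⟨y, hy⟩
    have key : ∀ m, m + 1 = n → ∃ x : {x : α m // Q m x}, R' m n x.1 y := by
      rintro m rfl
      obtain ⟨x, hx, hR⟩ := down m y hy
      exact ⟨⟨x, hx⟩, rfl, hR⟩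
    exact key (n - 1) (by omega)
  have up' : ∀ n (x : {x : α n // Q n x}), ∃ y : {y : α (n + 1) // Q (n + 1) y},
      R' n (n + 1) x.1 y.1 := by
    rintro n ⟨x, hx⟩
    obtain ⟨y, hy, hR⟩ := up n x hx
    exact ⟨⟨y, hy⟩, rfl, hR⟩
  choose U hU using up'
  choose D hD using down'
  let seq : ∀ n, {x : α n // Q n x} := fun n =>
    Int.inductionOn' n n₀ ⟨x₀, h₀⟩ (fun n _ x => U n x) (fun n _ y => D n y)
  refine ⟨fun n => (seq n).1, ?_, fun n => (seq n).2, fun n => ?_⟩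
  · change (seq n₀).1 = x₀
    simp only [seq, Int.inductionOn'_self]
  · have key : ∀ i j, i + 1 = j → R' i j (seq i).1 (seq j).1 := by
      intro i j hij
      -- The step from `i` to `i + 1` belongs to the upward recursion if `n₀ ≤ i`, and to the
      -- downward one otherwise.
      rcases le_or_gt n₀ i with hi | hi
      · subst hij
        have := hU i (seq i)
        rwa [show U i (seq i) = seq (i + 1) from (Int.inductionOn'_add_one hi).symm] at this
      · obtain rfl : i = j - 1 := by omega
        have := hD j (seq j)
        rwa [show D j (seq j) = seq (j - 1) from
          (Int.inductionOn'_sub_one (by omega)).symm] at this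
    obtain ⟨_, h⟩ := key n (n + 1) rfl
    exact h

/-! ## Frobenius dualities -/

section FrobeniusDuality

/-- A Frobenius duality on a `k`-algebra `R`: an isomorphism of left `R`-modules `R ≅ R^*`. -/
structure FrobeniusDuality (k : Type u) (R : Type v) [Field k] [Ring R] [Algebra k R] where
  equiv : R ≃ₗ[k] Module.Dual k R
  equiv_mul : ∀ r x s, equiv (r * x) s = equiv x (s * r)

namespace FrobeniusDuality

variable {k : Type u} {R : Type v} [Field k] [Ring R] [Algebra k R] (B : FrobeniusDuality k R)

/-- The trace functional. -/
def tr : R →ₗ[k] k := B.equiv 1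

theorem equiv_apply (x s : R) : B.equiv x s = B.tr (s * x) := by
  have := B.equiv_mul x 1 s
  rwa [mul_one] at this

/-- In other words, the kernel of the trace contains no nonzero left ideal. This is why `R`-linear
maps into `R` can be compared after taking traces. -/
theorem eq_zero_of_tr {x : R} (h : ∀ s, B.tr (s * x) = 0) : x = 0 :=
  B.equiv.injective (by
    rw [map_zero]
    exact LinearMap.ext fun s => (B.equiv_apply x s).trans (h s))

variable {M : Type w} [AddCommGroup M] [Module k M] [Module R M] [IsScalarTower k R M]

theorem hom_eq_zero {f : M →ₗ[R] R} (h : ∀ m, B.tr (f m) = 0) : f = 0 :=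
  LinearMap.ext fun m => B.eq_zero_of_tr fun s => by
    rw [← smul_eq_mul, ← map_smul]
    exact h _

/-- The `R`-linear map `M → R` whose trace is a given functional on `M`. -/
def lift (φ : M →ₗ[k] k) : M →ₗ[R] R where
  toFun m := B.equiv.symm (φ ∘ₗ (LinearMap.toSpanSingleton R M m).restrictScalars k)
  map_add' m m' := by
    rw [← map_add]
    congr 1
    ext s
    simp
  map_smul' r m := by
    rw [RingHom.id_apply, smul_eq_mul, LinearEquiv.symm_apply_eq]
    ext s
    rw [B.equiv_mul, LinearEquiv.apply_symm_apply]
    simp [mul_smul]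

theorem tr_lift (φ : M →ₗ[k] k) (m : M) : B.tr (B.lift φ m) = φ m := by
  have := B.equiv_apply (B.lift φ m) 1
  rw [one_mul] at this
  rw [← this]
  simp [lift]

variable {Z : Type w'} [AddCommGroup Z] [Module k Z] [Module R Z] [IsScalarTower k R Z]

/-- Self-injectivity of `R`. Taking traces identifies `R`-linear maps into `R` with functionals, so
the extension problem becomes one of vector spaces, where it is always solvable. -/
theorem exists_factor_self (B : FrobeniusDuality k R) (p : M →ₗ[R] Z) (g : M →ₗ[R] R) (hg : ∀ m, p m = 0 → g m = 0) :
    ∃ h : Z →ₗ[R] R, h ∘ₗ p = g := by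
  -- The functional `tr ∘ g` descends to the range of `p`, and `φ` extends it to `Z`.
  obtain ⟨φ, hφ⟩ := ((LinearMap.ker (p.restrictScalars k)).liftQ (B.tr ∘ₗ g.restrictScalars k)
    (fun m hm => by simp [hg m hm]) ∘ₗ
    ((p.restrictScalars k).quotKerEquivRange.symm.toLinearMap)).exists_extend
  refine ⟨B.lift φ, sub_eq_zero.1 (B.hom_eq_zero fun m => ?_)⟩
  have h := LinearMap.congr_fun hφ ⟨p m, m, rfl⟩
  have h' : (p.restrictScalars k).quotKerEquivRange.symm ⟨p m, m, rfl⟩ =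
      (LinearMap.ker (p.restrictScalars k)).mkQ m := by
    rw [LinearEquiv.symm_apply_eq]
    rfl
  simp only [LinearMap.comp_apply, LinearEquiv.coe_coe, h', Submodule.mkQ_apply,
    Submodule.liftQ_apply, Submodule.subtype_apply, LinearMap.restrictScalars_apply] at h
  rw [LinearMap.sub_apply, map_sub, LinearMap.comp_apply, B.tr_lift, h, sub_self]

/-- Finitely generated projective modules over `R` are injective. -/
theorem exists_factor (B : FrobeniusDuality k R) {P : Type w''} [AddCommGroup P] [Module R P] [Module.Finite R P]
    [Module.Projective R P] (p : M →ₗ[R] Z) (g : M →ₗ[R] P) (hg : ∀ m, p m = 0 → g m = 0) :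
    ∃ h : Z →ₗ[R] P, h ∘ₗ p = g := by
  -- `P` is a retract of `Rⁿ`, so the problem is solved one coordinate at a time and pushed back
  -- along `f`.
  obtain ⟨n, f, i, -, -, hfi⟩ := Module.Finite.exists_comp_eq_id_of_projective R P
  have := fun j : Fin n => B.exists_factor_self p (LinearMap.proj j ∘ₗ i ∘ₗ g)
    (fun m hm => by simp [hg m hm])
  choose h hh using this
  refine ⟨f ∘ₗ LinearMap.pi h, LinearMap.ext fun m => ?_⟩
  have hm : LinearMap.pi h (p m) = i (g m) := funext fun j => LinearMap.congr_fun (hh j) m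
  rw [LinearMap.comp_apply, LinearMap.comp_apply, hm]
  exact LinearMap.congr_fun hfi (g m)

/-- Finite-dimensional modules over `R` embed into free modules of finite rank. -/
theorem exists_embedding (B : FrobeniusDuality k R) (M : Type w) [AddCommGroup M] [Module k M]
    [Module R M] [IsScalarTower k R M] [FiniteDimensional k M] :
    ∃ (n : ℕ) (i : M →ₗ[R] (Fin n → R)), Function.Injective i := by
  -- The lifts of the coordinate functionals are jointly injective, because their traces recover the
  -- coordinates.
  let b := Module.finBasis k M
  refine ⟨_, LinearMap.pi fun j => B.lift (b.coord j), ?_⟩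
  rw [← LinearMap.ker_eq_bot, LinearMap.ker_eq_bot']
  intro m hm
  refine b.repr.injective (Finsupp.ext fun j => ?_)
  have := B.tr_lift (b.coord j) m
  rw [show B.lift (b.coord j) m = 0 from congrFun hm j, map_zero] at this
  simpa using this.symm

end FrobeniusDuality

end FrobeniusDuality

/-! ### Frobenius dualities of `A` and of its enveloping algebra -/

section FrobeniusForm

variable {k : Type u} {A : Type v} [Field k] [Ring A] [Algebra k A] (F : FrobeniusForm k A)

theorem FrobeniusForm.form_one_left (x : A) : F.form 1 x = F.form x 1 := by
  have := F.assoc 1 x 1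
  rw [one_mul, mul_one] at this
  exact this.symm

theorem FrobeniusForm.form_eq (x y : A) : F.form x y = F.form (x * y) 1 := by
  rw [F.assoc, mul_one]

variable [FiniteDimensional k A]

/-- The duality `x ↦ ⟨-, x⟩` of a Frobenius algebra. -/
def FrobeniusForm.duality : FrobeniusDuality k A where
  equiv := LinearMap.BilinForm.toDual F.form.flip F.nondegenerate.flip
  equiv_mul r x s := by
    simp only [LinearMap.BilinForm.toDual_def]
    exact (F.assoc s r x).symm

theorem FrobeniusForm.duality_apply (x s : A) : F.duality.equiv x s = F.form s x := rfl

/-- The isomorphism `Aᵉ ≅ (Aᵉ)^*` given by `⟨a ⊗ b, a' ⊗ b'⟩ = ⟨a', a⟩ ⟨b, b'⟩`. -/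
def FrobeniusForm.envEquiv : Env k A ≃ₗ[k] Module.Dual k (Env k A) :=
  (TensorProduct.congr F.duality.equiv
    ((opLinearEquiv k).symm ≪≫ₗ F.form.toDual F.nondegenerate ≪≫ₗ
      (opLinearEquiv k : A ≃ₗ[k] Aᵐᵒᵖ).symm.dualMap)) ≪≫ₗ
    TensorProduct.dualDistribEquiv k A Aᵐᵒᵖ

theorem FrobeniusForm.envEquiv_env (a b a' b' : A) :
    F.envEquiv (env k a b) (env k a' b') = F.form a' a * F.form b b' := rfl

/-- The enveloping algebra of a Frobenius algebra has a Frobenius duality. -/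
def FrobeniusForm.envDuality : FrobeniusDuality k (Env k A) where
  equiv := F.envEquiv
  equiv_mul r x s := by
    induction r using env_induction with
    | zero => simp
    | add r r' h h' => simp only [add_mul, mul_add, map_add, LinearMap.add_apply, h, h']
    | env a b =>
      induction x using env_induction with
      | zero => simp
      | add r r' h h' => simp only [mul_add, map_add, LinearMap.add_apply, h, h']
      | env a' b' =>
        induction s using env_induction with
        | zero => simp
        | add r r' h h' => simp only [add_mul, map_add, h, h']
        | env a'' b'' =>
          simp only [env_mul, envEquiv_env, F.assoc]

theorem FrobeniusForm.envDuality_tr_env (a b : A) :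
    F.envDuality.tr (env k a b) = F.form a 1 * F.form 1 b := rfl

end FrobeniusForm

/-! ## Existence of complete resolutions -/

section Existence

variable {k : Type u} {A : Type v} [Field k] [Ring A] [Algebra k A] [FiniteDimensional k A]

instance : FiniteDimensional k (Env k A) :=
  inferInstanceAs (FiniteDimensional k (A ⊗[k] Aᵐᵒᵖ))

instance : IsNoetherianRing (Env k A) := IsNoetherianRing.of_finite k (Env k A)

instance : Module.Finite (Env k A) A :=
  Module.Finite.of_restrictScalars_finite k (Env k A) A

/-- A short exact sequence `0 → K → Rᵐ → C → 0`. -/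
def IsSyzygy {R : Type v} [Ring R] (C K : ModuleCat.{v} R) : Prop :=
  ∃ (m : ℕ) (i : K →ₗ[R] (Fin m → R)) (p : (Fin m → R) →ₗ[R] C),
    Function.Injective i ∧ Function.Surjective p ∧ Function.Exact i p

theorem exists_syzygy {R : Type v} [Ring R] [IsNoetherianRing R] (C : ModuleCat.{v} R)
    [Module.Finite R C] : ∃ K : ModuleCat.{v} R, Module.Finite R K ∧ IsSyzygy C K := by
  obtain ⟨m, p, hp⟩ := Module.Finite.exists_fin' R C
  exact ⟨ModuleCat.of R (LinearMap.ker p), inferInstanceAs (Module.Finite R (LinearMap.ker p)),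
    m, (LinearMap.ker p).subtype, p, Subtype.val_injective, hp, fun x => by simp⟩

/-- This step prolongs a resolution to the right. It rests on the Frobenius property: a finitely
generated `K` is finite-dimensional, hence embeds into a free bimodule of finite rank. -/
theorem exists_cosyzygy (F : FrobeniusForm k A) (K : ModuleCat.{v} (Env k A))
    [Module.Finite (Env k A) K] :
    ∃ C : ModuleCat.{v} (Env k A), Module.Finite (Env k A) C ∧ IsSyzygy C K := by
  have : FiniteDimensional k K := Module.Finite.trans (Env k A) K
  obtain ⟨m, i, hi⟩ := F.envDuality.exists_embedding K
  exact ⟨ModuleCat.of _ (_ ⧸ LinearMap.range i),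
    inferInstanceAs (Module.Finite _ (_ ⧸ LinearMap.range i)),
    m, i, (LinearMap.range i).mkQ, hi, Submodule.mkQ_surjective _,
    LinearMap.exact_iff.2 (Submodule.ker_mkQ _)⟩

/-- Since `Aᵉ` is self-injective, a functional that vanishes on the kernel of `g` extends along `g`.
So exactness of the dual complex is automatic for an exact complex. -/
theorem EnvDual.exact_comp (F : FrobeniusForm k A) {X Y Z : Type*} [AddCommGroup X]
    [Module (Env k A) X] [AddCommGroup Y] [Module k Y] [Module (Env k A) Y]
    [IsScalarTower k (Env k A) Y] [AddCommGroup Z] [Module k Z] [Module (Env k A) Z]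
    [IsScalarTower k (Env k A) Z] {f : X →ₗ[Env k A] Y} {g : Y →ₗ[Env k A] Z}
    (h : Function.Exact f g) :
    Function.Exact (fun a : EnvDual k A Z => a.comp g) (fun a : EnvDual k A Y => a.comp f) := by
  intro a
  constructor
  · intro ha
    obtain ⟨b, hb⟩ := F.envDuality.exists_factor g (EnvDual.hom k A Y a) (fun y hy => by
      obtain ⟨x, rfl⟩ := (h y).1 hy
      exact LinearMap.congr_fun (f := (EnvDual.hom k A Y a).comp f) (g := 0) ha x)
    exact ⟨(EnvDual.hom k A Z).symm b, hb⟩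
  · rintro ⟨b, rfl⟩
    exact LinearMap.ext fun x => by
      change EnvDual.hom k A Z b (g (f x)) = 0
      rw [h.apply_apply_eq_zero, map_zero]

theorem exists_completeResolution (F : FrobeniusForm k A) : Nonempty (CompleteResolution k A) := by
  -- The modules `Z n` are the syzygies, with short exact sequences `0 → Z (n + 1) → X n → Z n → 0`
  -- and `Z 0 = A`. The differential `X (n + 1) → X n` passes through `Z (n + 1)`.
  obtain ⟨Z, hZ₀, hZ, hR⟩ := exists_int_seq (α := fun _ => ModuleCat.{v} (Env k A))
    (fun _ Z => Module.Finite (Env k A) Z) (fun _ C K => IsSyzygy C K) 0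
    (ModuleCat.of (Env k A) A) (inferInstanceAs (Module.Finite (Env k A) A))
    (fun _ C _ => exists_syzygy C) (fun _ K _ => exists_cosyzygy F K)
  choose m i p hi hp hip using hR
  have hexact : ∀ n, Function.Exact ((i (n + 1)).comp (p (n + 1 + 1))) ((i n).comp (p (n + 1))) := by
    intro n x
    rw [LinearMap.comp_apply, map_eq_zero_iff _ (hi n), hip (n + 1) x]
    constructor
    · rintro ⟨y, rfl⟩
      obtain ⟨z, rfl⟩ := hp (n + 1 + 1) y
      exact ⟨z, rfl⟩
    · rintro ⟨z, rfl⟩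
      exact ⟨_, rfl⟩
  let X : ℤ → ModuleCat.{v} (Env k A) := fun n => ModuleCat.of (Env k A) (Fin (m n) → Env k A)
  let C : ChainComplex (ModuleCat.{v} (Env k A)) ℤ := ChainComplex.of X
    (fun n => ModuleCat.ofHom ((i n).comp (p (n + 1)))) (fun n => by
      exact ModuleCat.hom_ext (LinearMap.ext fun x => (hexact n).apply_apply_eq_zero x))
  have hd : ∀ n, (C.d (n + 1) n).hom = (i n).comp (p (n + 1)) := fun n => by
    have h : C.d (n + 1) n = ModuleCat.ofHom ((i n).comp (p (n + 1))) :=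
      ChainComplex.of_d X (fun n => ModuleCat.ofHom ((i n).comp (p (n + 1)))) n
    rw [h]
    rfl
  have hC : ∀ a b c, b + 1 = a → c + 1 = b → Function.Exact (C.d a b).hom (C.d b c).hom := by
    rintro _ _ n rfl rfl
    rw [hd, hd]
    exact hexact n
  -- The recursion yields `Z 0 = A` only as an equation, so the augmentation needs a transport.
  let e : Z 0 ≃ₗ[Env k A] A := (CategoryTheory.eqToIso hZ₀).toLinearEquiv
  exact ⟨{
    complex := C
    finite := fun n => inferInstanceAs (Module.Finite (Env k A) (Fin (m n) → Env k A))
    projective := fun n => inferInstanceAs (Module.Projective (Env k A) (Fin (m n) → Env k A))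
    exact := hC
    dual_exact := fun a b c hb hc => EnvDual.exact_comp F (hC a b c hb hc)
    ε := e.toLinearMap.comp (p 0)
    ε_surjective := e.surjective.comp (hp 0)
    ε_exact := by
      intro x
      have h : (C.d 1 0).hom = (i 0).comp (p 1) := hd 0
      rw [h, LinearMap.comp_apply, LinearEquiv.coe_coe, map_eq_zero_iff _ e.injective,
        hip 0 x]
      constructor
      · rintro ⟨y, rfl⟩
        obtain ⟨z, rfl⟩ := hp 1 y
        exact ⟨z, rfl⟩
      · rintro ⟨z, rfl⟩
        exact ⟨_, rfl⟩ }⟩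

end Existence

/-! ## Comparison of complete resolutions -/

section Comparison

variable {k : Type u} {A : Type v} [Field k] [Ring A] [Algebra k A]

namespace CompleteResolution

variable (S T : CompleteResolution k A)

instance (n : ℤ) : Module.Finite (Env k A) (T.X n) := T.finite n

instance (n : ℤ) : Module.Projective (Env k A) (T.X n) := T.projective n

variable {S T}

/-- The kernels of `d₀` and `ε` agree, since both equal the image of `d₁`. -/
theorem η_injective : Function.Injective T.η := by
  rw [← LinearMap.ker_eq_bot, LinearMap.ker_eq_bot']
  intro a ha
  obtain ⟨x, rfl⟩ := T.ε_surjective a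
  rw [η_ε] at ha
  obtain ⟨y, rfl⟩ := (T.exact 1 0 (-1) (by norm_num) (by norm_num) x).1 ha
  exact (T.ε_exact _).2 ⟨y, rfl⟩

theorem ε_d (x : T.X 1) : T.ε (T.d 1 0 x) = 0 := (T.ε_exact _).2 ⟨x, rfl⟩

/-- A map into a term of an exact pair lifts if the source is projective. -/
theorem exists_lift_d {P : Type w} [AddCommGroup P] [Module (Env k A) P]
    [Module.Projective (Env k A) P] (i j l : ℤ) (hj : j + 1 = i) (hl : l + 1 = j)
    (g : P →ₗ[Env k A] T.X j) (hg : ∀ x, T.d j l (g x) = 0) :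
    ∃ h : P →ₗ[Env k A] T.X i, (T.d i j).comp h = g := by
  obtain ⟨h, hh⟩ := Module.projective_lifting_property (T.d i j).rangeRestrict
    (g.codRestrict (LinearMap.range (T.d i j)) (fun x => (T.exact i j l hj hl _).1 (hg x)))
    (T.d i j).surjective_rangeRestrict
  exact ⟨h, LinearMap.ext fun x => congrArg Subtype.val (LinearMap.congr_fun hh x)⟩

variable [FiniteDimensional k A]

/-- A map from a term of an exact pair to a finitely generated projective bimodule extends. -/
theorem exists_extend_d (F : FrobeniusForm k A) {P : Type w} [AddCommGroup P]
    [Module (Env k A) P] [Module.Finite (Env k A) P] [Module.Projective (Env k A) P]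
    (i j l : ℤ) (hj : j + 1 = i) (hl : l + 1 = j)
    (g : T.X j →ₗ[Env k A] P) (hg : ∀ x, g (T.d i j x) = 0) :
    ∃ h : T.X l →ₗ[Env k A] P, h.comp (T.d j l) = g :=
  F.envDuality.exists_factor (T.d j l) g (fun m hm => by
    obtain ⟨x, rfl⟩ := (T.exact i j l hj hl _).1 hm
    exact hg x)

variable (S T) in
/-- A chain map of complete resolutions. -/
structure ChainMap where
  f : ∀ n, S.X n →ₗ[Env k A] T.X n
  comm : ∀ i j, j + 1 = i → ∀ x, T.d i j (f i x) = f j (S.d i j x)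

/-- There is an augmentation-preserving chain map between any two complete resolutions. -/
theorem exists_chainMap (F : FrobeniusForm k A) (S T : CompleteResolution k A) :
    ∃ f : ChainMap S T, ∀ x, T.ε (f.f 0 x) = S.ε x := by
  obtain ⟨f₀, hf₀⟩ := Module.projective_lifting_property T.ε S.ε T.ε_surjective
  have hf₀' : ∀ x, T.ε (f₀ x) = S.ε x := LinearMap.congr_fun hf₀
  -- The invariant says that `f` maps boundaries to cycles. This is the obstruction to lifting
  -- upwards. In degree `0` it follows from `d₀ = η ε` and `ε f₀ = ε`. The downward step uses
  -- injectivity of the terms of `T`.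
  obtain ⟨f, hf, -, hR⟩ := exists_int_seq (α := fun n => S.X n →ₗ[Env k A] T.X n)
    (fun n f => ∀ x, T.d n (n - 1) (f (S.d (n + 1) n x)) = 0)
    (fun n f g => ∀ x, T.d (n + 1) n (g x) = f (S.d (n + 1) n x)) 0 f₀
    (fun x => by
      change T.d 0 (-1) (f₀ (S.d 1 0 x)) = 0
      rw [← T.η_ε, hf₀', ε_d, map_zero])
    (fun n f hf => by
      obtain ⟨g, hg⟩ := exists_lift_d (n + 1) n (n - 1) rfl (by omega) (f.comp (S.d (n + 1) n)) hf
      have hg' : ∀ x, T.d (n + 1) n (g x) = f (S.d (n + 1) n x) := LinearMap.congr_fun hg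
      refine ⟨g, fun x => ?_, hg'⟩
      have h : n + 1 - 1 = n := by omega
      rw [h, hg', S.d_d, map_zero])
    (fun n g hg => by
      have h : n + 1 - 1 = n := by omega
      rw [h] at hg
      obtain ⟨f, hf⟩ := exists_extend_d F (n + 1 + 1) (n + 1) n rfl rfl
        ((T.d (n + 1) n).comp g) hg
      have hf' : ∀ x, f (S.d (n + 1) n x) = T.d (n + 1) n (g x) := LinearMap.congr_fun hf
      exact ⟨f, fun x => by rw [hf', T.d_d], fun x => (hf' x).symm⟩)
  refine ⟨⟨f, ?_⟩, fun x => ?_⟩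
  · rintro _ j rfl x
    exact hR j x
  · exact (congrArg (fun g => T.ε (g x)) hf).trans (hf₀' x)

/-- A null-homotopy of a chain map. -/
structure NullHomotopy (f : ChainMap S T) where
  h : ∀ i j, i + 1 = j → S.X i →ₗ[Env k A] T.X j
  comm : ∀ i j l (hij : i + 1 = j) (hjl : j + 1 = l) x,
    f.f j x = T.d l j (h j l hjl x) + h i j hij (S.d j i x)

/-- A chain map is null-homotopic if it is zero in `H⁰(Hom_{Aᵉ}(S, A))`. -/
theorem exists_nullHomotopy (F : FrobeniusForm k A) (f : ChainMap S T)
    (w : S.X (-1) →ₗ[Env k A] A) (hw : ∀ x, T.ε (f.f 0 x) = w (S.d 0 (-1) x)) :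
    Nonempty (NullHomotopy f) := by
  -- The homotopy starts in degree `-1` with a lift `h₀ : S₋₁ → T₀` of `w`. Then `d₀ h₀ d₀ = η w d₀
  -- = η ε f₀ = d₀ f₀ = f₋₁ d₀`, which is the invariant in that degree.
  obtain ⟨h₀, hh₀⟩ := Module.projective_lifting_property T.ε w T.ε_surjective
  have hh₀' : ∀ x, T.ε (h₀ x) = w x := LinearMap.congr_fun hh₀
  obtain ⟨h, -, -, hR⟩ := exists_int_seq (α := fun n => S.X n →ₗ[Env k A] T.X (n + 1))
    (fun n h => ∀ x, T.d (n + 1) n (h (S.d (n + 1) n x)) = f.f n (S.d (n + 1) n x))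
    (fun n h h' => ∀ x, f.f (n + 1) x = T.d (n + 1 + 1) (n + 1) (h' x) + h (S.d (n + 1) n x))
    (-1) h₀
    (fun x => by
      change T.d 0 (-1) (h₀ (S.d 0 (-1) x)) = f.f (-1) (S.d 0 (-1) x)
      rw [← f.comm 0 (-1) (by norm_num), ← T.η_ε, ← T.η_ε, hh₀', hw])
    (fun n h hh => by
      obtain ⟨h', hh'⟩ := exists_lift_d (n + 1 + 1) (n + 1) n rfl rfl
        (f.f (n + 1) - h.comp (S.d (n + 1) n)) (fun x => by
          simp [f.comm, hh])
      have hh'' : ∀ x, T.d (n + 1 + 1) (n + 1) (h' x) = f.f (n + 1) x - h (S.d (n + 1) n x) :=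
        LinearMap.congr_fun hh'
      exact ⟨h', fun x => by rw [hh'', S.d_d, map_zero, sub_zero], fun x => by
        rw [hh'', sub_add_cancel]⟩)
    (fun n h' hh' => by
      obtain ⟨h, hh⟩ := exists_extend_d F (n + 1 + 1) (n + 1) n rfl rfl
        (f.f (n + 1) - (T.d (n + 1 + 1) (n + 1)).comp h') (fun x => by
          simp [hh'])
      have hh'' : ∀ x, h (S.d (n + 1) n x) = f.f (n + 1) x - T.d (n + 1 + 1) (n + 1) (h' x) :=
        LinearMap.congr_fun hh
      exact ⟨h, fun x => by rw [hh'', map_sub, T.d_d, sub_zero, f.comm _ _ rfl], fun x => by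
        rw [hh'', add_sub_cancel]⟩)
  refine ⟨⟨fun i j hij => hij ▸ h i, ?_⟩⟩
  rintro i _ _ rfl rfl x
  exact hR i x

end CompleteResolution

end Comparison

/-! ## Contractions of complete resolutions as complexes of left modules -/

section LeftContraction

variable (k : Type u) (A : Type v) [Field k] [Ring A] [Algebra k A]

/-- The ring homomorphism `a ↦ a ⊗ 1`. -/
def leftHom : A →+* Env k A :=
  (Algebra.TensorProduct.includeLeft : A →ₐ[k] A ⊗[k] Aᵐᵒᵖ).toRingHom

/-- The left `A`-module underlying a bimodule. -/
abbrev leftModule (X : Type w) [AddCommGroup X] [Module (Env k A) X] : Module A X :=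
  Module.compHom X (leftHom k A)

/-- Through `a ⊗ 1` the algebra `Aᵉ` is free of finite rank over `A`, and a retract of `(Aᵉ)ⁿ` is
then a retract of a free `A`-module of finite rank. -/
theorem leftModule_finite_projective [FiniteDimensional k A] (X : Type w) [AddCommGroup X]
    [Module (Env k A) X] [Module.Finite (Env k A) X] [Module.Projective (Env k A) X] :
    @Module.Finite A X _ _ (leftModule k A X) ∧ @Module.Projective A _ X _ (leftModule k A X) := by
  let := leftModule k A X
  let : Module A (Env k A) := inferInstanceAs (Module A (A ⊗[k] Aᵐᵒᵖ))
  have : Module.Finite A (Env k A) := inferInstanceAs (Module.Finite A (A ⊗[k] Aᵐᵒᵖ))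
  have : Module.Free A (Env k A) := inferInstanceAs (Module.Free A (A ⊗[k] Aᵐᵒᵖ))
  have hsmul : ∀ (a : A) (c : Env k A), a • c = env k a 1 * c := by
    intro a c
    induction c using env_induction with
    | zero => simp
    | add x y hx hy => rw [smul_add, hx, hy, mul_add]
    | env b b' =>
      rw [env_mul, mul_one]
      rfl
  have : IsScalarTower A (Env k A) (Env k A) := ⟨fun a c x => by
    rw [smul_eq_mul, smul_eq_mul, hsmul, hsmul, mul_assoc]⟩
  have : IsScalarTower A (Env k A) X := ⟨fun a c x => by
    rw [hsmul, mul_smul]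
    rfl⟩
  obtain ⟨n, f, i, hf, -, hfi⟩ := Module.Finite.exists_comp_eq_id_of_projective (Env k A) X
  refine ⟨Module.Finite.of_surjective (f.restrictScalars A) hf,
    Module.Projective.of_split (i.restrictScalars A) (f.restrictScalars A)
      (LinearMap.ext fun x => LinearMap.congr_fun hfi x)⟩

variable {k A}

/-- A contraction of a complete resolution, as a complex of left `A`-modules. -/
structure LeftContraction (T : CompleteResolution k A) where
  s : ∀ i j, i + 1 = j → T.X i →ₗ[k] T.X j
  smul : ∀ i j h (a : A) x, s i j h (env k a 1 • x) = env k a 1 • s i j h x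
  comm : ∀ i j l hij hjl x, T.d l j (s j l hjl x) + s i j hij (T.d j i x) = x

/-- As a left module, `A` is both projective and injective, so the complex splits at `A`. All terms
are also projective and injective over `A`, and the splitting spreads in both directions. -/
theorem exists_leftContraction [FiniteDimensional k A] (F : FrobeniusForm k A)
    (T : CompleteResolution k A) : Nonempty (LeftContraction T) := by
  let : ∀ n, Module A (T.X n) := fun n => leftModule k A (T.X n)
  have : ∀ n, Module.Finite A (T.X n) := fun n => (leftModule_finite_projective k A (T.X n)).1
  have : ∀ n, Module.Projective A (T.X n) := fun n =>
    (leftModule_finite_projective k A (T.X n)).2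
  have hsmul : ∀ n (a : A) (x : T.X n), a • x = env k a 1 • x := fun _ _ _ => rfl
  have : ∀ n, IsScalarTower k A (T.X n) := fun n => ⟨fun r a x => by
    rw [hsmul, hsmul, env_smul_left, smul_assoc]⟩
  let d : ∀ i j, T.X i →ₗ[A] T.X j := fun i j =>
    { (T.d i j).toAddHom with map_smul' := fun a x => (T.d i j).map_smul (env k a 1) x }
  let ε : T.X 0 →ₗ[A] A :=
    { T.ε.toAddHom with
      map_smul' := fun a x => (T.ε.map_smul (env k a 1) x).trans (by
        rw [env_smul_self, mul_one]
        rfl) }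
  let η : A →ₗ[A] T.X (-1) :=
    { T.η.toAddHom with
      map_smul' := fun a x => by
        have h := T.η.map_smul (env k a 1) x
        rw [env_smul_self, mul_one] at h
        exact h }
  -- `σ` is a section of `ε` and `ρ` a retraction of `η`. The contraction starts with `σ ρ` in
  -- degree `-1`, where `d₀ σ ρ d₀ = η ε σ ρ η ε = d₀`.
  obtain ⟨σ, hσ⟩ := Module.projective_lifting_property ε LinearMap.id T.ε_surjective
  obtain ⟨ρ, hρ⟩ := F.duality.exists_factor η LinearMap.id (fun a ha =>
    (map_eq_zero_iff T.η T.η_injective).1 ha)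
  have hσ' : ∀ a, T.ε (σ a) = a := LinearMap.congr_fun hσ
  have hρ' : ∀ a, ρ (T.η a) = a := LinearMap.congr_fun hρ
  obtain ⟨s, -, -, hR⟩ := exists_int_seq (α := fun n => T.X n →ₗ[A] T.X (n + 1))
    (fun n s => ∀ x, T.d (n + 1) n (s (T.d (n + 1) n x)) = T.d (n + 1) n x)
    (fun n s s' => ∀ x, T.d (n + 1 + 1) (n + 1) (s' x) + s (T.d (n + 1) n x) = x)
    (-1) (σ ∘ₗ ρ)
    (fun x => by
      change T.d 0 (-1) (σ (ρ (T.d 0 (-1) x))) = T.d 0 (-1) x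
      rw [← T.η_ε, ← T.η_ε, hρ', hσ'])
    (fun n s hs => by
      have hker : ∀ x, x - s (T.d (n + 1) n x) ∈ LinearMap.range (d (n + 1 + 1) (n + 1)) :=
        fun x => (T.exact (n + 1 + 1) (n + 1) n rfl rfl _).1 (by simp [hs])
      obtain ⟨s', hs'⟩ := Module.projective_lifting_property
        (d (n + 1 + 1) (n + 1)).rangeRestrict
        ((LinearMap.id - s ∘ₗ d (n + 1) n).codRestrict _ hker)
        (LinearMap.surjective_rangeRestrict _)
      have hs'' : ∀ x, T.d (n + 1 + 1) (n + 1) (s' x) = x - s (T.d (n + 1) n x) :=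
        fun x => congrArg Subtype.val (LinearMap.congr_fun hs' x)
      exact ⟨s', fun x => by rw [hs'', T.d_d, map_zero, sub_zero], fun x => by
        rw [hs'', sub_add_cancel]⟩)
    (fun n s' hs' => by
      obtain ⟨s, hs⟩ := F.duality.exists_factor (d (n + 1) n)
        (LinearMap.id - d (n + 1 + 1) (n + 1) ∘ₗ s') (fun x hx => by
          obtain ⟨y, rfl⟩ := (T.exact (n + 1 + 1) (n + 1) n rfl rfl _).1 hx
          exact sub_eq_zero.2 (hs' y).symm)
      have hs'' : ∀ x, s (T.d (n + 1) n x) = x - T.d (n + 1 + 1) (n + 1) (s' x) :=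
        fun x => LinearMap.congr_fun hs x
      exact ⟨s, fun x => by rw [hs'', map_sub, T.d_d, sub_zero], fun x => by
        rw [hs'', add_sub_cancel]⟩)
  refine ⟨⟨fun i j hij => (hij ▸ s i : T.X i →ₗ[A] T.X j).restrictScalars k, ?_, ?_⟩⟩
  · rintro i _ rfl a x
    exact (s i).map_smul a x
  · rintro i _ _ rfl rfl x
    exact hR i x

end LeftContraction

/-! ## Left linear maps and tensor products -/

section LeftLinear

variable {k : Type u} {A : Type v} [Field k] [Ring A] [Algebra k A]
variable {X : Type*} [AddCommGroup X] [Module k X] [Module (Env k A) X]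
  [IsScalarTower k (Env k A) X]
variable {Y : Type*} [AddCommGroup Y] [Module k Y] [Module (Env k A) Y]
  [IsScalarTower k (Env k A) Y]
variable {Q : Type*} [AddCommGroup Q] [Module k Q] [Module (Env k A) Q]
  [IsScalarTower k (Env k A) Q]

/-- A left linear map `s : X → Y` induces a map `Q ⊗_A X → Q ⊗_A Y`. -/
def ATensor.lmap (s : X →ₗ[k] Y) (hs : ∀ (a : A) x, s (env k a 1 • x) = env k a 1 • s x) :
    ATensor k A Q X →ₗ[k] ATensor k A Q Y :=
  ATensor.lift ((ATensor.mk k A Q Y).compl₂ s) (fun a q x => by simp [ATensor.mk_smul, hs])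

theorem ATensor.lmap_mk (s : X →ₗ[k] Y) (hs : ∀ (a : A) x, s (env k a 1 • x) = env k a 1 • s x)
    (q : Q) (x : X) : ATensor.lmap s hs (ATensor.mk k A Q X q x) = ATensor.mk k A Q Y q (s x) := rfl

/-- The bilinear map `(a ⊗ b, x) ↦ s(x a) ⊗ e b`. -/
def sandwich (s : X →ₗ[k] Y) (e : Q) : Env k A →ₗ[k] X →ₗ[k] ATensor k A Y Q :=
  TensorProduct.lift (LinearMap.mk₂ k
    (fun (a : A) (b : Aᵐᵒᵖ) => (ATensor.mk k A Y Q).flip (env k 1 b.unop • e) ∘ₗ s ∘ₗ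
      Algebra.lsmul k k X (env k 1 a))
    (fun a a' b => LinearMap.ext fun x => by simp [env_add_right])
    (fun r a b => LinearMap.ext fun x => by simp [env_smul_right])
    (fun a b b' => LinearMap.ext fun x => by simp [env_add_right, add_smul])
    (fun r a b => LinearMap.ext fun x => by simp [env_smul_right]))

theorem sandwich_env (s : X →ₗ[k] Y) (e : Q) (a b : A) (x : X) :
    sandwich s e (env k a b) x = ATensor.mk k A Y Q (s (env k 1 a • x)) (env k 1 b • e) := rfl

/-- This rule makes the extension of `s` to `X ⊗_A Q` balanced over `A` and right linear. The model
is `Q = Aᵉ`, where `X ⊗_A Aᵉ` is `X ⊗_k A` and the right action on `X` disappears, so that left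
linearity of `s` suffices. -/
theorem sandwich_env_mul (s : X →ₗ[k] Y) (e : Q) (a b : A) (c : Env k A) (x : X) :
    sandwich s e (env k a b * c) x = env k 1 b • sandwich s e c (env k 1 a • x) := by
  induction c using env_induction with
  | zero => simp
  | add c c' h h' => simp only [mul_add, map_add, LinearMap.add_apply, smul_add, h, h']
  | env a' b' =>
    simp only [env_mul, sandwich_env, ATensor.env_smul_mk, ← mul_smul, mul_one, env_one, one_smul]

theorem sandwich_smul (s : X →ₗ[k] Y) (hs : ∀ (a : A) x, s (env k a 1 • x) = env k a 1 • s x)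
    (e : Q) (a : A) (c : Env k A) (x : X) :
    sandwich s e c (env k a 1 • x) = env k a 1 • sandwich s e c x := by
  induction c using env_induction with
  | zero => simp
  | add c c' h h' => simp only [map_add, LinearMap.add_apply, smul_add, h, h']
  | env a' b' =>
    simp only [sandwich_env, ATensor.env_smul_mk, env_one, ← hs, ← mul_smul, env_mul,
      mul_one, one_mul]

variable (k A) in
/-- A finite dual basis of a bimodule. -/
structure EnvDualBasis (Q : Type w) [AddCommGroup Q] [Module (Env k A) Q] where
  n : ℕ
  e : Fin n → Q
  φ : Fin n → Q →ₗ[Env k A] Env k A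
  sum_smul : ∀ q, ∑ i, φ i q • e i = q

theorem exists_envDualBasis (Q : Type w) [AddCommGroup Q] [Module (Env k A) Q]
    [Module.Finite (Env k A) Q] [Module.Projective (Env k A) Q] :
    Nonempty (EnvDualBasis k A Q) := by
  obtain ⟨n, f, i, -, -, hfi⟩ := Module.Finite.exists_comp_eq_id_of_projective (Env k A) Q
  refine ⟨⟨n, fun j => f (Pi.single j 1), fun j => LinearMap.proj j ∘ₗ i, fun q => ?_⟩⟩
  have h := LinearMap.congr_fun hfi q
  rw [LinearMap.comp_apply, LinearMap.pi_apply_eq_sum_univ f (i q)] at h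
  refine Eq.trans (Finset.sum_congr rfl fun j _ => ?_) h
  simp only [LinearMap.comp_apply, LinearMap.proj_apply]
  congr 2
  ext l
  simp [Pi.single_apply, eq_comm]

/-- A left linear map `s : X → Y` induces a morphism of bimodules `X ⊗_A Q → Y ⊗_A Q`, if a dual
basis of `Q` is given. -/
def EnvDualBasis.extend (b : EnvDualBasis k A Q) (s : X →ₗ[k] Y)
    (hs : ∀ (a : A) x, s (env k a 1 • x) = env k a 1 • s x) :
    ATensor k A X Q →ₗ[Env k A] ATensor k A Y Q :=
  ATensor.toEnvLinear
    (ATensor.lift (∑ i, (sandwich s (b.e i) ∘ₗ (b.φ i).restrictScalars k).flip) (fun a x q => by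
      simp only [LinearMap.sum_apply, LinearMap.flip_apply, LinearMap.comp_apply,
        LinearMap.restrictScalars_apply, map_smul, smul_eq_mul, sandwich_env_mul, env_one,
        one_smul]))
    (fun a a' x q => by
      simp only [ATensor.lift_mk, LinearMap.sum_apply, LinearMap.flip_apply, LinearMap.comp_apply,
        LinearMap.restrictScalars_apply, map_smul, smul_eq_mul, sandwich_env_mul, env_one,
        one_smul, sandwich_smul s hs, Finset.smul_sum, ← mul_smul, env_mul, mul_one])

theorem EnvDualBasis.extend_mk (b : EnvDualBasis k A Q) (s : X →ₗ[k] Y)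
    (hs : ∀ (a : A) x, s (env k a 1 • x) = env k a 1 • s x) (x : X) (q : Q) :
    b.extend s hs (ATensor.mk k A X Q x q) = ∑ i, sandwich s (b.e i) (b.φ i q) x := by
  change (∑ i, (sandwich s (b.e i) ∘ₗ (b.φ i).restrictScalars k).flip) x q = _
  simp

/-- Summed over a dual basis, this shows that the extension of the identity is the identity; the
contraction identity thereby passes to `T ⊗_A Q`. -/
theorem sandwich_id (e : Q) (c : Env k A) (x : X) :
    sandwich LinearMap.id e c x = ATensor.mk k A X Q x (c • e) := by
  induction c using env_induction with
  | zero => simp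
  | add c c' h h' => simp only [map_add, LinearMap.add_apply, add_smul, h, h']
  | env a' b' =>
    simp only [sandwich_env, LinearMap.id_apply, ATensor.mk_smul, ← mul_smul, env_mul, mul_one]

theorem map_sandwich {Y' : Type*} [AddCommGroup Y'] [Module k Y'] [Module (Env k A) Y']
    [IsScalarTower k (Env k A) Y'] (d : Y →ₗ[Env k A] Y') (s : X →ₗ[k] Y) (e : Q)
    (c : Env k A) (x : X) :
    ATensor.map d LinearMap.id (sandwich s e c x) =
      sandwich (d.restrictScalars k ∘ₗ s) e c x := by
  induction c using env_induction with
  | zero => simp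
  | add c c' h h' => simp only [map_add, LinearMap.add_apply, h, h']
  | env a' b' => rfl

theorem sandwich_map {X' : Type*} [AddCommGroup X'] [Module k X'] [Module (Env k A) X']
    [IsScalarTower k (Env k A) X'] (d : X' →ₗ[Env k A] X) (s : X →ₗ[k] Y) (e : Q)
    (c : Env k A) (x : X') :
    sandwich s e c (d x) = sandwich (s ∘ₗ d.restrictScalars k) e c x := by
  induction c using env_induction with
  | zero => simp
  | add c c' h h' => simp only [map_add, LinearMap.add_apply, h, h']
  | env a' b' => simp [sandwich_env]

theorem sandwich_add (s s' : X →ₗ[k] Y) (e : Q) (c : Env k A) (x : X) :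
    sandwich (s + s') e c x = sandwich s e c x + sandwich s' e c x := by
  induction c using env_induction with
  | zero => simp
  | add c c' h h' =>
    simp only [map_add, LinearMap.add_apply, h, h']
    abel
  | env a' b' => simp [sandwich_env]

end LeftLinear

/-! ### Contractibility of `T ⊗_A Q` and exactness of `Q ⊗_A T` -/

section Contraction

variable {k : Type u} {A : Type v} [Field k] [Ring A] [Algebra k A]
  {T : CompleteResolution k A} (c : LeftContraction T)
variable {Q : Type*} [AddCommGroup Q] [Module k Q] [Module (Env k A) Q]
  [IsScalarTower k (Env k A) Q]

/-- The contraction of `T ⊗_A Q`, for a finitely generated projective bimodule `Q`. -/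
theorem LeftContraction.extend_comm (b : EnvDualBasis k A Q) (i j l : ℤ) (hij : i + 1 = j)
    (hjl : j + 1 = l) (t : ATensor k A (T.X j) Q) :
    ATensor.map (T.d l j) LinearMap.id (b.extend (c.s j l hjl) (c.smul j l hjl) t) +
      b.extend (c.s i j hij) (c.smul i j hij) (ATensor.map (T.d j i) LinearMap.id t) = t := by
  induction t using ATensor.induction with
  | zero => simp
  | add x y hx hy =>
    simp only [map_add]
    nth_rw 3 [← hx, ← hy]
    abel
  | mk x q =>
    have h : (T.d l j).restrictScalars k ∘ₗ c.s j l hjl +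
        c.s i j hij ∘ₗ (T.d j i).restrictScalars k = LinearMap.id :=
      LinearMap.ext (c.comm i j l hij hjl)
    rw [ATensor.map_mk, LinearMap.id_apply, b.extend_mk, b.extend_mk, map_sum,
      ← Finset.sum_add_distrib, Finset.sum_congr rfl fun a _ => by
        rw [map_sandwich, sandwich_map, ← sandwich_add, h, sandwich_id], ← map_sum, b.sum_smul]

/-- The complex `Q ⊗_A T` is exact. -/
theorem LeftContraction.exists_eq_map (c : LeftContraction T) (i j l : ℤ) (hij : i + 1 = j) (hjl : j + 1 = l)
    (t : ATensor k A Q (T.X j)) (ht : ATensor.map LinearMap.id (T.d j i) t = 0) :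
    ∃ t', ATensor.map LinearMap.id (T.d l j) t' = t := by
  -- In `Q ⊗_A T` the balancing uses only the left action on `T`, so `id ⊗ s` is defined for every
  -- `Q`. It is merely `k`-linear in general, which is enough for exactness.
  refine ⟨ATensor.lmap (c.s j l hjl) (c.smul j l hjl) t, ?_⟩
  have h : ∀ t : ATensor k A Q (T.X j),
      ATensor.map LinearMap.id (T.d l j) (ATensor.lmap (c.s j l hjl) (c.smul j l hjl) t) +
        ATensor.lmap (c.s i j hij) (c.smul i j hij) (ATensor.map LinearMap.id (T.d j i) t) = t := by
    intro t
    induction t using ATensor.induction with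
    | zero => simp
    | add x y hx hy =>
      simp only [map_add]
      nth_rw 3 [← hx, ← hy]
      abel
    | mk q x =>
      simp only [ATensor.map_mk, ATensor.lmap_mk, LinearMap.id_apply, ← map_add, c.comm]
  have h' := h t
  rwa [ht, map_zero, add_zero] at h'

end Contraction

/-! ## Existence of diagonal approximations -/

section DiagonalExistence

variable {k : Type u} {A : Type v} [Field k] [Ring A] [Algebra k A]

theorem map_units_smul' {M N : Type*} [AddCommGroup M] [AddCommGroup N] (f : M →+ N) (e : ℤˣ)
    (x : M) : f (e • x) = e • f x := by
  rcases Int.units_eq_one_or e with rfl | rfl <;> simp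

theorem units_smul_smul_self {M : Type*} [AddCommGroup M] (e : ℤˣ) (x : M) : e • e • x = x := by
  rw [smul_smul, Int.units_mul_self, one_smul]

section Maps

variable {X Y X' Y' : Type*} [AddCommGroup X] [Module k X] [Module (Env k A) X]
  [IsScalarTower k (Env k A) X] [AddCommGroup Y] [Module k Y] [Module (Env k A) Y]
  [IsScalarTower k (Env k A) Y] [AddCommGroup X'] [Module k X'] [Module (Env k A) X']
  [IsScalarTower k (Env k A) X'] [AddCommGroup Y'] [Module k Y'] [Module (Env k A) Y']
  [IsScalarTower k (Env k A) Y']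

theorem ATensor.map_comm (f : X →ₗ[Env k A] X') (g : Y →ₗ[Env k A] Y') (t : ATensor k A X Y) :
    ATensor.map f LinearMap.id (ATensor.map LinearMap.id g t) =
      ATensor.map LinearMap.id g (ATensor.map f LinearMap.id t) := by
  induction t using ATensor.induction with
  | zero => simp
  | mk x y => rfl
  | add x y hx hy => simp only [map_add, hx, hy]

/-- The canonical isomorphism `X ⊗_A A → X`, `x ⊗ a ↦ x a`. -/
def rightUnit (X : Type*) [AddCommGroup X] [Module k X] [Module (Env k A) X]
    [IsScalarTower k (Env k A) X] : ATensor k A X A →ₗ[Env k A] X :=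
  ATensor.toEnvLinear
    (ATensor.lift
      (LinearMap.mk₂ k (fun (x : X) (a : A) => env k 1 a • x)
        (fun x x' a => smul_add _ _ _)
        (fun r x a => smul_comm _ _ _)
        (fun x a b => by rw [env_add_right, add_smul])
        (fun r x a => by rw [env_smul_right, smul_assoc]))
      (fun a x b => by
        simp only [LinearMap.mk₂_apply, env_smul_self, ← mul_smul, env_mul, mul_one]))
    (fun a b x c => by
      simp only [ATensor.lift_mk, LinearMap.mk₂_apply, env_smul_self, ← mul_smul, env_mul,
        mul_one, one_mul])

theorem rightUnit_mk (x : X) (a : A) : rightUnit X (ATensor.mk k A X A x a) = env k 1 a • x := rfl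

theorem rightUnit_map (f : X →ₗ[Env k A] X') (t : ATensor k A X A) :
    rightUnit X' (ATensor.map f LinearMap.id t) = f (rightUnit X t) := by
  induction t using ATensor.induction with
  | zero => simp
  | mk x y => exact (f.map_smul _ _).symm
  | add x y hx hy => simp only [map_add, hx, hy]

theorem rightUnit_injective : Function.Injective (rightUnit (k := k) (A := A) X) := by
  have h : ∀ t, t = ATensor.mk k A X A (rightUnit X t) 1 := by
    intro t
    induction t using ATensor.induction with
    | zero => simp
    | mk x y => rw [rightUnit_mk, ATensor.mk_smul, env_smul_self, mul_one, mul_one]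
    | add x y hx hy => rw [map_add, map_add, LinearMap.add_apply, ← hx, ← hy]
  intro t t' htt
  rw [h t, h t', htt]

end Maps

/-- The morphism `x ⊗ y ↦ x ε(y)` from `X ⊗_A T₀` to `X`. -/
def counitRight (T : CompleteResolution k A) (X : Type w) [AddCommGroup X] [Module k X]
    [Module (Env k A) X] [IsScalarTower k (Env k A) X] : ATensor k A X (T.X 0) →ₗ[Env k A] X :=
  (rightUnit X).comp (ATensor.map LinearMap.id T.ε)

section Counit

variable {T : CompleteResolution k A} {X X' : Type*} [AddCommGroup X] [Module k X]
  [Module (Env k A) X] [IsScalarTower k (Env k A) X] [AddCommGroup X'] [Module k X']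
  [Module (Env k A) X'] [IsScalarTower k (Env k A) X']

theorem counitRight_mk (x : X) (y : T.X 0) :
    counitRight T X (ATensor.mk k A X (T.X 0) x y) = env k 1 (T.ε y) • x := rfl

theorem counitRight_map (f : X →ₗ[Env k A] X') (t : ATensor k A X (T.X 0)) :
    counitRight T X' (ATensor.map f LinearMap.id t) = f (counitRight T X t) := by
  rw [counitRight, counitRight, LinearMap.comp_apply, LinearMap.comp_apply, ← rightUnit_map,
    ATensor.map_comm]

theorem counitRight_surjective : Function.Surjective (counitRight T X) := by
  intro x
  obtain ⟨y, hy⟩ := T.ε_surjective 1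
  exact ⟨ATensor.mk k A X (T.X 0) x y, by rw [counitRight_mk, hy, env_one, one_smul]⟩

/-- Since `d₀ = η ε`, the map `id ⊗ d₀` factors through `id ⊗ ε`. -/
theorem map_d_eq_zero_of_counitRight {t : ATensor k A X (T.X 0)} (ht : counitRight T X t = 0) :
    ATensor.map LinearMap.id (T.d 0 (-1)) t = 0 := by
  have h₀ : ATensor.map (LinearMap.id : X →ₗ[Env k A] X) T.ε t = 0 :=
    rightUnit_injective (ht.trans (map_zero _).symm)
  have h : ∀ t : ATensor k A X (T.X 0), ATensor.map LinearMap.id (T.d 0 (-1)) t =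
      ATensor.map LinearMap.id T.η (ATensor.map LinearMap.id T.ε t) := by
    intro t
    induction t using ATensor.induction with
    | zero => simp
    | mk x y => simp only [ATensor.map_mk, T.η_ε]; rfl
    | add x y hx hy => simp only [map_add, hx, hy]
  rw [h, h₀, map_zero]

end Counit

variable {T : CompleteResolution k A}

/-- This reduces the normalisation of a diagonal to its component in row `q = 0`. -/
theorem map_ε_ε (t : ATensor k A (T.X 0) (T.X 0)) : ATensor.map T.ε T.ε t =
    ATensor.mk k A A A (T.ε (counitRight T (T.X 0) t)) 1 := by
  induction t using ATensor.induction with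
  | zero => simp
  | mk x y =>
    rw [counitRight_mk, map_smul, ATensor.mk_smul, ATensor.map_mk, env_smul_self, mul_one,
      mul_one]
  | add x y hx hy => rw [map_add, hx, hy, map_add, map_add, map_add, LinearMap.add_apply]

theorem LeftContraction.exists_lift (c : LeftContraction T) {P Q : Type*} [AddCommGroup P]
    [Module (Env k A) P] [Module.Projective (Env k A) P] [AddCommGroup Q] [Module k Q]
    [Module (Env k A) Q] [IsScalarTower k (Env k A) Q] (i j l : ℤ) (hij : i + 1 = j)
    (hjl : j + 1 = l) (g : P →ₗ[Env k A] ATensor k A Q (T.X j))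
    (hg : ∀ x, ATensor.map LinearMap.id (T.d j i) (g x) = 0) :
    ∃ h : P →ₗ[Env k A] ATensor k A Q (T.X l),
      ∀ x, ATensor.map LinearMap.id (T.d l j) (h x) = g x := by
  let δ : ATensor k A Q (T.X l) →ₗ[Env k A] ATensor k A Q (T.X j) :=
    ATensor.map LinearMap.id (T.d l j)
  obtain ⟨h, hh⟩ := Module.projective_lifting_property δ.rangeRestrict
    (g.codRestrict (LinearMap.range δ) (fun x => c.exists_eq_map i j l hij hjl _ (hg x)))
    δ.surjective_rangeRestrict
  exact ⟨h, fun x => congrArg Subtype.val (LinearMap.congr_fun hh x)⟩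

/-- The families of components `T_n → T_p ⊗_A T_q` for fixed `q`. -/
abbrev DiagonalRow (T : CompleteResolution k A) (q : ℤ) : Type _ :=
  ∀ p n : ℤ, p + q = n → T.X n →ₗ[Env k A] ATensor k A (T.X p) (T.X q)

/-- The failure of a row to commute with the horizontal differential. -/
def DiagonalRow.defect {q : ℤ} (D : DiagonalRow T q) (p n : ℤ) (h : p + q = n) :
    T.X (n + 1) →ₗ[Env k A] ATensor k A (T.X p) (T.X q) :=
  (D p n h).comp (T.d (n + 1) n) -
    (ATensor.map (T.d (p + 1) p) LinearMap.id).comp (D (p + 1) (n + 1) (by omega))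

theorem DiagonalRow.defect_apply {q : ℤ} (D : DiagonalRow T q) (p n : ℤ) (h : p + q = n) (x) :
    D.defect p n h x = D p n h (T.d (n + 1) n x) -
      ATensor.map (T.d (p + 1) p) LinearMap.id (D (p + 1) (n + 1) (by omega) x) := rfl

/-- The two squares of differentials vanish and the mixed terms cancel. This identity is the
consistency condition that lets the construction continue from one row to the next. -/
theorem DiagonalRow.defect_add_map {q : ℤ} (D : DiagonalRow T q) (p n : ℤ) (h : p + q = n) (x) :
    D.defect p n h (T.d (n + 1 + 1) (n + 1) x) +
      ATensor.map (T.d (p + 1) p) LinearMap.id (D.defect (p + 1) (n + 1) (by omega) x) = 0 := by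
  have hdd : ∀ t : ATensor k A (T.X (p + 1 + 1)) (T.X q), ATensor.map (T.d (p + 1) p) LinearMap.id
      (ATensor.map (T.d (p + 1 + 1) (p + 1)) LinearMap.id t) = 0 := by
    intro t
    induction t using ATensor.induction with
    | zero => simp
    | mk x y => simp only [ATensor.map_mk, T.d_d, map_zero, LinearMap.zero_apply]
    | add x y hx hy => simp only [map_add, hx, hy, add_zero]
  simp only [defect_apply, T.d_d, map_zero, map_sub, hdd]
  abel

/-- The displayed equation is the chain map condition in the component `(p, q)`. It is solved for
row `q + 1` separately for each `p`, using exactness of `T_p ⊗_A T` and projectivity of the source.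
-/
theorem exists_next_row (c : LeftContraction T) (q : ℤ) (D : DiagonalRow T q)
    (hD : ∀ p n h x, ATensor.map LinearMap.id (T.d q (q - 1)) (D.defect p n h x) = 0) :
    ∃ D' : DiagonalRow T (q + 1), ∀ p n h x,
      ATensor.map LinearMap.id (T.d (q + 1) q) (D' p (n + 1) (by omega) x) =
        p.negOnePow • D.defect p n h x := by
  have key : ∀ p, ∃ E : T.X (p + q + 1) →ₗ[Env k A] ATensor k A (T.X p) (T.X (q + 1)), ∀ x,
      ATensor.map LinearMap.id (T.d (q + 1) q) (E x) = p.negOnePow • D.defect p (p + q) rfl x :=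
    fun p => c.exists_lift (q - 1) q (q + 1) (by omega) rfl
      (p.negOnePow • D.defect p (p + q) rfl) (fun x => by
        rw [LinearMap.smul_apply]
        exact (map_units_smul' (ATensor.map LinearMap.id (T.d q (q - 1))).toAddMonoidHom _ _).trans
          ((congrArg _ (hD _ _ _ _)).trans (smul_zero _)))
  choose E hE using key
  have hn : ∀ p n, p + (q + 1) = n → p + q + 1 = n := fun p n h => by omega
  refine ⟨fun p n h => hn p n h ▸ E p, ?_⟩
  rintro p _ rfl x
  exact hE p x

/-- Here the same equation is solved for row `q`, whose entries for different `p` are coupled. A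
contraction of `T ⊗_A T_q` by bimodule morphisms gives all of them at once. -/
theorem exists_previous_row (c : LeftContraction T) (q : ℤ) (D' : DiagonalRow T (q + 1))
    (hD' : ∀ p n h x, ATensor.map LinearMap.id (T.d (q + 1) q) (D'.defect p n h x) = 0) :
    ∃ D : DiagonalRow T q, ∀ p n h x,
      ATensor.map LinearMap.id (T.d (q + 1) q) (D' p (n + 1) (by omega) x) =
        p.negOnePow • D.defect p n h x := by
  obtain ⟨b⟩ := exists_envDualBasis (k := k) (A := A) (T.X q)
  let H : ∀ i j, i + 1 = j → ATensor k A (T.X i) (T.X q) →ₗ[Env k A] ATensor k A (T.X j) (T.X q) :=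
    fun i j h => b.extend (c.s i j h) (c.smul i j h)
  let g : ∀ p n, p + (q + 1) = n → T.X n →ₗ[Env k A] ATensor k A (T.X p) (T.X q) := fun p n h =>
    p.negOnePow • (ATensor.map LinearMap.id (T.d (q + 1) q)).comp (D' p n h)
  -- The right-hand side `g` must itself anticommute with the horizontal differential; this is the
  -- hypothesis on the defect of row `q + 1`.
  have hg : ∀ p n h x, ATensor.map (T.d (p + 1) p) LinearMap.id (g (p + 1) (n + 1) (by omega) x) =
      - g p n h (T.d (n + 1) n x) := by
    intro p n h x
    have h₁ := hD' p n h x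
    rw [DiagonalRow.defect_apply, map_sub, sub_eq_zero] at h₁
    simp only [g, LinearMap.smul_apply, LinearMap.comp_apply, h₁, Int.negOnePow_succ]
    rw [← ATensor.map_comm, Units.neg_smul, map_neg, neg_inj]
    exact map_units_smul' (ATensor.map (T.d (p + 1) p) LinearMap.id).toAddMonoidHom _ _
  -- With `D = -H g`, the defect is `-H g d + (d ⊗ id) H g = H (d ⊗ id) g + (d ⊗ id) H g = g`.
  let D : DiagonalRow T q := fun p n h => -(H (p - 1) p (by omega)).comp (g (p - 1) n (by omega))
  have hD : ∀ p' p n (hp : p' + 1 = p) (h : p + q = n) x,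
      D p n h x = - H p' p hp (g p' n (by omega) x) := by
    intro p' p n hp h x
    obtain rfl : p' = p - 1 := by omega
    rfl
  refine ⟨D, fun p n h x => ?_⟩
  obtain ⟨r, rfl⟩ : ∃ r, r + 1 = p := ⟨p - 1, by omega⟩
  have hc : H r (r + 1) rfl (ATensor.map (T.d (r + 1) r) LinearMap.id
      (g (r + 1) (n + 1) (by omega) x)) + ATensor.map (T.d (r + 1 + 1) (r + 1)) LinearMap.id
      (H (r + 1) (r + 1 + 1) rfl (g (r + 1) (n + 1) (by omega) x)) =
      g (r + 1) (n + 1) (by omega) x :=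
    (add_comm _ _).trans (c.extend_comm b r (r + 1) (r + 1 + 1) rfl rfl _)
  rw [DiagonalRow.defect_apply, hD r (r + 1) n rfl h,
    hD (r + 1) (r + 1 + 1) (n + 1) rfl (by omega), map_neg,
    sub_neg_eq_add, ← map_neg, ← hg r n (by omega), hc]
  exact (units_smul_smul_self _ _).symm

variable [FiniteDimensional k A]

/-- The chain map condition links only adjacent rows, and products over all `(p, q)` impose no
finiteness. So the rows can be chosen recursively in both directions from row `0`. -/
theorem exists_diagonalApproximation (F : FrobeniusForm k A) (T : CompleteResolution k A) :
    Nonempty (DiagonalApproximation T) := by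
  obtain ⟨c⟩ := exists_leftContraction F T
  have hsec : ∀ n, ∃ σ : T.X n →ₗ[Env k A] ATensor k A (T.X n) (T.X 0),
      ∀ x, counitRight T (T.X n) (σ x) = x := fun n => by
    obtain ⟨σ, hσ⟩ := Module.projective_lifting_property (counitRight T (T.X n)) LinearMap.id
      counitRight_surjective
    exact ⟨σ, LinearMap.congr_fun hσ⟩
  choose σ hσ using hsec
  -- Row `0` consists of sections of `id ⊗ ε`. Its defect is killed by `id ⊗ ε` and hence by `id ⊗
  -- d₀`.
  let D₀ : DiagonalRow T 0 := fun p n h => (show p = n by omega) ▸ σ p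
  have hD₀ : ∀ p n (h : p + 0 = n) x, HEq (counitRight T (T.X p) (D₀ p n h x)) x := by
    intro p n h x
    obtain rfl : p = n := by omega
    exact heq_of_eq (hσ p x)
  have hD₁ : ∀ p n (h : p + 0 = n) x, counitRight T (T.X p) (D₀.defect p n h x) = 0 := by
    intro p n h x
    obtain rfl : p = n := by omega
    rw [DiagonalRow.defect_apply, map_sub, counitRight_map, eq_of_heq (hD₀ p p h _),
      eq_of_heq (hD₀ (p + 1) (p + 1) (by omega) _), sub_self]
  -- The invariant says that `id ⊗ d` kills the defect of the row. Upwards it is inherited through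
  -- `defect_add_map`; downwards the defect is, up to sign, an image under `id ⊗ d`, and `d² = 0`.
  obtain ⟨D, hD, -, hR⟩ := exists_int_seq (α := fun q => DiagonalRow T q)
    (fun q D => ∀ p n h x, ATensor.map LinearMap.id (T.d q (q - 1)) (D.defect p n h x) = 0)
    (fun q D D' => ∀ p n h x,
      ATensor.map LinearMap.id (T.d (q + 1) q) (D' p (n + 1) (by omega) x) =
        p.negOnePow • D.defect p n h x)
    0 D₀ (fun p n h x => map_d_eq_zero_of_counitRight (hD₁ p n h x))
    (fun q D hD => by
      obtain ⟨D', hD'⟩ := exists_next_row c q D hD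
      refine ⟨D', fun p n h x => ?_, hD'⟩
      obtain rfl : n = p + q + 1 := by omega
      have h₁ := hD' (p + 1) (p + q + 1) (by omega) x
      have h₂ := hD' p (p + q) rfl (T.d (p + q + 1 + 1) (p + q + 1) x)
      have h₃ := D.defect_add_map p (p + q) rfl x
      have e : q + 1 - 1 = q := by omega
      rw [e, DiagonalRow.defect_apply, map_sub, h₂, ← ATensor.map_comm, h₁,
        Int.negOnePow_succ, Units.neg_smul, map_neg, sub_neg_eq_add]
      refine Eq.trans (congrArg₂ _ rfl (map_units_smul'
        (ATensor.map (T.d (p + 1) p) LinearMap.id).toAddMonoidHom _ _)) ?_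
      rw [← smul_add]
      exact (congrArg _ h₃).trans (smul_zero _))
    (fun q D' hD' => by
      have e : q + 1 - 1 = q := by omega
      rw [e] at hD'
      obtain ⟨D, hD⟩ := exists_previous_row c q D' hD'
      refine ⟨D, fun p n h x => ?_, hD⟩
      have hdd : ∀ t : ATensor k A (T.X p) (T.X (q + 1)), ATensor.map LinearMap.id (T.d q (q - 1))
          (ATensor.map LinearMap.id (T.d (q + 1) q) t) = 0 := by
        intro t
        induction t using ATensor.induction with
        | zero => simp
        | mk x y => simp only [ATensor.map_mk, T.d_d, map_zero]
        | add x y hx hy => simp only [map_add, hx, hy, add_zero]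
      rw [← units_smul_smul_self p.negOnePow (D.defect p n h x), ← hD p n h x]
      exact (map_units_smul' (ATensor.map LinearMap.id (T.d q (q - 1))).toAddMonoidHom _ _).trans
        ((congrArg _ (hdd _)).trans (smul_zero _)))
  refine ⟨{
    Δ := fun n => LinearMap.pi fun pq => D pq.1.2 pq.1.1 n pq.2
    comm := ?_
    augmentation := fun x => ?_ }⟩
  · rintro _ m rfl x
    funext ⟨⟨p, q⟩, hpq⟩
    change ATensor.map (T.d (p + 1) p) LinearMap.id (D q (p + 1) (m + 1) _ x) +
      p.negOnePow • ATensor.map LinearMap.id (T.d (q + 1) q) (D (q + 1) p (m + 1) _ x) =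
        D q p m hpq (T.d (m + 1) m x)
    rw [hR q p m hpq x, units_smul_smul_self, DiagonalRow.defect_apply, add_sub_cancel]
  · change ATensor.map T.ε T.ε (D 0 0 0 rfl x) = _
    rw [hD]
    rw [map_ε_ε, eq_of_heq (hD₀ 0 0 rfl x)]

end DiagonalExistence

/-! ## The dual of a complete resolution -/

section TwistedDual

variable {k : Type u} {A : Type v} [Field k] [Ring A] [Algebra k A] (ν : A ≃ₐ[k] A)

/-- The antiautomorphism `a ⊗ b ↦ ν(b) ⊗ a` of `Aᵉ`. -/
def twistFlip : Env k A →ₗ[k] Env k A :=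
  (envMap k ν AlgEquiv.refl).toLinearMap ∘ₗ (opLinearEquiv k).symm.toLinearMap ∘ₗ
    (flip k A).toLinearMap

theorem twistFlip_env (a b : A) : twistFlip ν (env k a b) = env k (ν b) a := by
  change envMap k ν AlgEquiv.refl (unop (flip k A (env k a b))) = _
  rw [flip_env, unop_op, envMap_env]
  rfl

theorem twistFlip_mul (c c' : Env k A) :
    twistFlip ν (c * c') = twistFlip ν c' * twistFlip ν c := by
  change envMap k ν AlgEquiv.refl (unop (flip k A (c * c'))) = _
  rw [map_mul, unop_mul, map_mul]
  rfl

/-- The inverse `a ⊗ b ↦ b ⊗ ν⁻¹(a)` of `twistFlip ν`. -/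
def untwistFlip : Env k A →ₗ[k] Env k A :=
  (opLinearEquiv k).symm.toLinearMap ∘ₗ (flip k A).toLinearMap ∘ₗ
    (envMap k ν.symm AlgEquiv.refl).toLinearMap

theorem untwistFlip_env (a b : A) : untwistFlip ν (env k a b) = env k b (ν.symm a) := by
  change unop (flip k A (envMap k ν.symm AlgEquiv.refl (env k a b))) = _
  rw [envMap_env, flip_env, unop_op]
  rfl

theorem untwistFlip_twistFlip (c : Env k A) : untwistFlip ν (twistFlip ν c) = c := by
  induction c using env_induction with
  | zero => simp
  | env a b => rw [twistFlip_env, untwistFlip_env, AlgEquiv.symm_apply_apply]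
  | add x y hx hy => rw [map_add, map_add, hx, hy]

theorem twistFlip_untwistFlip (c : Env k A) : twistFlip ν (untwistFlip ν c) = c := by
  induction c using env_induction with
  | zero => simp
  | env a b => rw [untwistFlip_env, twistFlip_env, AlgEquiv.apply_symm_apply]
  | add x y hx hy => rw [map_add, map_add, hx, hy]

/-- The twisted dual `_{ν⁻¹}(X^∨)_1`. -/
abbrev TwistDual (X : Type w) [AddCommGroup X] [Module (Env k A) X] : Type _ :=
  Twist ν.symm AlgEquiv.refl (EnvDual k A X)

section

variable {X : Type w} [AddCommGroup X] [Module (Env k A) X]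
variable {Y : Type w'} [AddCommGroup Y] [Module (Env k A) Y]

/-- An element of the twisted dual as a morphism of bimodules. -/
def TwistDual.hom : TwistDual ν X ≃ₗ[k] (X →ₗ[Env k A] Env k A) :=
  (toTwist ν.symm AlgEquiv.refl (EnvDual k A X)).symm ≪≫ₗ EnvDual.hom k A X

theorem TwistDual.smul_hom_apply (c : Env k A) (f : TwistDual ν X) (x : X) :
    TwistDual.hom ν (c • f) x = TwistDual.hom ν f x * untwistFlip ν c := rfl

/-- The transpose of a morphism of bimodules. -/
def TwistDual.transpose (d : X →ₗ[Env k A] Y) : TwistDual ν Y →ₗ[Env k A] TwistDual ν X where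
  toFun f := (TwistDual.hom ν).symm ((TwistDual.hom ν f).comp d)
  map_add' _ _ := rfl
  map_smul' _ _ := rfl

theorem TwistDual.transpose_hom_apply (d : X →ₗ[Env k A] Y) (f : TwistDual ν Y) (x : X) :
    TwistDual.hom ν (TwistDual.transpose ν d f) x = TwistDual.hom ν f (d x) := rfl

/-- The functionals of a dual basis of `X` generate the dual, with coordinates `f(eᵢ)`. The
antiautomorphism turns right multiplication by these values into the left action. -/
theorem TwistDual.sum_twistFlip_smul (b : EnvDualBasis k A X) (f : TwistDual ν X) :
    ∑ i, twistFlip ν (TwistDual.hom ν f (b.e i)) • (TwistDual.hom ν).symm (b.φ i) = f := by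
  apply (TwistDual.hom ν).injective
  ext x
  simp only [map_sum, LinearMap.sum_apply, TwistDual.smul_hom_apply, LinearEquiv.apply_symm_apply,
    untwistFlip_twistFlip, ← smul_eq_mul, ← map_smul]
  rw [← map_sum, b.sum_smul]

theorem TwistDual.finite_projective [Module.Finite (Env k A) X] [Module.Projective (Env k A) X] :
    Module.Finite (Env k A) (TwistDual ν X) ∧ Module.Projective (Env k A) (TwistDual ν X) := by
  obtain ⟨b⟩ := exists_envDualBasis (k := k) (A := A) X
  let π : (Fin b.n → Env k A) →ₗ[Env k A] TwistDual ν X :=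
    Fintype.linearCombination (Env k A) (fun i => (TwistDual.hom ν).symm (b.φ i))
  let σ : TwistDual ν X →ₗ[Env k A] (Fin b.n → Env k A) :=
    { toFun := fun f i => twistFlip ν (TwistDual.hom ν f (b.e i))
      map_add' := fun f g => funext fun i => by simp
      map_smul' := fun c f => funext fun i => by
        rw [TwistDual.smul_hom_apply, twistFlip_mul, twistFlip_untwistFlip]
        rfl }
  have h : π ∘ₗ σ = LinearMap.id := LinearMap.ext (TwistDual.sum_twistFlip_smul ν b)
  exact ⟨Module.Finite.of_surjective π fun f => ⟨σ f, LinearMap.congr_fun h f⟩,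
    Module.Projective.of_split σ π h⟩

end

end TwistedDual

/-! ### The map `t`, the trace on `Aᵉ` and the Nakayama automorphism -/

section DualBasis

variable {k : Type u} {A : Type v} [Field k] [Ring A] [Algebra k A] [FiniteDimensional k A]
  (F : FrobeniusForm k A) (ν : A ≃ₐ[k] A)

namespace FrobeniusForm

theorem sum_form_dualBasis_smul (a : A) :
    ∑ i, F.form (F.form.dualBasis F.nondegenerate (Module.finBasis k A) i) a •
      Module.finBasis k A i = a := by
  have h : ∀ i, F.form (F.form.dualBasis F.nondegenerate (Module.finBasis k A) i) a =
      (Module.finBasis k A).repr a i := fun i => by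
    have h := congrArg (F.form (F.form.dualBasis F.nondegenerate (Module.finBasis k A) i))
      ((Module.finBasis k A).sum_repr a)
    simp only [map_sum, map_smul, LinearMap.BilinForm.apply_dualBasis_left, smul_eq_mul, mul_ite,
      mul_one, mul_zero, Finset.sum_ite_eq', Finset.mem_univ, if_true] at h
    exact h.symm
  simp only [h, (Module.finBasis k A).sum_repr]

theorem sum_form_smul_dualBasis (a : A) :
    ∑ i, F.form a (Module.finBasis k A i) •
      F.form.dualBasis F.nondegenerate (Module.finBasis k A) i = a := by
  have h := (F.form.dualBasis F.nondegenerate (Module.finBasis k A)).sum_repr a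
  simpa only [LinearMap.BilinForm.dualBasis_repr_apply] using h

theorem toDual_add (x y y' : A) : F.toDual ν x (y + y') = F.toDual ν x y + F.toDual ν x y' := by
  simp only [toDual, add_mul, env_add_left, Finset.sum_add_distrib]

/-- The point is the Casimir identity `∑ b uᵢ ⊗ vᵢ = ∑ uᵢ ⊗ vᵢ b`, which makes `t(x)` a morphism of
bimodules. -/
theorem toDual_mul (x a y b : A) : F.toDual ν x (a * y * b) = env k a b * F.toDual ν x y := by
  -- Expanding `b uᵢ` in the basis and `vⱼ b` in the dual basis turns both sides into the double sum
  -- with coefficients `⟨vⱼ b, uᵢ⟩`.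
  have h : ∀ z : A, ∑ i, env k (z * (b * Module.finBasis k A i) * ν x)
      (F.form.dualBasis F.nondegenerate (Module.finBasis k A) i) =
      ∑ i, env k (z * Module.finBasis k A i * ν x)
        (F.form.dualBasis F.nondegenerate (Module.finBasis k A) i * b) := by
    intro z
    have h₁ : ∀ i, env k (z * (b * Module.finBasis k A i) * ν x)
        (F.form.dualBasis F.nondegenerate (Module.finBasis k A) i) =
        ∑ j, F.form (F.form.dualBasis F.nondegenerate (Module.finBasis k A) j * b)
          (Module.finBasis k A i) • env k (z * Module.finBasis k A j * ν x)
          (F.form.dualBasis F.nondegenerate (Module.finBasis k A) i) := by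
      intro i
      conv_lhs => rw [← F.sum_form_dualBasis_smul (b * Module.finBasis k A i)]
      simp only [Finset.mul_sum, Finset.sum_mul, mul_smul_comm, smul_mul_assoc, F.assoc,
        ← env_smul_left]
      exact map_sum (AddMonoidHom.mk' (fun y => env k y _)
        (fun y y' => env_add_left k y y' _)) _ _
    have h₂ : ∀ j, env k (z * Module.finBasis k A j * ν x)
        (F.form.dualBasis F.nondegenerate (Module.finBasis k A) j * b) =
        ∑ i, F.form (F.form.dualBasis F.nondegenerate (Module.finBasis k A) j * b)
          (Module.finBasis k A i) • env k (z * Module.finBasis k A j * ν x)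
          (F.form.dualBasis F.nondegenerate (Module.finBasis k A) i) := by
      intro j
      conv_lhs => rw [← F.sum_form_smul_dualBasis
        (F.form.dualBasis F.nondegenerate (Module.finBasis k A) j * b)]
      simp only [← env_smul_right]
      exact map_sum (AddMonoidHom.mk' (fun y => env k _ y)
        (fun y y' => env_add_right k _ y y')) _ _
    rw [Finset.sum_congr rfl fun i _ => h₁ i, Finset.sum_congr rfl fun i _ => h₂ i,
      Finset.sum_comm]
  simp only [toDual, Finset.mul_sum, env_mul]
  simpa only [mul_assoc] using h (a * y)

/-- The map `y ↦ t(x)(y)`, as a morphism of bimodules. -/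
def toDualHom (x : A) : A →ₗ[Env k A] Env k A where
  toFun := F.toDual ν x
  map_add' := F.toDual_add ν x
  map_smul' c y := map_env_smul (AddMonoidHom.mk' (F.toDual ν x) (F.toDual_add ν x))
    (fun a b y => by
      rw [env_smul_self]
      exact F.toDual_mul ν x a y b) c y

variable {F ν}

theorem IsNakayama.form_symm (hν : F.IsNakayama ν) (a b : A) :
    F.form (ν.symm a) b = F.form b a := by
  rw [hν, AlgEquiv.apply_symm_apply]

/-- The sum collapses by expanding `1` in the basis, leaving `⟨y, ν(x)⟩`. Thus `t(x)` is the
morphism `A → Aᵉ` with trace `⟨x, -⟩`, and equations for `t` become equations for the form. -/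
theorem IsNakayama.tr_toDual (hν : F.IsNakayama ν) (x y : A) :
    F.envDuality.tr (F.toDual ν x y) = F.form x y := by
  have h : ∀ z : A, ∑ i, F.form (y * Module.finBasis k A i * z) 1 *
      F.form 1 (F.form.dualBasis F.nondegenerate (Module.finBasis k A) i) = F.form (y * z) 1 := by
    intro z
    have h₁ : F.form (y * (∑ i, F.form (F.form.dualBasis F.nondegenerate (Module.finBasis k A) i) 1 •
        Module.finBasis k A i) * z) 1 = F.form (y * z) 1 := by
      rw [F.sum_form_dualBasis_smul, mul_one]
    rw [← h₁]
    simp only [Finset.mul_sum, Finset.sum_mul, mul_smul_comm, smul_mul_assoc, map_sum, map_smul,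
      LinearMap.sum_apply, LinearMap.smul_apply, smul_eq_mul, F.form_one_left, mul_comm]
  simp only [toDual, map_sum, envDuality_tr_env]
  rw [h, ← F.form_eq, ← hν]

theorem IsNakayama.toDual_eq_iff (hν : F.IsNakayama ν) (x : A) (g : A →ₗ[Env k A] Env k A) :
    (∀ y, F.toDual ν x y = g y) ↔ ∀ y, F.form x y = F.envDuality.tr (g y) := by
  constructor
  · intro h y
    rw [← h, hν.tr_toDual]
  · intro h y
    refine LinearMap.congr_fun (f := F.toDualHom ν x) (sub_eq_zero.1
      (F.envDuality.hom_eq_zero fun y => ?_)) y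
    rw [LinearMap.sub_apply, map_sub, ← h, sub_eq_zero]
    exact hν.tr_toDual x y

/-- The trace on `Aᵉ` has its own Nakayama twist. This is what makes the twist by `ν⁻¹` on the dual
complex the right one for `ε'` to be a morphism of bimodules. -/
theorem IsNakayama.tr_mul_untwistFlip (hν : F.IsNakayama ν) (c : Env k A) (a b : A) :
    F.envDuality.tr (c * untwistFlip ν (env k a b)) =
      F.envDuality.tr (env k (ν.symm b) a * c) := by
  rw [untwistFlip_env]
  induction c using env_induction with
  | zero => simp
  | add x y hx hy => simp only [add_mul, mul_add, map_add, hx, hy]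
  | env p q =>
    rw [env_mul, env_mul, envDuality_tr_env, envDuality_tr_env, ← F.form_eq, ← F.form_eq,
      hν.form_symm, F.form_one_left, F.form_one_left, ← F.form_eq, ← F.form_eq, hν.form_symm]

/-- For central `c`, `⟨b, ν(c)⟩ = ⟨c, b⟩ = ⟨cb, 1⟩ = ⟨bc, 1⟩ = ⟨b, c⟩`. -/
theorem IsNakayama.apply_of_central (hν : F.IsNakayama ν) {c : A} (hc : ∀ a, a * c = c * a) :
    ν c = c := by
  apply F.duality.equiv.injective
  ext b
  rw [duality_apply, duality_apply, ← hν, F.form_eq, ← hc, F.form_eq b]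

end FrobeniusForm

end DualBasis

/-! ### The dual `T'` as a complete resolution -/

section DualResolution

variable {k : Type u} {A : Type v} [Field k] [Ring A] [Algebra k A] [FiniteDimensional k A]
  {F : FrobeniusForm k A} {ν : A ≃ₐ[k] A} (hν : F.IsNakayama ν) (T : CompleteResolution k A)

/-- The augmentation `ε'` of the dual resolution, determined by `⟨y, ε'(f)⟩ = - tr f(η(y))`. -/
def dualAugmentation (hν : F.IsNakayama ν) (T : CompleteResolution k A) :
    TwistDual ν (T.X (-1)) →ₗ[Env k A] A :=
  let e : TwistDual ν (T.X (-1)) → A := fun f => F.duality.equiv.symm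
    (-(F.envDuality.tr ∘ₗ ((TwistDual.hom ν f).comp T.η).restrictScalars k))
  have he : ∀ f y, F.form y (e f) = - F.envDuality.tr (TwistDual.hom ν f (T.η y)) := fun f y => by
    rw [← F.duality_apply, LinearEquiv.apply_symm_apply]
    rfl
  have hext : ∀ {a b : A}, (∀ y, F.form y a = F.form y b) → a = b := fun h =>
    F.duality.equiv.injective (LinearMap.ext h)
  have hadd : ∀ f g, e (f + g) = e f + e g := fun f g => hext fun y => by
    rw [map_add, he, he, he, map_add, LinearMap.add_apply, map_add, neg_add]
  { toFun := e
    map_add' := hadd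
    map_smul' := fun c f => map_env_smul (AddMonoidHom.mk' e hadd) (fun a b f => hext fun y => by
      rw [env_smul_self]
      change F.form y (e (env k a b • f)) = F.form y (a * e f * b)
      rw [he, TwistDual.smul_hom_apply, hν.tr_mul_untwistFlip, ← smul_eq_mul, ← map_smul,
        ← map_smul, env_smul_self, ← he, ← F.assoc y, ← hν.form_symm b, ← mul_assoc y, ← F.assoc,
        mul_assoc]) c f }

theorem form_dualAugmentation (f : TwistDual ν (T.X (-1))) (y : A) :
    F.form y (dualAugmentation hν T f) =
      - F.envDuality.tr (TwistDual.hom ν f (T.η y)) := by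
  have h := LinearMap.congr_fun (F.duality.equiv.apply_symm_apply
    (-(F.envDuality.tr ∘ₗ ((TwistDual.hom ν f).comp T.η).restrictScalars k))) y
  exact h

/-- This reconciles the description of `ε'` by traces with the equation `t(ν⁻¹(ε'(f))) = -f ∘ η`
that defines it. -/
theorem dualAugmentation_eq_iff (f : TwistDual ν (T.X (-1))) (a : A) :
    dualAugmentation hν T f = a ↔
      ∀ y, F.toDual ν (ν.symm a) y = - TwistDual.hom ν f (T.η y) := by
  have h := hν.toDual_eq_iff (ν.symm a) (-((TwistDual.hom ν f).comp T.η))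
  simp only [LinearMap.neg_apply, LinearMap.comp_apply, map_neg, hν.form_symm,
    ← form_dualAugmentation hν] at h
  rw [h]
  exact ⟨fun h y => by rw [h], fun h => F.duality.equiv.injective
    (LinearMap.ext fun y => (h y).symm)⟩

/-- Every morphism `A → Aᵉ` extends along the monomorphism `η`, because `Aᵉ` is injective. -/
theorem dualAugmentation_surjective : Function.Surjective (dualAugmentation hν T) := by
  intro a
  obtain ⟨f, hf⟩ := F.envDuality.exists_factor T.η (-F.toDualHom ν (ν.symm a)) (fun y hy => by
    rw [(map_eq_zero_iff T.η T.η_injective).1 hy, map_zero])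
  refine ⟨(TwistDual.hom ν).symm f, (dualAugmentation_eq_iff hν T _ a).2 fun y => ?_⟩
  rw [LinearEquiv.apply_symm_apply, show f (T.η y) = _ from LinearMap.congr_fun hf y,
    LinearMap.neg_apply, neg_neg]
  rfl

/-- `ε'(f)` vanishes when `f η` does, which is the same as `f η ε = f d₀ = 0` since `ε` is
surjective. -/
theorem dualAugmentation_eq_zero_iff (f : TwistDual ν (T.X (-1))) :
    dualAugmentation hν T f = 0 ↔ TwistDual.transpose ν (T.d 0 (-1)) f = 0 := by
  rw [dualAugmentation_eq_iff, map_zero]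
  have h₀ : ∀ y, F.toDual ν 0 y = 0 := fun y => by
    simp only [FrobeniusForm.toDual, map_zero, mul_zero]
    exact Finset.sum_eq_zero fun i _ => TensorProduct.zero_tmul _ _
  constructor
  · intro h
    apply (TwistDual.hom ν).injective
    ext x
    rw [TwistDual.transpose_hom_apply, ← T.η_ε, map_zero, LinearMap.zero_apply, ← neg_eq_zero,
      ← h, h₀]
  · intro h y
    obtain ⟨x, rfl⟩ := T.ε_surjective y
    rw [h₀, T.η_ε, ← TwistDual.transpose_hom_apply, h, map_zero, LinearMap.zero_apply, neg_zero]

theorem TwistDual.exact_transpose (i j l : ℤ) (hj : j + 1 = i) (hl : l + 1 = j) :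
    Function.Exact (TwistDual.transpose ν (T.d j l)) (TwistDual.transpose ν (T.d i j)) :=
  T.dual_exact i j l hj hl

variable (ν) in
/-- The differential of the dual resolution. -/
def dualD (i j : ℤ) : TwistDual ν (T.X (-1 - i)) →ₗ[Env k A] TwistDual ν (T.X (-1 - j)) :=
  (-1 - i).negOnePow • TwistDual.transpose ν (T.d (-1 - j) (-1 - i))

theorem dualD_apply (i j : ℤ) (f : TwistDual ν (T.X (-1 - i))) :
    dualD ν T i j f =
      (-1 - i).negOnePow • TwistDual.transpose ν (T.d (-1 - j) (-1 - i)) f := rfl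

theorem dualD_dualD (i j l : ℤ) (f : TwistDual ν (T.X (-1 - i))) :
    dualD ν T j l (dualD ν T i j f) = 0 := by
  rw [dualD_apply, dualD_apply]
  refine (congrArg _ (map_units_smul'
    (TwistDual.transpose ν (T.d (-1 - l) (-1 - j))).toAddMonoidHom _ _)).trans ?_
  have h : TwistDual.transpose ν (T.d (-1 - l) (-1 - j))
      (TwistDual.transpose ν (T.d (-1 - j) (-1 - i)) f) = 0 := by
    apply (TwistDual.hom ν).injective
    ext x
    rw [TwistDual.transpose_hom_apply, TwistDual.transpose_hom_apply, T.d_d, map_zero, map_zero,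
      LinearMap.zero_apply]
  exact (congrArg (fun y => _ • _ • y) h).trans (by simp)

theorem units_smul_eq_zero_iff {M : Type*} [AddCommGroup M] (e : ℤˣ) (x : M) :
    e • x = 0 ↔ x = 0 := by
  rcases Int.units_eq_one_or e with rfl | rfl <;> simp

theorem exact_dualD (i j l : ℤ) (hj : j + 1 = i) (hl : l + 1 = j) :
    Function.Exact (dualD ν T i j) (dualD ν T j l) := by
  intro f
  constructor
  · intro hf
    rw [dualD_apply, units_smul_eq_zero_iff] at hf
    obtain ⟨g, hg⟩ := (TwistDual.exact_transpose T (-1 - l) (-1 - j) (-1 - i) (by omega)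
      (by omega) f).1 hf
    refine ⟨(-1 - i).negOnePow • g, ?_⟩
    rw [dualD_apply]
    refine (congrArg _ (map_units_smul'
      (TwistDual.transpose ν (T.d (-1 - j) (-1 - i))).toAddMonoidHom _ _)).trans ?_
    exact (units_smul_smul_self _ _).trans hg
  · rintro ⟨g, rfl⟩
    exact dualD_dualD T i j l g

/-- The complex `T'` with `T'_j = _{ν⁻¹}((T_i)^∨)_1` for `i + j = -1`. -/
def dualComplex (ν : A ≃ₐ[k] A) (T : CompleteResolution k A) :
    ChainComplex (ModuleCat.{v} (Env k A)) ℤ where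
  X j := ModuleCat.of (Env k A) (TwistDual ν (T.X (-1 - j)))
  d i j := ModuleCat.ofHom (dualD ν T i j)
  shape i j hij := by
    have h : T.complex.d (-1 - j) (-1 - i) = 0 := T.complex.shape _ _ (fun h => hij (by
      simp only [ComplexShape.down_Rel] at h ⊢
      omega))
    refine ModuleCat.hom_ext (LinearMap.ext fun f => ?_)
    refine (units_smul_eq_zero_iff _ _).2 ((TwistDual.hom ν).injective (LinearMap.ext fun x => ?_))
    rw [TwistDual.transpose_hom_apply, CompleteResolution.d, h]
    simp
  d_comp_d' i j l _ _ := ModuleCat.hom_ext (LinearMap.ext fun f => dualD_dualD T i j l f)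

/-- The dual `T'` of a complete resolution `T`, with the augmentation `ε'`. -/
def dualResolution : CompleteResolution k A where
  complex := dualComplex ν T
  finite j := (TwistDual.finite_projective ν (X := T.X (-1 - j))).1
  projective j := (TwistDual.finite_projective ν (X := T.X (-1 - j))).2
  exact := exact_dualD T
  dual_exact i j l hj hl := EnvDual.exact_comp F (X := (dualComplex ν T).X i)
    (Y := (dualComplex ν T).X j) (Z := (dualComplex ν T).X l) (exact_dualD T i j l hj hl)
  ε := dualAugmentation hν T
  ε_surjective := dualAugmentation_surjective hν T
  ε_exact f := by
    have hd : ∀ g, dualD ν T 1 0 g = TwistDual.transpose ν (T.d (-1 - 0) (-1 - 1)) g := fun g => by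
      rw [dualD_apply, show (-1 - 1 : ℤ).negOnePow = 1 from rfl, one_smul]
    refine (dualAugmentation_eq_zero_iff hν T f).trans
      ((TwistDual.exact_transpose T 0 (-1 - 0) (-1 - 1) (by norm_num) (by norm_num) f).trans ?_)
    exact ⟨fun ⟨g, hg⟩ => ⟨g, (hd g).trans hg⟩, fun ⟨g, hg⟩ => ⟨g, (hd g).symm.trans hg⟩⟩

end DualResolution

/-! ## Functoriality of Tate-Hochschild homology in the complete resolution -/

section EnvTensorMap

variable {k : Type u} {A : Type v} [Field k] [Ring A] [Algebra k A]
variable {X : Type*} [AddCommGroup X] [Module k X] [Module (Env k A) X]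
  [IsScalarTower k (Env k A) X]
variable {Y : Type*} [AddCommGroup Y] [Module k Y] [Module (Env k A) Y]
  [IsScalarTower k (Env k A) Y]
variable {Z : Type*} [AddCommGroup Z] [Module k Z] [Module (Env k A) Z]
  [IsScalarTower k (Env k A) Z]
variable {N : Type*} [AddCommGroup N] [Module k N] [Module (Env k A) N]
  [IsScalarTower k (Env k A) N]
variable {N' : Type*} [AddCommGroup N'] [Module k N'] [Module (Env k A) N']
  [IsScalarTower k (Env k A) N']
variable {N'' : Type*} [AddCommGroup N''] [Module k N''] [Module (Env k A) N'']
  [IsScalarTower k (Env k A) N'']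

theorem EnvTensor.induction {motive : EnvTensor k A X N → Prop} (t : EnvTensor k A X N)
    (zero : motive 0) (mk : ∀ x n, motive (EnvTensor.mk k A X N x n))
    (add : ∀ x y, motive x → motive y → motive (x + y)) : motive t := by
  obtain ⟨t, rfl⟩ := (envRel k A X N).mkQ_surjective t
  exact TensorProduct.induction_on (motive := fun t => motive ((envRel k A X N).mkQ t)) t zero mk
    (fun x y hx hy => add _ _ hx hy)

theorem EnvTensor.map_map (f : X →ₗ[Env k A] Y) (f' : Y →ₗ[Env k A] Z) (g : N →ₗ[Env k A] N')
    (g' : N' →ₗ[Env k A] N'') (t : EnvTensor k A X N) :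
    EnvTensor.map f' g' (EnvTensor.map f g t) = EnvTensor.map (f'.comp f) (g'.comp g) t := by
  induction t using EnvTensor.induction with
  | zero => simp
  | mk x n => rfl
  | add x y hx hy => simp only [map_add, hx, hy]

theorem EnvTensor.map_id (t : EnvTensor k A X N) :
    EnvTensor.map LinearMap.id LinearMap.id t = t := by
  induction t using EnvTensor.induction with
  | zero => simp
  | mk x n => rfl
  | add x y hx hy => simp only [map_add, hx, hy]

theorem EnvTensor.map_add_left (f f' : X →ₗ[Env k A] Y) (g : N →ₗ[Env k A] N')
    (t : EnvTensor k A X N) :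
    EnvTensor.map (f + f') g t = EnvTensor.map f g t + EnvTensor.map f' g t := by
  induction t using EnvTensor.induction with
  | zero => simp
  | mk x n => simp
  | add x y hx hy =>
    simp only [map_add, hx, hy]
    abel

theorem EnvTensor.map_sub_left (f f' : X →ₗ[Env k A] Y) (g : N →ₗ[Env k A] N')
    (t : EnvTensor k A X N) :
    EnvTensor.map (f - f') g t = EnvTensor.map f g t - EnvTensor.map f' g t := by
  rw [eq_sub_iff_add_eq, ← EnvTensor.map_add_left, sub_add_cancel]

theorem EnvTensor.map_units_smul_left (e : ℤˣ) (f : X →ₗ[Env k A] Y) (g : N →ₗ[Env k A] N')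
    (t : EnvTensor k A X N) :
    EnvTensor.map (e • f) g t = e • EnvTensor.map f g t := by
  rcases Int.units_eq_one_or e with rfl | rfl
  · simp
  · have h := EnvTensor.map_sub_left 0 f g t
    have h₀ := EnvTensor.map_sub_left 0 0 g t (Y := Y)
    rw [sub_zero, sub_self] at h₀
    rw [h₀, zero_sub, zero_sub] at h
    simpa using h

end EnvTensorMap

section HomologyMaps

variable {k : Type u} {A : Type v} [Field k] [Ring A] [Algebra k A]
  {S T U : CompleteResolution k A}
variable {N : Type w} [AddCommGroup N] [Module k N] [Module (Env k A) N]
  [IsScalarTower k (Env k A) N]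

namespace CompleteResolution

/-- The map of chains induced by a chain map. -/
def ChainMap.tensor (f : ChainMap S T) (N : Type w) [AddCommGroup N] [Module k N]
    [Module (Env k A) N] [IsScalarTower k (Env k A) N] (n : ℤ) :
    EnvTensor k A (S.X n) N →ₗ[k] EnvTensor k A (T.X n) N :=
  EnvTensor.map (f.f n) LinearMap.id

theorem ChainMap.tensor_tensorD (f : ChainMap S T) (i j : ℤ) (hj : j + 1 = i)
    (z : EnvTensor k A (S.X i) N) :
    f.tensor N j (tensorD S N i j z) = tensorD T N i j (f.tensor N i z) := by
  rw [tensor, tensor, tensorD, tensorD, EnvTensor.map_map, EnvTensor.map_map]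
  congr 2
  exact LinearMap.ext fun x => (f.comm i j hj x).symm

/-- The composition of chain maps. -/
def ChainMap.comp (g : ChainMap T U) (f : ChainMap S T) : ChainMap S U where
  f n := (g.f n).comp (f.f n)
  comm i j hj x := by simp only [LinearMap.comp_apply, g.comm i j hj, f.comm i j hj]

/-- The difference of chain maps. -/
def ChainMap.sub (f g : ChainMap S T) : ChainMap S T where
  f n := f.f n - g.f n
  comm i j hj x := by simp only [LinearMap.sub_apply, map_sub, g.comm i j hj, f.comm i j hj]

variable (S) in
/-- The identity chain map. -/
def ChainMap.id : ChainMap S S where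
  f n := (LinearMap.id : S.X n →ₗ[Env k A] S.X n)
  comm i j hj x := by rw [LinearMap.id_apply, LinearMap.id_apply]

theorem ChainMap.tensor_comp (g : ChainMap T U) (f : ChainMap S T) (n : ℤ)
    (z : EnvTensor k A (S.X n) N) :
    (g.comp f).tensor N n z = g.tensor N n (f.tensor N n z) := by
  rw [tensor, tensor, tensor, EnvTensor.map_map, LinearMap.comp_id, comp]

theorem ChainMap.tensor_sub (f g : ChainMap S T) (n : ℤ) (z : EnvTensor k A (S.X n) N) :
    (f.sub g).tensor N n z = f.tensor N n z - g.tensor N n z :=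
  EnvTensor.map_sub_left _ _ _ _

theorem ChainMap.tensor_id (n : ℤ) (z : EnvTensor k A (S.X n) N) :
    (ChainMap.id S).tensor N n z = z := EnvTensor.map_id z

theorem ChainMap.tensor_mem (f : ChainMap S T) (n : ℤ) {z : EnvTensor k A (S.X n) N}
    (hz : z ∈ tateCycles S N n) : f.tensor N n z ∈ tateCycles T N n := by
  change tensorD T N n (n - 1) _ = 0
  rw [← f.tensor_tensorD n (n - 1) (by omega), show tensorD S N n (n - 1) z = 0 from hz, map_zero]

theorem ChainMap.tensor_boundary (f : ChainMap S T) (n : ℤ) {z : EnvTensor k A (S.X n) N}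
    (hz : z ∈ LinearMap.range (tensorD S N (n + 1) n)) :
    f.tensor N n z ∈ LinearMap.range (tensorD T N (n + 1) n) := by
  obtain ⟨y, rfl⟩ := hz
  exact ⟨f.tensor N (n + 1) y, (f.tensor_tensorD _ _ rfl y).symm⟩

theorem NullHomotopy.tensor_mem {f : ChainMap S T} (H : NullHomotopy f) (n : ℤ)
    {z : EnvTensor k A (S.X n) N} (hz : z ∈ tateCycles S N n) :
    f.tensor N n z ∈ LinearMap.range (tensorD T N (n + 1) n) := by
  obtain ⟨m, rfl⟩ : ∃ m, n = m + 1 := ⟨n - 1, by omega⟩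
  have hf : f.f (m + 1) = (T.d (m + 1 + 1) (m + 1)).comp (H.h (m + 1) (m + 1 + 1) rfl) +
      (H.h m (m + 1) rfl).comp (S.d (m + 1) m) :=
    LinearMap.ext fun x => H.comm m (m + 1) (m + 1 + 1) rfl rfl x
  refine ⟨EnvTensor.map (H.h (m + 1) (m + 1 + 1) rfl) LinearMap.id z, ?_⟩
  have hz' : EnvTensor.map (S.d (m + 1) m) LinearMap.id z = 0 := (mem_tateCycles rfl).1 hz
  have h₁ := EnvTensor.map_map (S.d (m + 1) m) (H.h m (m + 1) rfl) LinearMap.id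
    (LinearMap.id : N →ₗ[Env k A] N) z
  rw [hz', map_zero] at h₁
  rw [ChainMap.tensor, hf, EnvTensor.map_add_left, tensorD, EnvTensor.map_map]
  exact left_eq_add.2 h₁.symm

variable [FiniteDimensional k A]

/-- Augmentations need to agree only modulo morphisms through `d₀`. This weaker hypothesis is what
allows a central factor `c` different from `1` to be absorbed later. -/
theorem ChainMap.sub_mem_of_ε (F : FrobeniusForm k A) (f g : ChainMap S T)
    (w : S.X (-1) →ₗ[Env k A] A) (hw : ∀ x, T.ε (f.f 0 x) - T.ε (g.f 0 x) = w (S.d 0 (-1) x))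
    (n : ℤ) {z : EnvTensor k A (S.X n) N} (hz : z ∈ tateCycles S N n) :
    f.tensor N n z - g.tensor N n z ∈ LinearMap.range (tensorD T N (n + 1) n) := by
  obtain ⟨H⟩ := exists_nullHomotopy F (f.sub g) w (fun x => (map_sub T.ε _ _).trans (hw x))
  rw [← ChainMap.tensor_sub]
  exact H.tensor_mem n hz

theorem ChainMap.sub_mem (F : FrobeniusForm k A) (f g : ChainMap S T)
    (h : ∀ x, T.ε (f.f 0 x) = T.ε (g.f 0 x))
    (n : ℤ) {z : EnvTensor k A (S.X n) N} (hz : z ∈ tateCycles S N n) :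
    f.tensor N n z - g.tensor N n z ∈ LinearMap.range (tensorD T N (n + 1) n) :=
  f.sub_mem_of_ε F g 0 (fun x => by rw [h, sub_self, LinearMap.zero_apply]) n hz

end CompleteResolution

end HomologyMaps

/-! ## The duality between cochains and chains -/

section EvalDual

variable {k : Type u} {A : Type v} [Field k] [Ring A] [Algebra k A] (ν : A ≃ₐ[k] A)
variable {X : Type w} [AddCommGroup X] [Module k X] [Module (Env k A) X]
  [IsScalarTower k (Env k A) X]
variable {M : Type w'} [AddCommGroup M] [Module k M] [Module (Env k A) M]
  [IsScalarTower k (Env k A) M]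

theorem evalDual_mk_apply (f : TwistDual ν X) (m : M) (x : X) :
    evalDual ν.symm X M (EnvTensor.mk k A _ _ f (toTwist AlgEquiv.refl ν.symm M m)) x =
      TwistDual.hom ν f x • m := rfl

theorem mk_toTwist_smul {Y : Type*} [AddCommGroup Y] [Module k Y] [Module (Env k A) Y]
    [IsScalarTower k (Env k A) Y] (y : Y) (c : Env k A) (m : M) :
    EnvTensor.mk k A _ _ y (toTwist AlgEquiv.refl ν.symm M (c • m)) =
      EnvTensor.mk k A _ _ (twistFlip ν c • y) (toTwist AlgEquiv.refl ν.symm M m) := by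
  induction c using env_induction with
  | zero => simp
  | add c c' h h' => simp only [add_smul, map_add, LinearMap.add_apply, h, h']
  | env a b =>
    rw [twistFlip_env, EnvTensor.mk_smul, smul_toTwist, envMap_env, AlgEquiv.symm_apply_apply]
    rfl

/-- A dual basis provides the inverse `u ↦ ∑ φᵢ ⊗ u(eᵢ)`. -/
theorem evalDual_bijective [Module.Finite (Env k A) X] [Module.Projective (Env k A) X] :
    Function.Bijective (evalDual ν.symm X M) := by
  obtain ⟨b⟩ := exists_envDualBasis (k := k) (A := A) X
  let g : (X →ₗ[Env k A] M) →
      EnvTensor k A (TwistDual ν X) (Twist AlgEquiv.refl ν.symm M) := fun u =>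
    ∑ i, EnvTensor.mk k A _ _ ((TwistDual.hom ν).symm (b.φ i))
      (toTwist AlgEquiv.refl ν.symm M (u (b.e i)))
  have hg : ∀ t, g (evalDual ν.symm X M t) = t := by
    intro t
    induction t using EnvTensor.induction with
    | zero => simp [g]
    | add x y hx hy =>
      nth_rw 2 [← hx, ← hy]
      simp only [g, map_add, LinearMap.add_apply, Finset.sum_add_distrib]
    | mk f m =>
      obtain ⟨m, rfl⟩ := (toTwist AlgEquiv.refl ν.symm M).surjective m
      simp only [g, evalDual_mk_apply, mk_toTwist_smul]
      rw [← LinearMap.sum_apply, ← map_sum, TwistDual.sum_twistFlip_smul]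
  refine ⟨fun t t' h => by rw [← hg t, h, hg], fun u => ⟨g u, LinearMap.ext fun x => ?_⟩⟩
  simp only [g, map_sum, LinearMap.sum_apply, evalDual_mk_apply, LinearEquiv.apply_symm_apply,
    ← map_smul]
  rw [← map_sum, b.sum_smul]

theorem evalDual_transpose {Y : Type*} [AddCommGroup Y] [Module k Y] [Module (Env k A) Y]
    [IsScalarTower k (Env k A) Y] (d : X →ₗ[Env k A] Y)
    (t : EnvTensor k A (TwistDual ν Y) (Twist AlgEquiv.refl ν.symm M)) :
    evalDual ν.symm X M (EnvTensor.map (TwistDual.transpose ν d) LinearMap.id t) =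
      (evalDual ν.symm Y M t).comp d := by
  induction t using EnvTensor.induction with
  | zero => simp
  | add x y hx hy => simp only [map_add, hx, hy, LinearMap.add_comp]
  | mk f m => rfl

end EvalDual

/-! ### Cochains of `T` as chains of `T'` -/

section DualChain

variable {k : Type u} {A : Type v} [Field k] [Ring A] [Algebra k A] [FiniteDimensional k A]
  {F : FrobeniusForm k A} {ν : A ≃ₐ[k] A} (hν : F.IsNakayama ν) (T : CompleteResolution k A)

/-- The identification of `_{ν⁻¹}((T_n)^∨)_1` with the term of degree `m` of the dual resolution,
for `n + m = -1`. -/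
def dualTerm (n m : ℤ) (h : n + m = -1) :
    TwistDual ν (T.X n) ≃ₗ[Env k A] (dualResolution hν T).X m :=
  (show -1 - m = n by omega) ▸ (LinearEquiv.refl (Env k A) (TwistDual ν (T.X (-1 - m))) :
    TwistDual ν (T.X (-1 - m)) ≃ₗ[Env k A] (dualResolution hν T).X m)

theorem dualTerm_d (n m n' m' : ℤ) (h : n + m = -1) (h' : n' + m' = -1)
    (f : TwistDual ν (T.X n)) :
    (dualResolution hν T).d m m' (dualTerm hν T n m h f) =
      n.negOnePow • dualTerm hν T n' m' h' (TwistDual.transpose ν (T.d n' n) f) := by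
  obtain rfl : n = -1 - m := by omega
  obtain rfl : n' = -1 - m' := by omega
  rfl

theorem dualTerm_ε (f : TwistDual ν (T.X (-1))) :
    (dualResolution hν T).ε (dualTerm hν T (-1) 0 rfl f) = dualAugmentation hν T f := rfl

open CompleteResolution in
/-- Dual comparisons are the augmentation-preserving chain maps from the dual resolution. -/
theorem DualComparison.exists_chainMap (θ : DualComparison F ν T) :
    ∃ f : ChainMap (dualResolution hν T) T,
      (∀ x, T.ε (f.f 0 x) = (dualResolution hν T).ε x) ∧
        ∀ n m h x, f.f m (dualTerm hν T n m h x) = θ.θ n m h x := by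
  let g : ∀ m, (dualResolution hν T).X m →ₗ[Env k A] T.X m := fun m =>
    (θ.θ (-1 - m) m (by omega)).comp (dualTerm hν T (-1 - m) m (by omega)).symm.toLinearMap
  have hg : ∀ n m h x, g m (dualTerm hν T n m h x) = θ.θ n m h x := by
    intro n m h x
    obtain rfl : n = -1 - m := by omega
    exact congrArg _ ((dualTerm hν T (-1 - m) m h).symm_apply_apply x)
  refine ⟨⟨g, fun i j hj x => ?_⟩, fun x => ?_, hg⟩
  · obtain ⟨x, rfl⟩ := (dualTerm hν T (-1 - i) i (by omega)).surjective x
    rw [hg, dualTerm_d hν T (-1 - i) i (-1 - j) j (by omega) (by omega)]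
    refine (θ.comm (-1 - i) i (-1 - j) j (by omega) (by omega) hj x).trans ?_
    refine Eq.trans ?_ (map_units_smul' (g j).toAddMonoidHom _ _).symm
    exact congrArg _ (hg (-1 - j) j (by omega) _).symm
  · obtain ⟨x, rfl⟩ := (dualTerm hν T (-1) 0 rfl).surjective x
    refine (congrArg T.ε (hg (-1) 0 rfl x)).trans ?_
    rw [dualTerm_ε]
    exact ((dualAugmentation_eq_iff hν T x _).2 (θ.augmentation x)).symm

/-- `T'` is a complete resolution, so the comparison theorem applies to it. -/
theorem exists_dualComparison (hν : F.IsNakayama ν) (T : CompleteResolution k A) :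
    Nonempty (DualComparison F ν T) := by
  obtain ⟨f, hf⟩ := CompleteResolution.exists_chainMap F (dualResolution hν T) T
  refine ⟨⟨fun n m h => (f.f m).comp (dualTerm hν T n m h).toLinearMap, ?_, fun x => ?_⟩⟩
  · intro n m n' m' h h' hm x
    refine (f.comm m m' hm _).trans ?_
    refine (congrArg _ (dualTerm_d hν T n m n' m' h h' _)).trans ?_
    exact map_units_smul' (f.f m').toAddMonoidHom _ _
  · exact (dualAugmentation_eq_iff hν T _ _).1 (hf (dualTerm hν T (-1) 0 rfl x)).symm

variable (M : Type w) [AddCommGroup M] [Module k M] [Module (Env k A) M]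
  [IsScalarTower k (Env k A) M]

/-- The isomorphism `Hom_{Aᵉ}(T_n, M) ≅ T'_m ⊗_{Aᵉ} _1 M_{ν⁻¹}` for `n + m = -1`. -/
def dualChain (n m : ℤ) (h : n + m = -1) :
    (T.X n →ₗ[Env k A] M) ≃ₗ[k]
      EnvTensor k A ((dualResolution hν T).X m) (Twist AlgEquiv.refl ν.symm M) :=
  (LinearEquiv.ofBijective (evalDual ν.symm (T.X n) M) (evalDual_bijective ν)).symm ≪≫ₗ
    LinearEquiv.ofLinearMap
      (EnvTensor.map (dualTerm hν T n m h).toLinearMap LinearMap.id)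
      (EnvTensor.map (dualTerm hν T n m h).symm.toLinearMap LinearMap.id)
      (LinearMap.ext fun t => by
        rw [LinearMap.comp_apply, EnvTensor.map_map, LinearEquiv.comp_coe,
          LinearEquiv.symm_trans_self]
        exact EnvTensor.map_id t)
      (LinearMap.ext fun t => by
        rw [LinearMap.comp_apply, EnvTensor.map_map, LinearEquiv.comp_coe,
          LinearEquiv.self_trans_symm]
        exact EnvTensor.map_id t)

variable {M}

theorem dualChain_evalDual (n m : ℤ) (h : n + m = -1)
    (y : EnvTensor k A (TwistDual ν (T.X n)) (Twist AlgEquiv.refl ν.symm M)) :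
    dualChain hν T M n m h (evalDual ν.symm (T.X n) M y) =
      EnvTensor.map (dualTerm hν T n m h).toLinearMap LinearMap.id y := by
  have h₁ : (LinearEquiv.ofBijective (evalDual ν.symm (T.X n) M) (evalDual_bijective ν)).symm
      (evalDual ν.symm (T.X n) M y) = y := LinearEquiv.ofBijective_symm_apply_apply _ _
  exact congrArg (EnvTensor.map (dualTerm hν T n m h).toLinearMap LinearMap.id) h₁

/-- Up to signs this is an isomorphism of complexes; hence cocycles match cycles and coboundaries
match boundaries. -/
theorem tensorD_dualChain (n m n' m' : ℤ) (h : n + m = -1) (h' : n' + m' = -1)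
    (u : T.X n →ₗ[Env k A] M) :
    tensorD (dualResolution hν T) (Twist AlgEquiv.refl ν.symm M) m m' (dualChain hν T M n m h u) =
      n.negOnePow • dualChain hν T M n' m' h' (homD T M n' n u) := by
  obtain ⟨y, rfl⟩ := (evalDual_bijective (X := T.X n) (M := M) ν).2 u
  have h₁ : homD T M n' n (evalDual ν.symm (T.X n) M y) = evalDual ν.symm (T.X n') M
      (EnvTensor.map (TwistDual.transpose ν (T.d n' n)) LinearMap.id y) :=
    (evalDual_transpose ν (T.d n' n) y).symm
  rw [h₁, dualChain_evalDual, dualChain_evalDual, tensorD, EnvTensor.map_map, EnvTensor.map_map,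
    ← EnvTensor.map_units_smul_left]
  congr 2
  exact LinearMap.ext fun f => dualTerm_d hν T n m n' m' h h' f

theorem dualChain_mem_cycles_iff (n m : ℤ) (h : n + m = -1) (u : T.X n →ₗ[Env k A] M) :
    dualChain hν T M n m h u ∈ tateCycles (dualResolution hν T) _ m ↔ u ∈ tateCocycles T M n := by
  change tensorD _ _ m (m - 1) _ = 0 ↔ homD T M (n + 1) n u = 0
  rw [tensorD_dualChain hν T n m (n + 1) (m - 1) h (by omega), units_smul_eq_zero_iff,
    LinearEquiv.map_eq_zero_iff]

theorem dualChain_mem_boundaries_iff (n m : ℤ) (h : n + m = -1) (u : T.X n →ₗ[Env k A] M) :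
    dualChain hν T M n m h u ∈ LinearMap.range
      (tensorD (dualResolution hν T) (Twist AlgEquiv.refl ν.symm M) (m + 1) m) ↔
      u ∈ LinearMap.range (homD T M n (n - 1)) := by
  have key := tensorD_dualChain (M := M) hν T (n - 1) (m + 1) n m (by omega) h
  constructor
  · rintro ⟨y, hy⟩
    obtain ⟨g, rfl⟩ := (dualChain hν T M (n - 1) (m + 1) (by omega)).surjective y
    rw [key] at hy
    refine ⟨(n - 1).negOnePow • g, (dualChain hν T M n m h).injective (Eq.trans ?_ hy)⟩
    exact (congrArg _ (map_units_smul' (homD T M n (n - 1)).toAddMonoidHom _ _)).trans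
      (map_units_smul' (dualChain hν T M n m h).toLinearMap.toAddMonoidHom _ _)
  · rintro ⟨g, rfl⟩
    refine ⟨(n - 1).negOnePow • dualChain hν T M (n - 1) (m + 1) (by omega) g, ?_⟩
    refine (map_units_smul' (tensorD (dualResolution hν T) (Twist AlgEquiv.refl ν.symm M)
      (m + 1) m).toAddMonoidHom _ _).trans ?_
    exact (congrArg _ (key g)).trans (units_smul_smul_self _ _)

end DualChain

/-! ## The fundamental class -/

section FundamentalClass

open CompleteResolution

variable {k : Type u} {A : Type v} [Field k] [Ring A] [Algebra k A] [FiniteDimensional k A]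
  {F : FrobeniusForm k A} {ν : A ≃ₐ[k] A} (hν : F.IsNakayama ν) (T : CompleteResolution k A)

variable {T} in
/-- A fundamental class is represented by the image, under a comparison `T' → T`, of the chain
that is dual to a representative of the unit. -/
theorem IsFundamentalClass.exists_chainMap
    {ω : TateHomology T (Twist AlgEquiv.refl ν.symm A) (-1)} (hω : IsFundamentalClass F ν T ω) :
    ∃ (θ : ChainMap (dualResolution hν T) T) (u : tateCocycles T A 0)
      (z : tateCycles T (Twist AlgEquiv.refl ν.symm A) (-1)),
      (∀ x, T.ε (θ.f 0 x) = (dualResolution hν T).ε x) ∧ TateCohomology.mk T A 0 u = tateOne T ∧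
        z.1 = θ.tensor _ (-1) (dualChain hν T A 0 (-1) (by norm_num) u.1) ∧
        TateHomology.mk T _ (-1) z = ω := by
  obtain ⟨θ, u, y, z, hu, hy, hz, hzω⟩ := hω
  obtain ⟨f, hf, hfθ⟩ := DualComparison.exists_chainMap hν T θ
  refine ⟨f, u, z, hf, hu, ?_, hzω⟩
  rw [hz, ← hy, dualChain_evalDual, ChainMap.tensor, EnvTensor.map_map, LinearMap.comp_id]
  congr 2
  exact LinearMap.ext fun x => (hfθ 0 (-1) (by norm_num) x).symm

/-- The class does not depend on the choices in the duality relation: two comparisons are homotopic,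
and two representatives of the unit differ by a coboundary. -/
theorem existsUnique_fundamentalClass (hν : F.IsNakayama ν) (T : CompleteResolution k A) :
    ∃! ω, IsFundamentalClass F ν T ω := by
  have hex : ∃ ω, IsFundamentalClass F ν T ω := by
    obtain ⟨θ⟩ := exists_dualComparison hν T
    obtain ⟨f, -, hfθ⟩ := DualComparison.exists_chainMap hν T θ
    obtain ⟨y, hy⟩ := (evalDual_bijective (X := T.X 0) (M := A) ν).2 (augmentationCocycle T).1
    have hz := f.tensor_mem (-1) ((dualChain_mem_cycles_iff hν T 0 (-1) (by norm_num) _).2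
      (augmentationCocycle T).2)
    refine ⟨_, θ, augmentationCocycle T, y, ⟨_, hz⟩, rfl, hy, ?_, rfl⟩
    change f.tensor _ (-1) (dualChain hν T A 0 (-1) (by norm_num) (augmentationCocycle T).1) = _
    rw [← hy, dualChain_evalDual, ChainMap.tensor, EnvTensor.map_map, LinearMap.comp_id]
    congr 2
    exact LinearMap.ext fun x => hfθ 0 (-1) (by norm_num) x
  obtain ⟨ω, hω⟩ := hex
  refine ⟨ω, hω, fun ω' hω' => ?_⟩
  obtain ⟨θ, u, z, hθ, hu, hz, rfl⟩ := hω.exists_chainMap hν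
  obtain ⟨θ', u', z', hθ', hu', hz', rfl⟩ := hω'.exists_chainMap hν
  have huu : u'.1 - u.1 ∈ LinearMap.range (homD T A 0 (0 - 1)) :=
    (Submodule.Quotient.eq (tateCoboundaries T A 0)).1 (hu'.trans hu.symm)
  refine (Submodule.Quotient.eq (tateBoundaries T (Twist AlgEquiv.refl ν.symm A) (-1))).2 ?_
  change z'.1 - z.1 ∈ LinearMap.range (tensorD T _ (-1 + 1) (-1))
  -- With `a`, `a'` dual to `u`, `u'`, the difference splits as `θ'(a') - θ(a) = θ'(a' - a) + (θ'(a)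
  -- - θ(a))`.
  have h₁ := θ'.tensor_boundary (-1)
    ((dualChain_mem_boundaries_iff hν T 0 (-1) (by norm_num) _).2 huu)
  have h₂ := θ'.sub_mem F θ (fun x => (hθ' x).trans (hθ x).symm) (-1)
    ((dualChain_mem_cycles_iff hν T 0 (-1) (by norm_num) u.1).2 u.2)
  rw [map_sub, map_sub] at h₁
  rw [hz, hz']
  have h₃ := add_mem h₁ h₂
  rwa [sub_add_sub_cancel] at h₃

end FundamentalClass

/-! ## The cap product with a cycle -/

section Naturality

variable {k : Type u} {A : Type v} [Field k] [Ring A] [Algebra k A]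
variable {M : Type*} [AddCommGroup M] [Module k M] [Module (Env k A) M]
  [IsScalarTower k (Env k A) M]
variable {M' : Type*} [AddCommGroup M'] [Module k M'] [Module (Env k A) M']
  [IsScalarTower k (Env k A) M']
variable {X : Type*} [AddCommGroup X] [Module k X] [Module (Env k A) X]
  [IsScalarTower k (Env k A) X]
variable {X' : Type*} [AddCommGroup X'] [Module k X'] [Module (Env k A) X']
  [IsScalarTower k (Env k A) X']
variable {Y : Type*} [AddCommGroup Y] [Module k Y] [Module (Env k A) Y]
  [IsScalarTower k (Env k A) Y]
variable {N : Type*} [AddCommGroup N] [Module k N] [Module (Env k A) N]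
  [IsScalarTower k (Env k A) N]

/-- A morphism of bimodules, regarded as a morphism of twisted bimodules. -/
def Twist.map (α β : A ≃ₐ[k] A) (g : M →ₗ[Env k A] M') :
    Twist α β M →ₗ[Env k A] Twist α β M' where
  toFun m := toTwist α β M' (g ((toTwist α β M).symm m))
  map_add' m m' := by simp
  map_smul' c m := g.map_smul (envMap k α β c) m

theorem Twist.map_toTwist (α β : A ≃ₐ[k] A) (g : M →ₗ[Env k A] M') (m : M) :
    Twist.map α β g (toTwist α β M m) = toTwist α β M' (g m) := rfl

theorem contract_comp (g : M →ₗ[Env k A] M') (u : Y →ₗ[Env k A] M)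
    (t : EnvTensor k A (ATensor k A X Y) N) :
    contract (g.comp u) t =
      EnvTensor.map LinearMap.id (ATensor.map g LinearMap.id) (contract u t) :=
  LinearMap.congr_fun (f := contract (g.comp u))
    (g := (EnvTensor.map LinearMap.id (ATensor.map g LinearMap.id)).comp (contract u))
    (contract_ext fun _ _ _ => rfl) t

theorem twistUnit_map (β : A ≃ₐ[k] A) (g : M →ₗ[Env k A] M')
    (t : ATensor k A M (Twist AlgEquiv.refl β A)) :
    twistUnit M' β (ATensor.map g LinearMap.id t) =
      Twist.map AlgEquiv.refl β g (twistUnit M β t) := by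
  induction t using ATensor.induction with
  | zero => simp
  | mk m a => exact (congrArg (toTwist AlgEquiv.refl β M') (g.map_smul _ _)).symm
  | add x y hx hy => simp only [map_add, hx, hy]

variable (ν : A ≃ₐ[k] A)

variable (X) in
/-- The isomorphism `X ⊗_{Aᵉ} _1(Aᵉ)_{ν⁻¹} → X`. -/
def envUnit : EnvTensor k A X (Twist AlgEquiv.refl ν.symm (Env k A)) →ₗ[k] X :=
  EnvTensor.lift
    (LinearMap.mk₂ k (fun x (c : Twist AlgEquiv.refl ν.symm (Env k A)) =>
        twistFlip ν ((toTwist AlgEquiv.refl ν.symm (Env k A)).symm c) • x)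
      (fun x x' c => smul_add _ _ _)
      (fun r x c => smul_comm _ _ _)
      (fun x c c' => by rw [map_add, map_add, add_smul])
      (fun r x c => by rw [map_smul, map_smul, smul_assoc]))
    (fun a b x c => by
      obtain ⟨c, rfl⟩ := (toTwist AlgEquiv.refl ν.symm (Env k A)).surjective c
      simp only [LinearMap.mk₂_apply, smul_toTwist, LinearEquiv.symm_apply_apply, envMap_env,
        smul_eq_mul, twistFlip_mul, twistFlip_env, AlgEquiv.apply_symm_apply, mul_smul]
      rfl)

theorem envUnit_mk (x : X) (c : Env k A) :
    envUnit X ν (EnvTensor.mk k A _ _ x (toTwist AlgEquiv.refl ν.symm (Env k A) c)) =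
      twistFlip ν c • x := rfl

theorem envUnit_map (d : X →ₗ[Env k A] X')
    (t : EnvTensor k A X (Twist AlgEquiv.refl ν.symm (Env k A))) :
    envUnit X' ν (EnvTensor.map d LinearMap.id t) = d (envUnit X ν t) := by
  induction t using EnvTensor.induction with
  | zero => simp
  | mk x c => exact (d.map_smul _ _).symm
  | add x y hx hy => simp only [map_add, hx, hy]

/-- Right multiplication on the coefficients `Aᵉ` becomes the left action on `X`. This gives the
`Aᵉ`-linearity of `capTerm`. -/
theorem envUnit_map_toSpanSingleton (c : Env k A)
    (t : EnvTensor k A X (Twist AlgEquiv.refl ν.symm (Env k A))) :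
    envUnit X ν (EnvTensor.map LinearMap.id
      (Twist.map _ _ (LinearMap.toSpanSingleton (Env k A) (Env k A) c)) t) =
        twistFlip ν c • envUnit X ν t := by
  induction t using EnvTensor.induction with
  | zero => simp
  | mk x c' =>
    obtain ⟨c', rfl⟩ := (toTwist AlgEquiv.refl ν.symm (Env k A)).surjective c'
    rw [EnvTensor.map_mk, Twist.map_toTwist, LinearMap.id_apply, envUnit_mk, envUnit_mk,
      LinearMap.toSpanSingleton_apply, smul_eq_mul, twistFlip_mul, mul_smul]
  | add x y hx hy => simp only [map_add, hx, hy, smul_add]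

theorem map_toSpanSingleton (m : M)
    (t : EnvTensor k A X (Twist AlgEquiv.refl ν.symm (Env k A))) :
    EnvTensor.map LinearMap.id (Twist.map _ _ (LinearMap.toSpanSingleton (Env k A) M m)) t =
      EnvTensor.mk k A X _ (envUnit X ν t) (toTwist AlgEquiv.refl ν.symm M m) := by
  induction t using EnvTensor.induction with
  | zero => simp
  | mk x c =>
    obtain ⟨c, rfl⟩ := (toTwist AlgEquiv.refl ν.symm (Env k A)).surjective c
    rw [EnvTensor.map_mk, Twist.map_toTwist, LinearMap.id_apply, envUnit_mk,
      LinearMap.toSpanSingleton_apply, mk_toTwist_smul]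
  | add x y hx hy => simp only [map_add, hx, hy, LinearMap.add_apply]

/-- Capping with the augmentation amounts to applying `id ⊗ ε` to the diagonal. -/
theorem map_twistUnit_contract_ε {T : CompleteResolution k A} (β : A ≃ₐ[k] A)
    (t : EnvTensor k A (ATensor k A X (T.X 0)) (Twist AlgEquiv.refl β A)) :
    EnvTensor.map LinearMap.id (twistUnit A β) (contract T.ε t) =
      EnvTensor.map (counitRight T X) LinearMap.id t := by
  refine LinearMap.congr_fun
    (f := (EnvTensor.map LinearMap.id (twistUnit A β)).comp (contract T.ε))
    (g := EnvTensor.map (counitRight T X) LinearMap.id) (contract_ext fun x y a => ?_) t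
  obtain ⟨a, rfl⟩ := (toTwist (k := k) AlgEquiv.refl β A).surjective a
  rw [EnvTensor.map_mk, counitRight_mk, EnvTensor.mk_smul, LinearMap.id_apply, smul_toTwist,
    envMap_env, env_smul_self, map_one, mul_one]
  change EnvTensor.mk k A X _ x (toTwist AlgEquiv.refl β A (env k 1 a • T.ε y)) = _
  rw [env_smul_self, one_mul]
  rfl

end Naturality

/-! ### The cap product with a cycle, reduced to coefficients in `Aᵉ` -/

section CapCycle

open CompleteResolution

variable {k : Type u} {A : Type v} [Field k] [Ring A] [Algebra k A] {T : CompleteResolution k A}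
  (Δ : DiagonalApproximation T) (ν : A ≃ₐ[k] A)
variable {M : Type w} [AddCommGroup M] [Module k M] [Module (Env k A) M]
  [IsScalarTower k (Env k A) M]
variable {M' : Type w'} [AddCommGroup M'] [Module k M'] [Module (Env k A) M']
  [IsScalarTower k (Env k A) M']

/-- The unsigned cap product with a chain `z ∈ T_s ⊗ _1 A_{ν⁻¹}`, with values in
`T_t ⊗ _1 M_{ν⁻¹}`. -/
def capTwist (t r s : ℤ) (h : t + r = s) (u : T.X r →ₗ[Env k A] M) :
    EnvTensor k A (T.X s) (Twist AlgEquiv.refl ν.symm A) →ₗ[k]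
      EnvTensor k A (T.X t) (Twist AlgEquiv.refl ν.symm M) :=
  (EnvTensor.map LinearMap.id (twistUnit M ν.symm)).comp (capUnsigned Δ t r s h u)

theorem capTwist_add (t r s : ℤ) (h : t + r = s) (u u' : T.X r →ₗ[Env k A] M) (z) :
    capTwist Δ ν t r s h (u + u') z = capTwist Δ ν t r s h u z + capTwist Δ ν t r s h u' z := by
  simp only [capTwist, LinearMap.comp_apply, capUnsigned_add, map_add]

theorem capTwist_comp (t r s : ℤ) (h : t + r = s) (g : M →ₗ[Env k A] M')
    (u : T.X r →ₗ[Env k A] M) (z) :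
    capTwist Δ ν t r s h (g.comp u) z =
      EnvTensor.map LinearMap.id (Twist.map _ _ g) (capTwist Δ ν t r s h u z) := by
  simp only [capTwist, capUnsigned, LinearMap.comp_apply, contract_comp, EnvTensor.map_map]
  congr 2
  exact LinearMap.ext fun t => twistUnit_map ν.symm g t

theorem tensorD_capTwist (p q s : ℤ) (h : p + 1 + q = s) (u : T.X q →ₗ[Env k A] M)
    {z : EnvTensor k A (T.X s) (Twist AlgEquiv.refl ν.symm A)} (hz : z ∈ tateCycles T _ s) :
    tensorD T _ (p + 1) p (capTwist Δ ν (p + 1) q s h u z) =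
      -(p.negOnePow • capTwist Δ ν p (q + 1) s (by omega) (homD T M (q + 1) q u) z) := by
  obtain ⟨m, rfl⟩ : ∃ m, s = m + 1 := ⟨s - 1, by omega⟩
  have hL := capUnsigned_leibniz Δ p q m (by omega) u z
  rw [(mem_tateCycles rfl).1 hz, map_zero] at hL
  rw [capTwist, LinearMap.comp_apply, tensorD_map, eq_neg_of_add_eq_zero_left hL.symm, map_neg]
  exact congrArg _ (map_units_smul' (EnvTensor.map LinearMap.id
    (twistUnit M ν.symm)).toAddMonoidHom _ _)

theorem capTwist_coboundary (t r s : ℤ) (h : t + r = s) {u : T.X r →ₗ[Env k A] M}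
    (hu : u ∈ LinearMap.range (homD T M r (r - 1)))
    {z : EnvTensor k A (T.X s) (Twist AlgEquiv.refl ν.symm A)} (hz : z ∈ tateCycles T _ s) :
    capTwist Δ ν t r s h u z ∈
      LinearMap.range (tensorD T (Twist AlgEquiv.refl ν.symm M) (t + 1) t) := by
  obtain ⟨q, rfl⟩ : ∃ q, r = q + 1 := ⟨r - 1, by omega⟩
  have hq : q + 1 - 1 = q := by omega
  rw [hq] at hu
  obtain ⟨g, rfl⟩ := hu
  have h₁ := units_smul_mem (LinearMap.range (tensorD T (Twist AlgEquiv.refl ν.symm M) (t + 1) t))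
    t.negOnePow (neg_mem (LinearMap.mem_range_self _
      (capTwist Δ ν (t + 1) q s (by omega) g z)))
  rwa [tensorD_capTwist Δ ν t q s (by omega) g hz, neg_neg, units_smul_smul_self] at h₁

/-- The map `T'_m → T_m` that induces the cap product with `z`. -/
def capTerm (t r s : ℤ) (h : t + r = s)
    (z : EnvTensor k A (T.X s) (Twist AlgEquiv.refl ν.symm A)) :
    TwistDual ν (T.X r) →ₗ[Env k A] T.X t where
  toFun f := envUnit (T.X t) ν (capTwist Δ ν t r s h (TwistDual.hom ν f) z)
  map_add' f g := by rw [map_add, capTwist_add, map_add]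
  map_smul' c f := by
    have h₁ : TwistDual.hom ν (c • f) = (LinearMap.toSpanSingleton (Env k A) (Env k A)
        (untwistFlip ν c)).comp (TwistDual.hom ν f) := rfl
    rw [h₁, capTwist_comp, envUnit_map_toSpanSingleton, twistFlip_untwistFlip, RingHom.id_apply]

theorem capTerm_apply (t r s : ℤ) (h : t + r = s)
    (z : EnvTensor k A (T.X s) (Twist AlgEquiv.refl ν.symm A)) (f : TwistDual ν (T.X r)) :
    capTerm Δ ν t r s h z f =
      envUnit (T.X t) ν (capTwist Δ ν t r s h (TwistDual.hom ν f) z) := rfl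

/-- An element `f ⊗ m` evaluates to the composite of `f : T_r → Aᵉ` with `Aᵉ → M`, `c ↦ cm`. By
naturality in the coefficients, the case `M = Aᵉ` therefore determines the cap product for every
`M`. -/
theorem map_capTerm (t r s : ℤ) (h : t + r = s)
    (z : EnvTensor k A (T.X s) (Twist AlgEquiv.refl ν.symm A))
    (y : EnvTensor k A (TwistDual ν (T.X r)) (Twist AlgEquiv.refl ν.symm M)) :
    EnvTensor.map (capTerm Δ ν t r s h z) LinearMap.id y =
      capTwist Δ ν t r s h (evalDual ν.symm (T.X r) M y) z := by
  have h₀ : capTwist Δ ν t r s h (0 : T.X r →ₗ[Env k A] M) z = 0 := by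
    have := capTwist_add Δ ν t r s h (0 : T.X r →ₗ[Env k A] M) 0 z
    rwa [add_zero, left_eq_add] at this
  induction y using EnvTensor.induction with
  | zero => rw [map_zero, map_zero, h₀]
  | mk f m =>
    obtain ⟨m, rfl⟩ := (toTwist AlgEquiv.refl ν.symm M).surjective m
    have h₁ : evalDual ν.symm (T.X r) M (EnvTensor.mk k A _ _ f (toTwist AlgEquiv.refl ν.symm M m)) =
      (LinearMap.toSpanSingleton (Env k A) M m).comp (TwistDual.hom ν f) := rfl
    rw [h₁, capTwist_comp, map_toSpanSingleton]
    rfl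
  | add x y hx hy => rw [map_add, map_add, capTwist_add, hx, hy]

theorem d_capTerm (p q s : ℤ) (h : p + 1 + q = s)
    {z : EnvTensor k A (T.X s) (Twist AlgEquiv.refl ν.symm A)} (hz : z ∈ tateCycles T _ s)
    (f : TwistDual ν (T.X q)) :
    T.d (p + 1) p (capTerm Δ ν (p + 1) q s h z f) =
      -(p.negOnePow • capTerm Δ ν p (q + 1) s (by omega) z
        (TwistDual.transpose ν (T.d (q + 1) q) f)) := by
  rw [capTerm_apply, ← envUnit_map]
  refine (congrArg (envUnit (T.X p) ν)
    (tensorD_capTwist Δ ν p q s h (TwistDual.hom ν f) hz)).trans ?_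
  rw [map_neg]
  exact congrArg _ (map_units_smul' (envUnit (T.X p) ν).toAddMonoidHom _ _)

end CapCycle

/-! ### The chain map `T' → T` behind the cap product -/

section CapChainMap

open CompleteResolution

variable {k : Type u} {A : Type v} [Field k] [Ring A] [Algebra k A] [FiniteDimensional k A]
  {T : CompleteResolution k A} (Δ : DiagonalApproximation T)
  {F : FrobeniusForm k A} {ν : A ≃ₐ[k] A} (hν : F.IsNakayama ν)
variable {M : Type w} [AddCommGroup M] [Module k M] [Module (Env k A) M]
  [IsScalarTower k (Env k A) M]

/-- The cap product with a cycle of degree `-1` is induced by a chain map `T' → T`. -/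
theorem exists_capChainMap {z : EnvTensor k A (T.X (-1)) (Twist AlgEquiv.refl ν.symm A)}
    (hz : z ∈ tateCycles T _ (-1)) :
    ∃ ψ : ChainMap (dualResolution hν T) T, ∀ n m (h : n + m = -1) x,
      ψ.f m (dualTerm hν T n m h x) =
        (m + 1).negOnePow • capTerm Δ ν m n (-1) (by omega) z x := by
  -- The Leibniz rule gives `d` the sign `-(-1)ʲ`, while the differential of `T'` carries `(-1)ⁿ =
  -- (-1)ʲ`. An alternating sign corrects this; `(-1)^(m + 1)` is normalised to be `1` in degree
  -- `-1`.
  let g : ∀ m, (dualResolution hν T).X m →ₗ[Env k A] T.X m := fun m =>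
    ((m + 1).negOnePow • capTerm Δ ν m (-1 - m) (-1) (by omega) z).comp
      (dualTerm hν T (-1 - m) m (by omega)).symm.toLinearMap
  have hg : ∀ n m (h : n + m = -1) x, g m (dualTerm hν T n m h x) =
      (m + 1).negOnePow • capTerm Δ ν m n (-1) (by omega) z x := by
    intro n m h x
    obtain rfl : n = -1 - m := by omega
    exact congrArg (fun y => (m + 1).negOnePow • capTerm Δ ν m (-1 - m) (-1) (by omega) z y)
      ((dualTerm hν T (-1 - m) m h).symm_apply_apply x)
  refine ⟨⟨g, ?_⟩, hg⟩
  rintro _ j rfl x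
  obtain ⟨n, hn⟩ : ∃ n, n = -1 - (j + 1) := ⟨_, rfl⟩
  obtain ⟨x, rfl⟩ := (dualTerm hν T n (j + 1) (by omega)).surjective x
  rw [hg, dualTerm_d hν T n (j + 1) (n + 1) j (by omega) (by omega)]
  refine (map_units_smul' (T.d (j + 1) j).toAddMonoidHom _ _).trans ?_
  refine Eq.trans ?_ (map_units_smul' (g j).toAddMonoidHom _ _).symm
  refine (congrArg _ (d_capTerm Δ ν j n (-1) (by omega) hz x)).trans ?_
  refine Eq.trans ?_ (congrArg _ (hg (n + 1) j (by omega) _)).symm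
  have hs : n.negOnePow = j.negOnePow := by
    rw [hn, Int.negOnePow_eq_iff]
    exact ⟨-1 - j, by ring⟩
  rw [hs, Int.negOnePow_succ, Int.negOnePow_succ, neg_neg, Units.neg_smul, smul_neg]

theorem capChainMap_tensor {z : EnvTensor k A (T.X (-1)) (Twist AlgEquiv.refl ν.symm A)}
    {ψ : ChainMap (dualResolution hν T) T}
    (hψ : ∀ n m (h : n + m = -1) x, ψ.f m (dualTerm hν T n m h x) =
        (m + 1).negOnePow • capTerm Δ ν m n (-1) (by omega) z x)
    (n m : ℤ) (h : n + m = -1) (u : T.X n →ₗ[Env k A] M) :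
    ψ.tensor _ m (dualChain hν T M n m h u) =
      (m + 1).negOnePow • capTwist Δ ν m n (-1) (by omega) u z := by
  obtain ⟨y, rfl⟩ := (evalDual_bijective (X := T.X n) (M := M) ν).2 u
  rw [dualChain_evalDual, ChainMap.tensor, EnvTensor.map_map, LinearMap.comp_id, ← map_capTerm,
    ← EnvTensor.map_units_smul_left]
  congr 2
  exact LinearMap.ext fun x => hψ n m h x

end CapChainMap

/-! ### The unit acts as the identity -/

section CapUnit

open CompleteResolution

variable {k : Type u} {A : Type v} [Field k] [Ring A] [Algebra k A]
  {T : CompleteResolution k A} (Δ : DiagonalApproximation T)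

theorem counitRight_map_d {X : Type*} [AddCommGroup X] [Module k X] [Module (Env k A) X]
    [IsScalarTower k (Env k A) X] (t : ATensor k A X (T.X 1)) :
    counitRight T X (ATensor.map LinearMap.id (T.d 1 0) t) = 0 := by
  induction t using ATensor.induction with
  | zero => simp
  | mk x y =>
    rw [ATensor.map_mk, counitRight_mk, ε_d, show env k (1 : A) 0 = 0 from
      TensorProduct.tmul_zero _ _, zero_smul]
  | add x y hx hy => rw [map_add, map_add, hx, hy, add_zero]

/-- The chain map `(id ⊗ ε) Δ`. -/
def DiagonalApproximation.counit : ChainMap T T where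
  f n := (counitRight T (T.X n)).comp (Δ.component n 0 (add_zero n))
  comm i j hj x := by
    subst hj
    -- In the component `(j, 0)` of the chain map condition, the second summand dies under `id ⊗ ε`
    -- because `ε d = 0`.
    have h := congrFun (Δ.comm (j + 1) j rfl x) ⟨(j, 0), add_zero j⟩
    have h' : ATensor.map (T.d (j + 1) j) LinearMap.id
        (Δ.component (j + 1) 0 (add_zero (j + 1)) x) + j.negOnePow •
          ATensor.map LinearMap.id (T.d 1 0) (Δ.component (n := j + 1) j 1 rfl x) =
        Δ.component j 0 (add_zero j) (T.d (j + 1) j x) := h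
    rw [LinearMap.comp_apply, LinearMap.comp_apply, ← h', map_add, counitRight_map, left_eq_add]
    exact (map_units_smul' (counitRight T (T.X j)).toAddMonoidHom _ _).trans
      ((congrArg _ (counitRight_map_d _)).trans (smul_zero _))

theorem DiagonalApproximation.ε_counit (x : T.X 0) : T.ε (Δ.counit.f 0 x) = T.ε x := by
  have h := (map_ε_ε (Δ.component 0 0 rfl x)).symm.trans (Δ.augmentation x)
  have h' := congrArg (rightUnit (k := k) A) h
  rw [rightUnit_mk, rightUnit_mk, env_one, one_smul, one_smul] at h'
  exact h'

variable [FiniteDimensional k A]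

/-- The unit `1 ⌢ z = z` of the cap product. -/
theorem capTwist_ε (F : FrobeniusForm k A) (ν : A ≃ₐ[k] A)
    {z : EnvTensor k A (T.X (-1)) (Twist AlgEquiv.refl ν.symm A)}
    (hz : z ∈ tateCycles T _ (-1)) :
    capTwist Δ ν (-1) 0 (-1) (by norm_num) T.ε z - z ∈
      LinearMap.range (tensorD T (Twist AlgEquiv.refl ν.symm A) (-1 + 1) (-1)) := by
  -- The chain map `(id ⊗ ε)Δ` preserves the augmentation, so it is homotopic to the identity.
  have h := ChainMap.sub_mem F Δ.counit (ChainMap.id T) Δ.ε_counit (-1) hz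
  rw [ChainMap.tensor_id] at h
  have h₁ : Δ.counit.tensor _ (-1) z = capTwist Δ ν (-1) 0 (-1) (by norm_num) T.ε z := by
    rw [capTwist, capUnsigned, LinearMap.comp_apply, LinearMap.comp_apply,
      map_twistUnit_contract_ε, EnvTensor.map_map, LinearMap.comp_id]
    rfl
  rwa [h₁] at h

end CapUnit

/-! ## The cap product with the fundamental class -/

section Central

open CompleteResolution

variable {k : Type u} {A : Type v} [Field k] [Ring A] [Algebra k A]
  {S T : CompleteResolution k A}

variable (k) in
/-- Multiplication by a central element, as a morphism of bimodules. -/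
def centralMul {c : A} (hc : ∀ a, a * c = c * a) (X : Type w) [AddCommGroup X]
    [Module (Env k A) X] : X →ₗ[Env k A] X where
  toFun x := env k c 1 • x
  map_add' := smul_add _
  map_smul' d x := map_env_smul (AddMonoidHom.mk' (fun x : X => env k c 1 • x) (smul_add _))
    (fun a b x => by
      change env k c 1 • env k a b • x = env k a b • env k c 1 • x
      rw [← mul_smul, ← mul_smul, env_mul, env_mul, hc, mul_one, one_mul]) d x

theorem centralMul_apply {c : A} (hc : ∀ a, a * c = c * a) {X : Type w} [AddCommGroup X]
    [Module (Env k A) X] (x : X) : centralMul k hc X x = env k c 1 • x := rfl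

theorem centralMul_self {c : A} (hc : ∀ a, a * c = c * a) (a : A) :
    centralMul k hc A a = c * a := by
  rw [centralMul_apply, env_smul_self, mul_one]

/-- Multiplication by a central element, as a chain map. -/
def CompleteResolution.ChainMap.central {c : A} (hc : ∀ a, a * c = c * a)
    (T : CompleteResolution k A) : ChainMap T T where
  f n := centralMul k hc (T.X n)
  comm i j _ x := (T.d i j).map_smul (env k c 1) x

/-- A cocycle `T₀ → A` factors through the augmentation, and is given by a central element. -/
theorem exists_central_of_comp_d (u : T.X 0 →ₗ[Env k A] A) (hu : ∀ x, u (T.d 1 0 x) = 0) :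
    ∃ c : A, (∀ a, a * c = c * a) ∧ ∀ x, u x = c * T.ε x := by
  let g : A →ₗ[Env k A] A := ((LinearMap.ker T.ε).liftQ u (fun x hx => by
      obtain ⟨y, rfl⟩ := (T.ε_exact x).1 hx
      exact hu y)).comp
    (T.ε.quotKerEquivOfSurjective T.ε_surjective).symm.toLinearMap
  have hg : ∀ x, g (T.ε x) = u x := fun x => by
    have h : (T.ε.quotKerEquivOfSurjective T.ε_surjective).symm (T.ε x) =
        (LinearMap.ker T.ε).mkQ x := by
      rw [LinearEquiv.symm_apply_eq]
      rfl
    simp only [g, LinearMap.comp_apply, LinearEquiv.coe_coe, h]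
    rfl
  -- A bimodule endomorphism of `A` is right and left multiplication by its value at `1`, which is
  -- therefore central.
  have h₁ : ∀ a, g a = a * g 1 := fun a => by
    have h := g.map_smul (env k a 1) 1
    rwa [env_smul_self, env_smul_self, mul_one, mul_one, mul_one] at h
  have h₂ : ∀ a, g a = g 1 * a := fun a => by
    have h := g.map_smul (env k 1 a) 1
    rwa [env_smul_self, env_smul_self, one_mul, one_mul, one_mul] at h
  exact ⟨g 1, fun a => (h₁ a).symm.trans (h₂ a), fun x => by rw [← h₂, hg]⟩

end Central

/-! ### Comparison of the cap product with the duality isomorphism -/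

section Main

open CompleteResolution

variable {k : Type u} {A : Type v} [Field k] [Ring A] [Algebra k A] [FiniteDimensional k A]
  {T : CompleteResolution k A} (Δ : DiagonalApproximation T)
  {F : FrobeniusForm k A} {ν : A ≃ₐ[k] A} (hν : F.IsNakayama ν)

/-- A central element acts on `Hom_{Aᵉ}(T, A)` as on the dual chains. -/
theorem central_tensor_dualChain {c : A} (hc : ∀ a, a * c = c * a) (n m : ℤ) (h : n + m = -1)
    (u : T.X n →ₗ[Env k A] A) :
    (ChainMap.central hc (dualResolution hν T)).tensor _ m (dualChain hν T A n m h u) =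
      dualChain hν T A n m h ((centralMul k hc A).comp u) := by
  obtain ⟨y, rfl⟩ := (evalDual_bijective (X := T.X n) (M := A) ν).2 u
  have hy : (centralMul k hc A).comp (evalDual ν.symm (T.X n) A y) =
      evalDual ν.symm (T.X n) A
        (EnvTensor.map (centralMul k hc (TwistDual ν (T.X n))) LinearMap.id y) := by
    induction y using EnvTensor.induction with
    | zero => simp
    | add x y hx hy => simp only [map_add, LinearMap.comp_add, hx, hy]
    | mk f a =>
      obtain ⟨a, rfl⟩ := (toTwist (k := k) AlgEquiv.refl ν.symm A).surjective a
      ext x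
      -- The Nakayama automorphism fixes the centre, so the twist on the dual does not change `c`.
      have hνc : ν.symm c = c := by
        rw [AlgEquiv.symm_apply_eq, hν.apply_of_central hc]
      have hf : TwistDual.hom ν (centralMul k hc (TwistDual ν (T.X n)) f) x =
          TwistDual.hom ν f x * env k 1 c := by
        rw [centralMul_apply, TwistDual.smul_hom_apply, untwistFlip_env, hνc]
      rw [EnvTensor.map_mk, LinearMap.id_apply, evalDual_mk_apply, LinearMap.comp_apply,
        evalDual_mk_apply, hf, mul_smul, map_smul, centralMul_self, env_smul_self, one_mul, hc]
  rw [hy, dualChain_evalDual, dualChain_evalDual, ChainMap.tensor, EnvTensor.map_map,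
    EnvTensor.map_map]
  congr 2
  exact LinearMap.ext fun f => ((dualTerm hν T n m h).map_smul (env k c 1) f).symm

/-- The chain map that induces the cap product with a fundamental class is homotopic to a
comparison of complete resolutions. -/
theorem capChainMap_sub_mem {θ ψ : ChainMap (dualResolution hν T) T}
    (hθ : ∀ x, T.ε (θ.f 0 x) = (dualResolution hν T).ε x)
    {u : tateCocycles T A 0} (hu : TateCohomology.mk T A 0 u = tateOne T)
    {z : EnvTensor k A (T.X (-1)) (Twist AlgEquiv.refl ν.symm A)}
    (hzc : z ∈ tateCycles T _ (-1))
    (hz : z = θ.tensor _ (-1) (dualChain hν T A 0 (-1) (by norm_num) u.1))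
    (hψ : ∀ n m (h : n + m = -1) x, ψ.f m (dualTerm hν T n m h x) =
        (m + 1).negOnePow • capTerm Δ ν m n (-1) (by omega) z x)
    {N : Type w} [AddCommGroup N] [Module k N] [Module (Env k A) N] [IsScalarTower k (Env k A) N]
    (n : ℤ) {y : EnvTensor k A ((dualResolution hν T).X n) N}
    (hy : y ∈ tateCycles (dualResolution hν T) N n) :
    ψ.tensor N n y - θ.tensor N n y ∈ LinearMap.range (tensorD T N (n + 1) n) := by
  obtain ⟨c, hc, hcψ⟩ := exists_central_of_comp_d (T.ε.comp (ψ.f 0)) (fun x => by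
    rw [LinearMap.comp_apply, ← ψ.comm 1 0 (by norm_num), ε_d])
  -- `ψ` and `cθ` have the same augmentation and are thus homotopic; the rest of the proof compares
  -- `cθ` with `θ`.
  let θc : ChainMap (dualResolution hν T) T := (ChainMap.central hc T).comp θ
  have hθc : ∀ x, T.ε (θc.f 0 x) = c * T.ε (θ.f 0 x) := fun x =>
    (T.ε.map_smul (env k c 1) (θ.f 0 x)).trans (centralMul_self hc _)
  have hψθ : ∀ x, T.ε (ψ.f 0 x) = T.ε (θc.f 0 x) := fun x =>
    (hcψ x).trans (by rw [hθc, hθ])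
  set a := dualChain hν T A 0 (-1) (by norm_num) u.1 with ha
  have hac : a ∈ tateCycles (dualResolution hν T) _ (-1) :=
    (dualChain_mem_cycles_iff hν T 0 (-1) (by norm_num) _).2 u.2
  have huε : u.1 - T.ε ∈ LinearMap.range (homD T A 0 (0 - 1)) :=
    (Submodule.Quotient.eq (tateCoboundaries T A 0)).1 hu
  -- In degree `-1` the map `ψ` carries no sign, so `ψ(a)` is the cap product of `u` with `z`. As
  -- `u` is cohomologous to `ε`, it is homologous to `z`.
  have h₁ : ψ.tensor _ (-1) a - z ∈
      LinearMap.range (tensorD T (Twist AlgEquiv.refl ν.symm A) (-1 + 1) (-1)) := by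
    have e₁ : ψ.tensor _ (-1) a = capTwist Δ ν (-1) 0 (-1) (by norm_num) u.1 z := by
      rw [ha, capChainMap_tensor Δ hν hψ]
      exact one_smul _ _
    have e₂ := capTwist_add Δ ν (-1) 0 (-1) (by norm_num) (u.1 - T.ε) T.ε z
    rw [sub_add_cancel] at e₂
    rw [e₁, e₂, add_sub_assoc]
    exact add_mem (capTwist_coboundary Δ ν (-1) 0 (-1) (by norm_num) huε hzc)
      (capTwist_ε Δ F ν hzc)
  have h₂ : θc.tensor _ (-1) a - θ.tensor _ (-1) a ∈
      LinearMap.range (tensorD T (Twist AlgEquiv.refl ν.symm A) (-1 + 1) (-1)) := by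
    have h := sub_mem h₁ (ψ.sub_mem F θc hψθ (-1) hac)
    rwa [sub_sub_sub_cancel_left, hz] at h
  -- A homotopy inverse `φ` of `θ` moves the relation `cθ(a) ~ θ(a)` back to `T'`, where it becomes
  -- `ca ~ a`.
  obtain ⟨φ, hφ⟩ := exists_chainMap F T (dualResolution hν T)
  have h₃ : ∀ x, (dualResolution hν T).ε ((φ.comp θ).f 0 x) =
      (dualResolution hν T).ε ((ChainMap.id _).f 0 x) := fun x =>
    (hφ _).trans (hθ x)
  have h₄ : ∀ x, (dualResolution hν T).ε ((φ.comp θc).f 0 x) =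
      (dualResolution hν T).ε ((ChainMap.central hc _).f 0 x) := fun x =>
    (hφ _).trans ((hθc x).trans ((congrArg (c * ·) (hθ x)).trans ((centralMul_self hc _).symm.trans
      ((dualResolution hν T).ε.map_smul (env k c 1) x).symm)))
  have h₅ : (ChainMap.central hc _).tensor _ (-1) a - a ∈ LinearMap.range
      (tensorD (dualResolution hν T) (Twist AlgEquiv.refl ν.symm A) (-1 + 1) (-1)) := by
    have e₁ := φ.tensor_boundary (-1) h₂
    have e₂ := ChainMap.sub_mem F _ _ h₃ (-1) hac
    have e₃ := ChainMap.sub_mem F _ _ h₄ (-1) hac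
    rw [ChainMap.tensor_comp, ChainMap.tensor_id] at e₂
    rw [ChainMap.tensor_comp] at e₃
    rw [map_sub] at e₁
    have e := add_mem (sub_mem e₁ e₃) e₂
    rwa [sub_sub_sub_cancel_left, sub_add_sub_cancel] at e
  have h₆ : (centralMul k hc A).comp u.1 - u.1 ∈ LinearMap.range (homD T A 0 (0 - 1)) := by
    rwa [ha, central_tensor_dualChain hν hc, ← map_sub, dualChain_mem_boundaries_iff] at h₅
  obtain ⟨w₁, hw₁⟩ := huε
  obtain ⟨w₂, hw₂⟩ := h₆
  have hw₁' : ∀ x, w₁ (T.d 0 (-1) x) = u.1 x - T.ε x := LinearMap.congr_fun hw₁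
  have hw₂' : ∀ x, w₂ (T.d 0 (-1) x) = c * u.1 x - u.1 x := fun x =>
    (LinearMap.congr_fun hw₂ x).trans (by
      rw [LinearMap.sub_apply, LinearMap.comp_apply, centralMul_self])
  -- From `w₁ d₀ = u - ε` and `w₂ d₀ = cu - u` one gets `(w₂ - c w₁ + w₁) d₀ = cε - ε`. Composition
  -- with `θ` gives the factorisation needed for `cθ ≃ θ`.
  let w : (dualResolution hν T).X (-1) →ₗ[Env k A] A :=
    (w₂ - (centralMul k hc A).comp w₁ + w₁).comp (θ.f (-1))
  have hw : ∀ x, T.ε (θc.f 0 x) - T.ε (θ.f 0 x) = w ((dualResolution hν T).d 0 (-1) x) := by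
    intro x
    have e : w ((dualResolution hν T).d 0 (-1) x) =
        (w₂ - (centralMul k hc A).comp w₁ + w₁) (T.d 0 (-1) (θ.f 0 x)) :=
      congrArg (w₂ - (centralMul k hc A).comp w₁ + w₁) (θ.comm 0 (-1) (by norm_num) x).symm
    rw [e, hθc, LinearMap.add_apply, LinearMap.sub_apply, LinearMap.comp_apply]
    refine Eq.trans ?_ (congrArg₂ _ (congrArg₂ _ (hw₂' _).symm
      ((congrArg _ (hw₁' _).symm).trans rfl)) (hw₁' _).symm)
    rw [centralMul_self, mul_sub]
    abel
  have h₇ := ChainMap.sub_mem_of_ε F θc θ w hw n hy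
  have h₈ := ψ.sub_mem F θc hψθ n hy
  have h := add_mem h₈ h₇
  rwa [sub_add_sub_cancel] at h

/-- On cycles the cap product is, up to sign, the duality map followed by `ψ`. Since `ψ` agrees with
`θ` on homology and `θ` has the homotopy inverse `φ`, both injectivity and surjectivity follow. -/
theorem capWith_bijective {ω : TateHomology T (Twist AlgEquiv.refl ν.symm A) (-1)}
    (hν : F.IsNakayama ν) (hω : IsFundamentalClass F ν T ω) (n : ℤ) (M : Type w) [AddCommGroup M]
    [Module k M] [Module (Env k A) M] [IsScalarTower k (Env k A) M] :
    Function.Bijective (capWith Δ ν.symm ω n M) := by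
  obtain ⟨θ, u₀, z, hθ, hu₀, hz, rfl⟩ := hω.exists_chainMap hν
  obtain ⟨ψ, hψ⟩ := exists_capChainMap Δ hν z.2
  obtain ⟨φ, hφ⟩ := exists_chainMap F T (dualResolution hν T)
  have hm : n + (-n - 1) = -1 := by omega
  -- The sign combines the one in the cap product with the one in `ψ`. It depends only on `n` and is
  -- irrelevant for bijectivity.
  have hcap : ∀ u : tateCocycles T M n, ∃ (e : ℤˣ) (hy : ψ.tensor _ (-n - 1)
      (dualChain hν T M n (-n - 1) hm u.1) ∈ tateCycles T _ (-n - 1)),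
      capWith Δ ν.symm (TateHomology.mk T _ (-1) z) n M (TateCohomology.mk T M n u) =
        e • TateHomology.mk T _ (-n - 1) ⟨_, hy⟩ := by
    intro u
    refine ⟨(n * (-n - 1)).negOnePow * (-n - 1 + 1).negOnePow,
      ψ.tensor_mem _ ((dualChain_mem_cycles_iff hν T n (-n - 1) hm _).2 u.2), ?_⟩
    refine Eq.trans ?_ (map_units_smul' (TateHomology.mk T _ (-n - 1)).toAddMonoidHom _ _)
    change TateHomology.mk T _ (-n - 1) ⟨EnvTensor.map LinearMap.id (twistUnit M ν.symm)
      (capChain Δ (-n - 1) n (-1) (by omega) u.1 z.1), _⟩ = _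
    refine congrArg (TateHomology.mk T (Twist AlgEquiv.refl ν.symm M) (-n - 1)) (Subtype.ext ?_)
    refine Eq.trans ?_ (map_units_smul'
      (tateCycles T (Twist AlgEquiv.refl ν.symm M) (-n - 1)).subtype.toAddMonoidHom _ _).symm
    change EnvTensor.map LinearMap.id (twistUnit M ν.symm)
      ((n * (-n - 1)).negOnePow • capUnsigned Δ (-n - 1) n (-1) (by omega) u.1 z.1) =
        ((n * (-n - 1)).negOnePow * (-n - 1 + 1).negOnePow) •
          ψ.tensor _ (-n - 1) (dualChain hν T M n (-n - 1) hm u.1)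
    rw [capChainMap_tensor Δ hν hψ, mul_smul, units_smul_smul_self]
    exact map_units_smul' (EnvTensor.map LinearMap.id (twistUnit M ν.symm)).toAddMonoidHom _ _
  have hψθ : ∀ {y : EnvTensor k A ((dualResolution hν T).X (-n - 1))
      (Twist AlgEquiv.refl ν.symm M)}, y ∈ tateCycles (dualResolution hν T) _ (-n - 1) →
      ψ.tensor _ (-n - 1) y - θ.tensor _ (-n - 1) y ∈ LinearMap.range
        (tensorD T (Twist AlgEquiv.refl ν.symm M) (-n - 1 + 1) (-n - 1)) := fun hy =>
    capChainMap_sub_mem Δ hν hθ hu₀ z.2 hz hψ (-n - 1) hy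
  constructor
  · rw [← LinearMap.ker_eq_bot, LinearMap.ker_eq_bot']
    intro x hx
    obtain ⟨u, rfl⟩ := (tateCoboundaries T M n).mkQ_surjective x
    obtain ⟨e, hy, he⟩ := hcap u
    rw [show (tateCoboundaries T M n).mkQ u = TateCohomology.mk T M n u from rfl, he,
      units_smul_eq_zero_iff] at hx
    have h₁ : ψ.tensor _ (-n - 1) (dualChain hν T M n (-n - 1) hm u.1) ∈ LinearMap.range
        (tensorD T (Twist AlgEquiv.refl ν.symm M) (-n - 1 + 1) (-n - 1)) :=
      (Submodule.Quotient.mk_eq_zero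
        (tateBoundaries T (Twist AlgEquiv.refl ν.symm M) (-n - 1))).1 hx
    have hu := (dualChain_mem_cycles_iff hν T n (-n - 1) hm u.1).2 u.2
    have h₂ := sub_mem h₁ (hψθ hu)
    rw [sub_sub_cancel] at h₂
    have h₃ := ChainMap.sub_mem F (φ.comp θ) (ChainMap.id _)
      (fun x => (hφ _).trans (hθ x)) (-n - 1) hu
    rw [ChainMap.tensor_comp, ChainMap.tensor_id] at h₃
    have h₄ := sub_mem (φ.tensor_boundary (-n - 1) h₂) h₃
    rw [sub_sub_cancel, dualChain_mem_boundaries_iff] at h₄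
    exact (Submodule.Quotient.mk_eq_zero (tateCoboundaries T M n)).2 h₄
  · intro x
    obtain ⟨t, rfl⟩ := (tateBoundaries T (Twist AlgEquiv.refl ν.symm M) (-n - 1)).mkQ_surjective x
    -- The preimage of a cycle is found by moving it to `T'` along `φ` and reading the result as a
    -- cochain.
    obtain ⟨u, hu⟩ := (dualChain hν T M n (-n - 1) hm).surjective (φ.tensor _ (-n - 1) t.1)
    have hcyc := φ.tensor_mem (-n - 1) t.2
    have huc : u ∈ tateCocycles T M n := by
      rw [← dualChain_mem_cycles_iff hν T n (-n - 1) hm, hu]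
      exact hcyc
    obtain ⟨e, hy, he⟩ := hcap ⟨u, huc⟩
    have h₁ : TateHomology.mk T _ (-n - 1) ⟨_, hy⟩ =
        (tateBoundaries T (Twist AlgEquiv.refl ν.symm M) (-n - 1)).mkQ t := by
      refine (Submodule.Quotient.eq
        (tateBoundaries T (Twist AlgEquiv.refl ν.symm M) (-n - 1))).2 ?_
      change ψ.tensor _ (-n - 1) (dualChain hν T M n (-n - 1) hm u) - t.1 ∈
        LinearMap.range (tensorD T (Twist AlgEquiv.refl ν.symm M) (-n - 1 + 1) (-n - 1))
      have h₂ := ChainMap.sub_mem F (θ.comp φ) (ChainMap.id _)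
        (fun x => (hθ _).trans (hφ x)) (-n - 1) t.2
      rw [ChainMap.tensor_comp, ChainMap.tensor_id] at h₂
      have h₃ := add_mem (hψθ hcyc) h₂
      rwa [sub_add_sub_cancel, ← hu] at h₃
    rw [h₁] at he
    -- The sign is its own inverse, so multiplying the preimage by it cancels the sign of the cap
    -- product.
    refine ⟨e • TateCohomology.mk T M n ⟨u, huc⟩, ?_⟩
    have h₂ := map_units_smul' (capWith Δ ν.symm (TateHomology.mk T _ (-1) z) n M).toAddMonoidHom
      e (TateCohomology.mk T M n ⟨u, huc⟩)
    exact h₂.trans ((congrArg (e • ·) he).trans (units_smul_smul_self _ _))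

end Main

end TateHochschild

end

theorem theorem4p1 {k : Type u} {A : Type v} [Field k] [Ring A] [Algebra k A]
    [FiniteDimensional k A] (F : TateHochschild.FrobeniusForm k A) (ν : A ≃ₐ[k] A)
    (hν : F.IsNakayama ν) :
    Nonempty (TateHochschild.CompleteResolution k A) ∧
    ∀ T : TateHochschild.CompleteResolution k A,
      Nonempty (TateHochschild.DiagonalApproximation T) ∧
      (∃! ω, TateHochschild.IsFundamentalClass F ν T ω) ∧
      ∀ (Δ : TateHochschild.DiagonalApproximation T)
        (ω : TateHochschild.TateHomology T (TateHochschild.Twist AlgEquiv.refl ν.symm A) (-1)),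
        TateHochschild.IsFundamentalClass F ν T ω →
        ∀ (n : ℤ) (M : Type w) [AddCommGroup M] [Module k M] [Module (TateHochschild.Env k A) M]
          [IsScalarTower k (TateHochschild.Env k A) M],
          Function.Bijective (TateHochschild.capWith Δ ν.symm ω n M) :=
  ⟨TateHochschild.exists_completeResolution F, fun T =>
    ⟨TateHochschild.exists_diagonalApproximation F T,
      TateHochschild.existsUnique_fundamentalClass hν T,
      fun Δ _ hω n M _ _ _ _ => TateHochschild.capWith_bijective Δ hν hω n M⟩⟩
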